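/- Let $n\ge 1$, let $\theta_1,\dots,\theta_n\in(0,\pi)$, let $h_\theta=\mathrm{diag}(e^{i\theta},e^{-i\theta})\in \mathrm{SU}(2)$ and $U(1)=\{h_\theta\}$, and let $dg$ be the normalized Haar measure of $\mathrm{SU}(2)$. Call $(g_1,\dots,g_n)\in \mathrm{SU}(2)^n$ a flat configuration if $g_p$ is conjugate to $h_{\theta_p}$ for every $p$ and $g_1\cdots g_n=1$; call it irreducible if some $g_p,g_q$ do not commute. Assume that $n\ge4$ or that every flat configuration (if there is any) is irreducible. Triangulate the sphere with the vertices $N,S,v_1,\dots,v_n$ and the $2n$ triangles $(N,v_p,v_{p+1})$, $(S,v_p,v_{p+1})$ ($p$ mod $n$), and let $\Gamma$ be the dual graph, with its $3n$ edges. Triangulate the cylinder $\Sigma\times I$ over it by cutting the prism over each triangle $(a,b,c)$ into the three tetrahedra $(a,b,c,c')$, $(a,b,b',c')$, $(a,a',b',c')$ ($6n$ tetrahedra, all vertices on the boundary); $n$ spinless particles move along the vertical edges $v_pv_p'$. Let $\Delta^*$ be the dual 2-complex, including the dual graphs $\Gamma_i,\Gamma_f\cong\Gamma$ of the two boundary components,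 and let $G_f$ be the holonomy around a dual face $f$. A spin network state is a gauge-invariant function on $\mathrm{SU}(2)^{3n}$ that is a finite linear combination of products, over the edges of $\Gamma$, of matrix elements of irreducible representations of $\mathrm{SU}(2)$. For spin network states $\Phi_i,\Phi_f$ and a maximal tree $T^*$ of the 1-skeleton of $\Delta^*$ the gauge-fixed Ponzano–Regge amplitude is $$\langle\Phi_f|\Phi_i\rangle=\int\prod_{e\notin T^*}dg_e\ \prod_{f\text{ not dual to a particle}}\delta(G_f)\ \prod_{p=1}^n\delta_{\theta_p}(G_{f_p})\ \overline{\Phi_f(g|_{\Gamma_f})}\,\Phi_i(g|_{\Gamma_i}),\qquad g_e=1\ (e\in T^*),$$ where $f_p$ is the face dual to $v_pv_p'$ and $\delta_\theta(G)=\int du\,\delta(G\,u h_\theta u^{-1})$. An integral containing delta functions is said to be finite with value $A$ if, whenever the $\delta$'s (independently of each other) are replaced by sequences of nonnegative continuous class functions of integral $1$ whose supports shrink to $\{1\}$, the resulting integrals converge to $A$. Then for all $\Phi_i,\Phi_f$ the amplitude is finite, does not depend on $T^*$, and equals $$\int\prod_{p=1}^n du_p\ \overline{\Phi_f(u_ph_{\theta_p}u_p^{-1})}\,\Phi_i(u_ph_{\theta_p}u_p^{-1})\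 \delta(u_1h_{\theta_1}u_1^{-1}\cdots u_nh_{\theta_n}u_n^{-1}),$$ an integral that is finite as well; here $\Phi(g_1,\dots,g_n)$ is the value of $\Phi$ at the connection on $\Gamma$ that equals $g_p$ on the edge dual to $Sv_p$ and $1$ on all other edges, so that its holonomy around the $p$-th particle is $g_p$. The form $\langle\cdot|\cdot\rangle$ is a positive semidefinite Hermitian scalar product on the space of spin network states. If moreover $n\ge4$ and an irreducible flat configuration exists, then the physical Hilbert space, that is, the completion of the space of spin network states modulo the null vectors of $\langle\cdot|\cdot\rangle$, is isomorphic as a Hilbert space to $L^2\big((\mathrm{SU}(2)/U(1))^{n-1}\big)$, for the invariant probability measure. -/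

import Mathlib

open MeasureTheory Filter Topology

noncomputable section

/-! ### The group `SU(2)`, its Haar measure, and delta functions on it -/

/-- The group `SU(2)`. -/
abbrev SU2 : Type := Matrix.specialUnitaryGroup (Fin 2) ℂ

instance SU2.instIsTopologicalGroup : IsTopologicalGroup SU2 where
  continuous_inv := by
    have h : Continuous fun g : SU2 => star (g : Matrix (Fin 2) (Fin 2) ℂ) :=
      continuous_subtype_val.star
    exact continuous_induced_rng.mpr h

instance SU2.instCompactSpace : CompactSpace SU2 := by
  have hclosed : IsClosed ((Matrix.specialUnitaryGroup (Fin 2) ℂ :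
      Submonoid (Matrix (Fin 2) (Fin 2) ℂ)) : Set (Matrix (Fin 2) (Fin 2) ℂ)) := by
    have h1 : IsClosed ((Matrix.unitaryGroup (Fin 2) ℂ : Submonoid _) :
        Set (Matrix (Fin 2) (Fin 2) ℂ)) := isClosed_unitary
    have h2 : IsClosed {A : Matrix (Fin 2) (Fin 2) ℂ | A.det = 1} :=
      isClosed_eq (Continuous.matrix_det continuous_id) continuous_const
    have h3 : ((Matrix.specialUnitaryGroup (Fin 2) ℂ :
        Submonoid (Matrix (Fin 2) (Fin 2) ℂ)) : Set (Matrix (Fin 2) (Fin 2) ℂ)) =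
        ((Matrix.unitaryGroup (Fin 2) ℂ : Submonoid _) : Set (Matrix (Fin 2) (Fin 2) ℂ)) ∩
          {A : Matrix (Fin 2) (Fin 2) ℂ | A.det = 1} := by
      ext A
      simp [Matrix.mem_specialUnitaryGroup_iff]
    rw [h3]
    exact h1.inter h2
  have hsub : ((Matrix.specialUnitaryGroup (Fin 2) ℂ :
      Submonoid (Matrix (Fin 2) (Fin 2) ℂ)) : Set (Matrix (Fin 2) (Fin 2) ℂ)) ⊆
      (Metric.closedBall (0 : ℂ) 1).matrix := by
    intro A hA i j
    have := entry_norm_bound_of_unitary (Matrix.specialUnitaryGroup_le_unitaryGroup hA) i j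
    simpa using this
  have hcpt := (isCompact_closedBall (0 : ℂ) 1).matrix (m := Fin 2) (n := Fin 2)
  exact isCompact_iff_compactSpace.mp (hcpt.of_isClosed_subset hclosed hsub)

instance SU2.instMeasurableSpace : MeasurableSpace SU2 := borel SU2

instance SU2.instBorelSpace : BorelSpace SU2 := ⟨rfl⟩

/-- The Haar measure of `SU(2)`, normalized to total mass one. -/
def haarSU2 : Measure SU2 := Measure.haarMeasure ⊤

/-- The element `h_φ = diag(e^{iφ}, e^{-iφ})` of the Cartan subgroup. -/
def torusElt (φ : ℝ) : SU2 :=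
  ⟨!![Complex.exp (φ * Complex.I), 0; 0, Complex.exp (-(φ * Complex.I))], by
    rw [Matrix.mem_specialUnitaryGroup_iff, Matrix.mem_unitaryGroup_iff]
    constructor
    · ext i j
      fin_cases i <;> fin_cases j <;>
        simp [Matrix.mul_apply, Fin.sum_univ_two, ← Complex.exp_conj, ← Complex.exp_add]
    · simp [Matrix.det_fin_two, ← Complex.exp_add]⟩

/-- The Cartan subgroup `U(1) = {h_φ}` of `SU(2)`. -/
def cartanU1 : Subgroup SU2 where
  carrier := Set.range torusElt
  one_mem' := ⟨0, by
    ext i j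
    fin_cases i <;> fin_cases j <;> simp [torusElt]⟩
  mul_mem' := by
    rintro _ _ ⟨a, rfl⟩ ⟨b, rfl⟩
    refine ⟨a + b, ?_⟩
    ext i j
    fin_cases i <;> fin_cases j <;>
      simp [torusElt, Matrix.mul_apply, Fin.sum_univ_two, ← Complex.exp_add] <;> ring_nf
  inv_mem' := by
    rintro _ ⟨a, rfl⟩
    refine ⟨-a, ?_⟩
    rw [← Matrix.star_eq_inv]
    ext i j
    fin_cases i <;> fin_cases j <;>
      simp [torusElt, Matrix.star_apply, ← Complex.exp_conj]

/-- The invariant probability measure on `SU(2)/U(1)`. -/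
def measureSU2ModU1 : Measure (SU2 ⧸ cartanU1) :=
  haarSU2.map (QuotientGroup.mk : SU2 → SU2 ⧸ cartanU1)

/-- A regularization of the delta function `δ(g)` of `SU(2)` (with respect to the normalized Haar
measure): continuous nonnegative class functions of total integral one, whose supports shrink to
the identity. -/
structure IsDeltaSequence (φ : ℕ → SU2 → ℝ) : Prop where
  continuous : ∀ k, Continuous (φ k)
  nonneg : ∀ k g, 0 ≤ φ k g
  conj_invariant : ∀ k x g, φ k (x * g * x⁻¹) = φ k g
  integral_eq_one : ∀ k, ∫ g, φ k g ∂haarSU2 = 1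
  support_shrinks : ∀ U ∈ 𝓝 (1 : SU2), ∀ᶠ k in atTop, Function.support (φ k) ⊆ U

/-- The distribution `δ_θ(G) = ∫ du δ(G u h_θ u⁻¹)` concentrated on the conjugacy class of `h_θ`,
built from a (regularized) delta function `φ`. -/
def classDelta (φ : SU2 → ℝ) (θ : ℝ) (G : SU2) : ℝ :=
  ∫ u : SU2, φ (G * (u * torusElt θ * u⁻¹)) ∂haarSU2

/-! ### The triangulated surface `Σ_{0,n}` and its dual graph

The sphere is triangulated with the `n + 2` vertices `N`, `S` (the poles, `N = true`, `S = false`)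
and `v_p` (`p : Fin n`, cyclically ordered; the particles), and with the `2n` triangles
`(pole s, v_p, v_{p+1})`, each written in the order of its vertices. The `3n` edges are the
meridians `(pole s, v_p)` and the equatorial edges `(v_p, v_{p+1})`. -/

/-- Triangles of the surface: `(p, s)` is the triangle `(pole s, v_p, v_{p+1})`. -/
abbrev Tri (n : ℕ) : Type := Fin n × Bool

/-- Edges of the surface triangulation, and at the same time the edges of its dual graph. -/
inductive SurfEdge (n : ℕ) : Type
  | meridian (p : Fin n) (s : Bool)
  | equator (p : Fin n)
  deriving DecidableEq, Fintype

variable {n : ℕ} [NeZero n]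

/-- Source of a dual edge of the surface. -/
def SurfEdge.src : SurfEdge n → Tri n
  | .meridian p s => (p, s)
  | .equator p => (p, true)

/-- Target of a dual edge of the surface. -/
def SurfEdge.tgt : SurfEdge n → Tri n
  | .meridian p s => (p - 1, s)
  | .equator p => (p, false)

/-! ### Spin network states on the dual graph -/

/-- Matrix elements of the representation of `SU(2)` of spin `d / 2`, in the basis `x^k y^(d-k)` of
the homogeneous polynomials of degree `d` (written with `y = 1`): `x ↦ g₀₀ x + g₁₀ y`,
`y ↦ g₀₁ x + g₁₁ y`. -/
def wigner (d : ℕ) (g : SU2) (m k : Fin (d + 1)) : ℂ :=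
  ((Polynomial.C (g.1 0 0) * Polynomial.X + Polynomial.C (g.1 1 0)) ^ (k : ℕ) *
    (Polynomial.C (g.1 0 1) * Polynomial.X + Polynomial.C (g.1 1 1)) ^ (d - (k : ℕ))).coeff m

/-- The lattice gauge transformation `g_e ↦ k_{t(e)}⁻¹ g_e k_{s(e)}`. -/
def gaugeTransform (k : Tri n → SU2) (g : SurfEdge n → SU2) : SurfEdge n → SU2 :=
  fun e => (k e.tgt)⁻¹ * g e * k e.src

variable (n) in
/-- The space of spin network states on the dual graph `Γ` of the surface: the gauge invariant
functions of the holonomies that are finite linear combinations, over all colorings `d` of the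
edges by spins `d e / 2`, of products over the edges of matrix elements in these representations. -/
def SpinNetworks : Submodule ℂ ((SurfEdge n → SU2) → ℂ) where
  carrier := {Φ | Φ ∈ Submodule.span ℂ {F : (SurfEdge n → SU2) → ℂ |
      ∃ (d : SurfEdge n → ℕ) (m k : ∀ e, Fin (d e + 1)),
        F = fun g => ∏ e, wigner (d e) (g e) (m e) (k e)} ∧
    ∀ k g, Φ (gaugeTransform k g) = Φ g}
  add_mem' := by
    rintro Φ Ψ ⟨h1, h2⟩ ⟨h3, h4⟩
    exact ⟨Submodule.add_mem _ h1 h3, fun k g => by simp [h2, h4]⟩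
  zero_mem' := ⟨Submodule.zero_mem _, fun _ _ => rfl⟩
  smul_mem' := by
    rintro c Φ ⟨h1, h2⟩
    exact ⟨Submodule.smul_mem _ c h1, fun k g => by simp [h2]⟩

/-- The boundary connection in the gauge where all holonomies are trivial except those of the
edges dual to the southern meridians; the holonomy around the particle `p` is then `g p`. -/
def gaugeFixedConnection (g : Fin n → SU2) : SurfEdge n → SU2
  | .meridian p false => g p
  | .meridian _ true => 1
  | .equator _ => 1

/-! ### The triangulated cylinder `Σ_{0,n} × I` and its dual 2-complex

Every prism `(a, b, c) × I` over a surface triangle is cut into the three tetrahedra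
`(a,b,c,c')`, `(a,b,b',c')`, `(a,a',b',c')` (primes denote the upper copies), `6n` in total.
All vertices lie on the boundary. The edges of the triangulation are, for each surface edge `xy`
(`x` before `y`), the lower edge `xy`, the diagonal `xy'`, the upper edge `x'y'`, and, for each
surface vertex `x`, the vertical edge `xx'`. The worldlines of the particles are the
vertical edges `v_p v_p'`. -/

/-- Dual vertices: above each surface triangle, level `0` is the lower boundary triangle, levels
`1`, `2`, `3` are the three tetrahedra in the above order, level `4` the upper boundary triangle. -/
abbrev DualVertex (n : ℕ) : Type := Tri n × Fin 5

/-- Dual edges. `column t k` joins levels `k` and `k + 1` above `t`. For a surface edge `e = xy`,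
`cross e 0` and `cross e 3` are the dual edges in the lower and the upper boundary surface, while
`cross e 1` and `cross e 2` are dual to the triangles `(x,y,y')` and `(x,x',y')`. -/
inductive DualEdge (n : ℕ) : Type
  | column (t : Tri n) (k : Fin 4)
  | cross (e : SurfEdge n) (k : Fin 4)
  deriving DecidableEq, Fintype

/-- The level of the starting point of `cross e k`. A meridian is the edge `ab` of its source
triangle `(a,b,c)`, an equatorial edge is the edge `bc`. -/
def SurfEdge.srcLevel : SurfEdge n → Fin 4 → Fin 5
  | .meridian _ _ => ![0, 2, 3, 4]
  | .equator _ => ![0, 1, 2, 4]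

/-- The level of the end point of `cross e k`. A meridian is the edge `ac` of its target
triangle `(a,b,c)`, an equatorial edge is the edge `bc`. -/
def SurfEdge.tgtLevel : SurfEdge n → Fin 4 → Fin 5
  | .meridian _ _ => ![0, 1, 3, 4]
  | .equator _ => ![0, 1, 2, 4]

/-- Source of a dual edge. -/
def DualEdge.src : DualEdge n → DualVertex n
  | .column t k => (t, k.castSucc)
  | .cross e k => (e.src, e.srcLevel k)

/-- Target of a dual edge. -/
def DualEdge.tgt : DualEdge n → DualVertex n
  | .column t k => (t, k.succ)
  | .cross e k => (e.tgt, e.tgtLevel k)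

/-- Dual faces, that is, edges of the triangulation. For a surface edge `e = xy`, `quad e 0`,
`quad e 1`, `quad e 2` are dual to `xy`, `xy'`, `x'y'`; `particle p` and `pole s` are dual to
the vertical edges at `v_p` and at the pole `s`. -/
inductive DualFace (n : ℕ) : Type
  | quad (e : SurfEdge n) (k : Fin 3)
  | particle (p : Fin n)
  | pole (s : Bool)
  deriving DecidableEq, Fintype

/-- The path upwards above `t` from level `i` to level `j`; `true` marks an edge traversed
along its orientation. -/
def columnUp (t : Tri n) (i j : Fin 5) : List (DualEdge n × Bool) :=
  ((List.finRange 4).filter fun k => decide (i ≤ k.castSucc ∧ k.succ ≤ j)).map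
    fun k => (DualEdge.column t k, true)

/-- The path downwards above `t` from level `j` to level `i`. -/
def columnDown (t : Tri n) (i j : Fin 5) : List (DualEdge n × Bool) :=
  ((columnUp t i j).map fun s => (s.1, false)).reverse

/-- The closed path around a dual face. -/
def DualFace.boundary : DualFace n → List (DualEdge n × Bool)
  | .quad e k =>
      [(DualEdge.cross e k.castSucc, true)] ++
        columnUp e.tgt (e.tgtLevel k.castSucc) (e.tgtLevel k.succ) ++
        [(DualEdge.cross e k.succ, false)] ++
        columnDown e.src (e.srcLevel k.castSucc) (e.srcLevel k.succ)
  | .particle p =>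
      [(DualEdge.cross (.meridian p true) 1, false), (DualEdge.cross (.equator p) 2, true),
        (DualEdge.cross (.meridian p false) 1, true),
        (DualEdge.cross (.equator (p - 1)) 1, false)]
  | .pole s => (List.finRange n).reverse.map fun p => (DualEdge.cross (.meridian p s) 2, true)

/-- The holonomy along a path: the ordered product of group elements, later steps to the left. -/
def pathHolonomy (g : DualEdge n → SU2) (path : List (DualEdge n × Bool)) : SU2 :=
  path.foldl (fun acc s => (if s.2 then g s.1 else (g s.1)⁻¹) * acc) 1

/-- The curvature `G_f` of a discrete connection on a dual face. -/
def curvature (g : DualEdge n → SU2) (f : DualFace n) : SU2 :=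
  pathHolonomy g f.boundary

/-- The restriction of a discrete connection to the initial boundary `Σ × {0}`. -/
def initialConnection (g : DualEdge n → SU2) : SurfEdge n → SU2 := fun e => g (.cross e 0)

/-- The restriction of a discrete connection to the final boundary `Σ × {1}`. -/
def finalConnection (g : DualEdge n → SU2) : SurfEdge n → SU2 := fun e => g (.cross e 3)

/-- `T` is a maximal tree of the dual 1-skeleton: it connects all dual vertices, with
one edge less than there are dual vertices. -/
def IsMaximalDualTree (T : Finset (DualEdge n)) : Prop :=
  T.card + 1 = Fintype.card (DualVertex n) ∧
    ∀ v w : DualVertex n,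
      Relation.EqvGen (fun a b => ∃ e ∈ T, e.src = a ∧ e.tgt = b) v w

/-- The connection that is trivial on the tree `T` and given by `g` off `T`. -/
def extendByOne (T : Finset (DualEdge n)) (g : {e : DualEdge n // e ∉ T} → SU2) :
    DualEdge n → SU2 :=
  fun e => if h : e ∈ T then 1 else g ⟨e, h⟩

/-! ### Transition amplitudes -/

/-- The factor attached to a dual face: `δ_{θ_p}(G)` if it is dual to the worldline of the
particle `p`, and `δ(G)` otherwise. -/
def faceFactor (θ : Fin n → ℝ) (φ : DualFace n → SU2 → ℝ) (f : DualFace n) (G : SU2) : ℝ :=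
  match f with
  | .particle p => classDelta (φ (.particle p)) (θ p) G
  | .quad e k => φ (.quad e k) G
  | .pole s => φ (.pole s) G

/-- The gauge fixed Ponzano-Regge amplitude
`∫ ∏_{e ∉ T} dg_e ∏_f δ(G_f) ∏_p δ_{θ_p}(G_p) conj(Φ_f) Φ_i`, with the delta function of each dual
face `f` replaced by the function `φ f`. -/
def regularizedAmplitude (θ : Fin n → ℝ) (T : Finset (DualEdge n))
    (Φf Φi : (SurfEdge n → SU2) → ℂ) (φ : DualFace n → SU2 → ℝ) : ℂ :=
  ∫ g : {e : DualEdge n // e ∉ T} → SU2,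
    ((∏ f : DualFace n, faceFactor θ φ f (curvature (extendByOne T g) f) : ℝ) : ℂ) *
      (starRingEnd ℂ (Φf (finalConnection (extendByOne T g))) *
        Φi (initialConnection (extendByOne T g)))
    ∂Measure.pi fun _ => haarSU2

/-- The gauge fixed Ponzano-Regge transition amplitude `⟨Φ_f|Φ_i⟩` on `Σ_{0,n} × I` with `n`
particles along the vertical edges exists and equals `A`: for every choice of delta sequences, one
for each dual face, the regularized amplitudes converge to `A`. -/
def IsTransitionAmplitude (θ : Fin n → ℝ) (T : Finset (DualEdge n))
    (Φf Φi : (SurfEdge n → SU2) → ℂ) (A : ℂ) : Prop :=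
  ∀ φ : DualFace n → ℕ → SU2 → ℝ, (∀ f, IsDeltaSequence (φ f)) →
    Tendsto (fun k => regularizedAmplitude θ T Φf Φi fun f => φ f k) atTop (𝓝 A)

/-- The integral
`∫ ∏ du_p conj(Φ_f(u_p h_{θ_p} u_p⁻¹)) Φ_i(u_p h_{θ_p} u_p⁻¹) δ(u_1 h_{θ_1} u_1⁻¹ ⋯ u_n h_{θ_n} u_n⁻¹)`
exists and equals `A`. -/
def IsReducedAmplitude (θ : Fin n → ℝ) (Φf Φi : (SurfEdge n → SU2) → ℂ) (A : ℂ) : Prop :=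
  ∀ φ : ℕ → SU2 → ℝ, IsDeltaSequence φ →
    Tendsto (fun k => ∫ u : Fin n → SU2,
      starRingEnd ℂ (Φf (gaugeFixedConnection fun p => u p * torusElt (θ p) * (u p)⁻¹)) *
        Φi (gaugeFixedConnection fun p => u p * torusElt (θ p) * (u p)⁻¹) *
        (φ k (List.ofFn fun p => u p * torusElt (θ p) * (u p)⁻¹).prod : ℂ)
      ∂Measure.pi fun _ => haarSU2) atTop (𝓝 A)

/-- A flat connection on `Σ_{0,n}` whose holonomy around the particle `p` lies in the conjugacy
class of `h_{θ_p}`, given by these holonomies. -/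
def IsFlatConfiguration (θ : Fin n → ℝ) (g : Fin n → SU2) : Prop :=
  (∀ p, IsConj (torusElt (θ p)) (g p)) ∧ (List.ofFn g).prod = 1

/-- Some of the holonomies do not commute (the flat connection is irreducible). -/
def IsIrreducibleConfiguration (g : Fin n → SU2) : Prop :=
  ∃ p q, g p * g q ≠ g q * g p

/-! ### The physical Hilbert space -/

variable (n) in
/-- The spin network states, as a bare complex vector space. -/
def SpinNetworkState : Type := SpinNetworks n

instance SpinNetworkState.instAddCommGroup : AddCommGroup (SpinNetworkState n) :=
  inferInstanceAs (AddCommGroup (SpinNetworks n))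

instance SpinNetworkState.instModule : Module ℂ (SpinNetworkState n) :=
  inferInstanceAs (Module ℂ (SpinNetworks n))

/-- The wave function of a spin network state. -/
def SpinNetworkState.toFun (Φ : SpinNetworkState n) : (SurfEdge n → SU2) → ℂ :=
  (show SpinNetworks n from Φ).1

/-- The spin network states with the seminorm `⟨Φ|Φ⟩^{1/2}` of a positive semidefinite scalar
product `c`. -/
def SpinNetworkState.With (_c : PreInnerProductSpace.Core ℂ (SpinNetworkState n)) : Type :=
  SpinNetworkState n

instance SpinNetworkState.With.instSeminormedAddCommGroup
    (c : PreInnerProductSpace.Core ℂ (SpinNetworkState n)) :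
    SeminormedAddCommGroup (SpinNetworkState.With c) :=
  @InnerProductSpace.Core.toSeminormedAddCommGroup ℂ (SpinNetworkState n) _ _ _ c

instance SpinNetworkState.With.instInnerProductSpace
    (c : PreInnerProductSpace.Core ℂ (SpinNetworkState n)) :
    InnerProductSpace ℂ (SpinNetworkState.With c) :=
  @InnerProductSpace.ofCore ℂ (SpinNetworkState n) _ _ _ c

/-- The Hilbert space defined by a positive semidefinite scalar product `c` on the spin network
states: the quotient by the null vectors, completed. -/
abbrev PhysicalHilbertSpace (c : PreInnerProductSpace.Core ℂ (SpinNetworkState n)) : Type :=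
  UniformSpace.Completion (SpinNetworkState.With c)

variable (n) in
/-- `L²((SU(2)/U(1))^{n-1})`. -/
abbrev L2SpherePower : Type :=
  Lp (α := Fin (n - 1) → SU2 ⧸ cartanU1) ℂ 2 (Measure.pi fun _ => measureSU2ModU1)

end

/-!
The proof has three parts: a reduction of the amplitude to an integral over `n` conjugacy classes,
the existence of that integral, and the identification of the Hilbert space.

*Reduction.* The regularized integrand is gauge invariant, so gauge fixing along any maximal tree
gives the integral over all dual edges (`integral_eq_integral_trivialized`; along a tree every
group-valued function is a coboundary, by the count of components in
`card_le_and_exists_potential`). The tree may therefore be replaced by the explicit tree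
`IsRadial`. In this gauge the `10n + 1` faces other than the south pole can be solved one after the
other by left and right translations (`solveConstraints`), after which each of their delta
functions depends on one variable only. These variables are concentrated at `1`, the particle
holonomies are `C p = u p * h_{θ p} * (u p)⁻¹`, and the remaining delta function, that of the
south pole, is evaluated at a product of the `C p` interspersed with the small variables.
Conjugating the small variables, which their densities do not notice, collects the `C p` in front
(`southHolonomy_collector`). Hence the small variables only smear the last delta function into
another delta sequence (`isDeltaSequence_smearedDelta`), and by uniform continuity they may be set
to `1` in the boundary states; what is left is the reduced integral.

*Existence of the reduced integral.* Integrate first over the conjugacy classes of two of the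
particles, with angles `a` and `b`, keeping the product `A` of the other holonomies fixed. Since
the squared modulus of an entry of a random element is uniform on `[0, 1]`
(`map_colWeight_haar`), the trace of `A * (v * h_b * v⁻¹)` is uniform on an interval of length
proportional to `sin b` times the sine `sinAngle A` of the angle of `A`, while a class delta
function is a function of the trace which concentrates at `cos a`, with the semicircle law fixing
its mass. This gives the limit `fiberLimit` whenever `cos a` is not an end point of the interval,
together with a bound by a multiple of `(sinAngle A)⁻¹`. The inverse sine is integrable over the
remaining particles (`holonomyProduct_sinAngle`), so dominated convergence applies. The end points
are avoided almost surely if `n ≥ 4`, because then the trace of `A` has no atoms, and everywhere if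
`n = 3`, because they belong to reducible flat configurations. For `n ≤ 2` all flat configurations
are reducible, so there are none, and the limit is `0`. The scalar product is defined by the limit,
and inherits symmetry and positivity from the approximating integrals.

*The Hilbert space.* Both spaces are separable, so that it is enough that they have infinite
dimension. Spin network states have countable dimension. In an irreducible flat configuration
two neighbouring holonomies do not commute, since the centralizer of a noncentral element is
abelian. Polynomials in the trace of the holonomy around these two particles are spin network
states, because the matrix elements of irreducible representations span an algebra. A nonzero such
polynomial has positive norm (`reducedLimit_pos`): the limit of the reduced integral charges a
neighbourhood of the flat configuration, and there the trace has no atoms. So the polynomials embed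
into the physical Hilbert space.
-/

open MeasureTheory Filter Topology

set_option linter.unusedSectionVars false

noncomputable section

/-! ### The group `SU(2)`: entries, trace, diagonalization -/

instance SU2.instT2Space : T2Space SU2 := inferInstanceAs (T2Space (Subtype _))
instance SU2.instSecondCountable : SecondCountableTopology SU2 :=
  have : SecondCountableTopology (Matrix (Fin 2) (Fin 2) ℂ) :=
    inferInstanceAs (SecondCountableTopology (Fin 2 → Fin 2 → ℂ))
  TopologicalSpace.Subtype.secondCountableTopology _

instance haarSU2.instIsHaar : haarSU2.IsHaarMeasure := by unfold haarSU2; infer_instance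

instance haarSU2.instIsProbability : IsProbabilityMeasure haarSU2 := by
  constructor
  have h := Measure.haarMeasure_self (K₀ := (⊤ : TopologicalSpace.PositiveCompacts SU2))
  simpa [haarSU2] using h

instance haarSU2.instRightInvariant : haarSU2.IsMulRightInvariant := by
  constructor
  intro g
  have : IsProbabilityMeasure (Measure.map (· * g) haarSU2) :=
    Measure.isProbabilityMeasure_map (measurable_mul_const g).aemeasurable
  exact Measure.isHaarMeasure_eq_of_isProbabilityMeasure _ _


namespace SU2

theorem continuous_entry (i j : Fin 2) : Continuous fun g : SU2 => g.1 i j :=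
  continuous_subtype_val.matrix_elem i j

theorem entries_eq (g : SU2) :
    g.1 0 1 = -starRingEnd ℂ (g.1 1 0) ∧ g.1 1 1 = starRingEnd ℂ (g.1 0 0) := by
  have h1 := Matrix.mem_unitaryGroup_iff'.mp (Matrix.mem_specialUnitaryGroup_iff.mp g.2).1
  have h2 := (Matrix.mem_specialUnitaryGroup_iff.mp g.2).2
  have h3 : star g.1 = g.1.adjugate := by
    have : g.1 * g.1.adjugate = 1 := by rw [Matrix.mul_adjugate, h2, one_smul]
    calc star g.1 = star g.1 * (g.1 * g.1.adjugate) := by rw [this, mul_one]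
      _ = g.1.adjugate := by rw [← mul_assoc, h1, one_mul]
  rw [Matrix.adjugate_fin_two] at h3
  have h4 := congrFun (congrFun h3 0) 0
  have h5 := congrFun (congrFun h3 0) 1
  simp [Matrix.star_apply] at h4 h5
  exact ⟨by rw [h5]; simp, h4.symm⟩

theorem normSq_add_normSq (g : SU2) :
    Complex.normSq (g.1 0 0) + Complex.normSq (g.1 1 0) = 1 := by
  have h2 := (Matrix.mem_specialUnitaryGroup_iff.mp g.2).2
  rw [Matrix.det_fin_two, (entries_eq g).1, (entries_eq g).2, neg_mul, sub_neg_eq_add,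
    Complex.mul_conj, mul_comm, Complex.mul_conj] at h2
  exact_mod_cast h2

/-- The element of `SU(2)` with first column `(a, b)`. -/
def ofColumn (a b : ℂ) (h : Complex.normSq a + Complex.normSq b = 1) : SU2 :=
  ⟨!![a, -starRingEnd ℂ b; b, starRingEnd ℂ a], by
    have h' : a * starRingEnd ℂ a + b * starRingEnd ℂ b = 1 := by
      rw [Complex.mul_conj, Complex.mul_conj]; exact_mod_cast h
    rw [Matrix.mem_specialUnitaryGroup_iff, Matrix.mem_unitaryGroup_iff]
    constructor
    · ext i j
      fin_cases i <;> fin_cases j <;>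
        simp [Matrix.mul_apply, Fin.sum_univ_two] <;>
        first | linear_combination h' | ring_nf
    · rw [Matrix.det_fin_two_of]; linear_combination h'⟩

/-- An element of `SU(2)` is determined by its first column. -/
theorem ext_column {g k : SU2} (h0 : g.1 0 0 = k.1 0 0) (h1 : g.1 1 0 = k.1 1 0) : g = k := by
  apply Subtype.ext
  ext i j
  have hg := entries_eq g
  have hk := entries_eq k
  fin_cases i <;> fin_cases j
  · exact h0
  · simp [hg.1, hk.1, h1]
  · exact h1
  · simp [hg.2, hk.2, h0]

theorem mul_apply_zero (g k : SU2) :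
    (g * k).1 0 0 = g.1 0 0 * k.1 0 0 + g.1 0 1 * k.1 1 0 := by
  simp [Matrix.mul_apply, Fin.sum_univ_two]

theorem mul_apply_one (g k : SU2) :
    (g * k).1 1 0 = g.1 1 0 * k.1 0 0 + g.1 1 1 * k.1 1 0 := by
  simp [Matrix.mul_apply, Fin.sum_univ_two]

@[simp] theorem torusElt_zero_zero (φ : ℝ) :
    (torusElt φ).1 0 0 = Complex.exp (φ * Complex.I) := by simp [torusElt]

@[simp] theorem torusElt_one_zero (φ : ℝ) : (torusElt φ).1 1 0 = 0 := by simp [torusElt]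

@[simp] theorem torusElt_zero_one (φ : ℝ) : (torusElt φ).1 0 1 = 0 := by simp [torusElt]

@[simp] theorem torusElt_one_one (φ : ℝ) :
    (torusElt φ).1 1 1 = Complex.exp (-(φ * Complex.I)) := by simp [torusElt]

theorem torusElt_add (a b : ℝ) : torusElt (a + b) = torusElt a * torusElt b := by
  apply ext_column
  · rw [mul_apply_zero]; simp [← Complex.exp_add]; ring_nf
  · rw [mul_apply_one]; simp

theorem torusElt_zero : torusElt 0 = 1 := by
  apply ext_column <;> simp

theorem torusElt_neg (a : ℝ) : torusElt (-a) = (torusElt a)⁻¹ :=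
  eq_inv_of_mul_eq_one_left (by rw [← torusElt_add]; simp [torusElt_zero])

theorem torusElt_mul_comm (a b : ℝ) : torusElt a * torusElt b = torusElt b * torusElt a := by
  rw [← torusElt_add, add_comm, torusElt_add]

theorem torusElt_periodic : Function.Periodic torusElt (2 * Real.pi) := by
  intro a
  apply ext_column
  · simp only [torusElt_zero_zero]; push_cast
    rw [add_mul, Complex.exp_add, Complex.exp_two_pi_mul_I, mul_one]
  · simp

theorem continuous_torusElt : Continuous torusElt := by
  apply Continuous.subtype_mk
  apply continuous_matrix
  intro i j
  fin_cases i <;> fin_cases j <;> simp <;> fun_prop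

/-- Half the trace of an element of `SU(2)`, the cosine of its rotation angle. -/
def halfTrace (g : SU2) : ℝ := (Matrix.trace g.1).re / 2

theorem halfTrace_eq (g : SU2) : halfTrace g = (g.1 0 0).re := by
  rw [halfTrace, Matrix.trace_fin_two, (entries_eq g).2]
  simp

theorem continuous_halfTrace : Continuous halfTrace := by
  have : halfTrace = fun g => (g.1 0 0).re := funext halfTrace_eq
  rw [this]
  exact Complex.continuous_re.comp (continuous_entry 0 0)

theorem halfTrace_mul_comm (g k : SU2) : halfTrace (g * k) = halfTrace (k * g) := by
  unfold halfTrace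
  rw [Submonoid.coe_mul, Submonoid.coe_mul, Matrix.trace_mul_comm]

theorem halfTrace_conj (x g : SU2) : halfTrace (x * g * x⁻¹) = halfTrace g := by
  rw [halfTrace_mul_comm, inv_mul_cancel_left]

theorem halfTrace_torusElt (φ : ℝ) : halfTrace (torusElt φ) = Real.cos φ := by
  rw [halfTrace_eq, torusElt_zero_zero, Complex.exp_ofReal_mul_I_re]

theorem abs_halfTrace_le (g : SU2) : |halfTrace g| ≤ 1 := by
  have h := normSq_add_normSq g
  rw [halfTrace_eq, abs_le_one_iff_mul_self_le_one]
  have h1 := Complex.normSq_nonneg (g.1 1 0)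
  rw [Complex.normSq_apply (g.1 0 0)] at h
  nlinarith [mul_self_nonneg (g.1 0 0).im]

theorem inv_entries (g : SU2) : (g⁻¹).1 0 0 = starRingEnd ℂ (g.1 0 0) ∧
    (g⁻¹).1 1 0 = -(g.1 1 0) := by
  rw [← Matrix.star_eq_inv]
  constructor
  · simp [Matrix.star_apply]
  · simp [Matrix.star_apply, (entries_eq g).1]

theorem halfTrace_inv (g : SU2) : halfTrace g⁻¹ = halfTrace g := by
  rw [halfTrace_eq, halfTrace_eq, (inv_entries g).1, Complex.conj_re]

/-- The Weyl element, which inverts the Cartan subgroup by conjugation. -/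
def weyl : SU2 := ofColumn 0 1 (by simp)

theorem weyl_conj (φ : ℝ) : weyl * torusElt φ * weyl⁻¹ = torusElt (-φ) := by
  rw [mul_inv_eq_iff_eq_mul]
  apply ext_column
  · simp [mul_apply_zero, weyl, ofColumn]
  · simp [mul_apply_one, weyl, ofColumn]

/-- Every element of `SU(2)` is conjugate to the torus element of angle `arccos (tr / 2)`. -/
theorem exists_diagonalization (g : SU2) :
    ∃ v : SU2, g = v * torusElt (Real.arccos (halfTrace g)) * v⁻¹ := by
  set ρ := Real.arccos (halfTrace g) with hρ
  have hb := abs_le.mp (abs_halfTrace_le g)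
  have hcos : Real.cos ρ = halfTrace g := Real.cos_arccos hb.1 hb.2
  have hsum := normSq_add_normSq g
  rw [halfTrace_eq] at hcos
  have he : Complex.exp (ρ * Complex.I) = Real.cos ρ + Real.sin ρ * Complex.I := by
    rw [Complex.exp_mul_I]; simp
  have hc : (g.1 0 0) + starRingEnd ℂ (g.1 0 0) = 2 * (Real.cos ρ : ℂ) := by
    rw [hcos, Complex.add_conj]; simp
  have hsc : (Real.sin ρ : ℂ) ^ 2 + (Real.cos ρ : ℂ) ^ 2 = 1 := by
    exact_mod_cast Real.sin_sq_add_cos_sq ρ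
  by_cases h : g.1 1 0 = 0
  -- a diagonal element is `torusElt (±ρ)`
  · have hre : Complex.normSq (g.1 0 0) = 1 := by simpa [h] using hsum
    rw [Complex.normSq_apply, ← hcos] at hre
    have him : ((g.1 0 0).im - Real.sin ρ) * ((g.1 0 0).im + Real.sin ρ) = 0 := by
      nlinarith [Real.sin_sq_add_cos_sq ρ]
    rcases mul_eq_zero.mp him with h1 | h1
    · refine ⟨1, ?_⟩
      simp only [one_mul, inv_one, mul_one]
      apply ext_column
      · rw [torusElt_zero_zero, he]
        apply Complex.ext <;> simp [-Complex.ofReal_sin, hcos]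
        linarith
      · simp [h]
    · refine ⟨weyl, ?_⟩
      rw [weyl_conj]
      apply ext_column
      · rw [torusElt_zero_zero, Complex.exp_ofReal_mul_I, Real.cos_neg, Real.sin_neg]
        apply Complex.ext <;> simp [-Complex.ofReal_sin, hcos]
        linarith
      · simp [h]
  -- otherwise an eigenvector for the eigenvalue `exp (iρ)` is the first column of `v`
  · set p : ℂ := Complex.exp (ρ * Complex.I) - starRingEnd ℂ (g.1 0 0) with hp
    set N : ℝ := Complex.normSq p + Complex.normSq (g.1 1 0) with hN
    have hNpos : 0 < N := by
      have := Complex.normSq_pos.mpr h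
      have := Complex.normSq_nonneg p
      linarith
    have hs : Real.sqrt N * Real.sqrt N = N := Real.mul_self_sqrt hNpos.le
    have hs0 : Real.sqrt N ≠ 0 := (Real.sqrt_pos.mpr hNpos).ne'
    refine ⟨ofColumn (p / (Real.sqrt N : ℝ)) (g.1 1 0 / (Real.sqrt N : ℝ)) ?_, ?_⟩
    · rw [Complex.normSq_div, Complex.normSq_div, Complex.normSq_ofReal, hs, ← add_div,
        div_self hNpos.ne']
    · have hs0' : ((Real.sqrt N : ℝ) : ℂ) ≠ 0 := by exact_mod_cast hs0
      rw [eq_mul_inv_iff_mul_eq]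
      have hE : Complex.exp (ρ * Complex.I) * Complex.exp (ρ * Complex.I) + 1 =
          2 * (Real.cos ρ : ℂ) * Complex.exp (ρ * Complex.I) := by
        rw [he]
        linear_combination (-1 : ℂ) * hsc + (Real.sin ρ : ℂ) ^ 2 * Complex.I_sq
      have hn : g.1 0 0 * starRingEnd ℂ (g.1 0 0) + g.1 1 0 * starRingEnd ℂ (g.1 1 0) = 1 := by
        rw [Complex.mul_conj, Complex.mul_conj]; exact_mod_cast hsum
      apply ext_column
      · rw [mul_apply_zero, mul_apply_zero, (entries_eq g).1]
        simp only [ofColumn, torusElt_zero_zero, torusElt_one_zero]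
        simp
        field_simp
        rw [hp]
        linear_combination Complex.exp (ρ * Complex.I) * hc - hn - hE
      · rw [mul_apply_one, mul_apply_one, (entries_eq g).2]
        simp only [ofColumn, torusElt_zero_zero, torusElt_one_zero]
        simp
        field_simp
        rw [hp]
        ring

end SU2

theorem Continuous.integrable_of_compactSpace {X E : Type*} [TopologicalSpace X] [CompactSpace X]
    [MeasurableSpace X] [OpensMeasurableSpace X] [NormedAddCommGroup E] {μ : Measure X}
    [IsFiniteMeasure μ] {f : X → E} (hf : Continuous f) : Integrable f μ :=
  hf.integrable_of_hasCompactSupport (HasCompactSupport.of_compactSpace f)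

/-! ### The distribution of the first column of a random element -/

namespace SU2

/-- The squared modulus of the upper left entry. -/
def colWeight (u : SU2) : ℝ := Complex.normSq (u.1 0 0)

theorem continuous_colWeight : Continuous colWeight :=
  Complex.continuous_normSq.comp (continuous_entry 0 0)

theorem colWeight_nonneg (u : SU2) : 0 ≤ colWeight u := Complex.normSq_nonneg _

theorem colWeight_le_one (u : SU2) : colWeight u ≤ 1 := by
  have := normSq_add_normSq u
  have := Complex.normSq_nonneg (u.1 1 0)
  unfold colWeight; linarith

theorem normSq_one_zero (u : SU2) : Complex.normSq (u.1 1 0) = 1 - colWeight u := by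
  have := normSq_add_normSq u
  unfold colWeight; linarith

/-- Up to the factor `√(1 + c²)`, the linear form is the upper left entry of a translate. -/
theorem integral_normSq_add_pow (k : ℕ) (c : ℝ) :
    ∫ u : SU2, Complex.normSq (c * u.1 1 0 + u.1 0 0) ^ k ∂haarSU2 =
      (1 + c ^ 2) ^ k * ∫ u : SU2, colWeight u ^ k ∂haarSU2 := by
  have hpos : 0 < 1 + c ^ 2 := by positivity
  set r := Real.sqrt (1 + c ^ 2) with hr
  have hrr : r * r = 1 + c ^ 2 := Real.mul_self_sqrt hpos.le
  have hr0 : r ≠ 0 := (Real.sqrt_pos.mpr hpos).ne'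
  let g : SU2 := ofColumn ((1 / r : ℝ) : ℂ) ((-c / r : ℝ) : ℂ) (by
    rw [Complex.normSq_ofReal, Complex.normSq_ofReal]
    field_simp
    linarith)
  rw [← integral_mul_left_eq_self (fun u : SU2 => colWeight u ^ k) g, ← integral_const_mul]
  congr 1
  ext u
  have hg : (g * u).1 0 0 = (c * u.1 1 0 + u.1 0 0) / (r : ℂ) := by
    rw [mul_apply_zero]
    simp [g, ofColumn]
    ring
  rw [colWeight, hg, Complex.normSq_div, Complex.normSq_ofReal, hrr, div_pow,
    mul_div_cancel₀ _ (pow_ne_zero k hpos.ne')]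

/-- Different torus weights make the mixed moments of the first column vanish. -/
theorem integral_mixed_moment (k i j : ℕ) (hi : i ≤ k) (hj : j ≤ k) (hij : i ≠ j) :
    ∫ u : SU2, (u.1 1 0 ^ i * u.1 0 0 ^ (k - i)) *
      starRingEnd ℂ (u.1 1 0 ^ j * u.1 0 0 ^ (k - j)) ∂haarSU2 = 0 := by
  -- translation by the torus element of this angle multiplies the integrand by `-1`
  set τ : ℝ := Real.pi / (2 * ((j : ℝ) - i)) with hτ
  have hne : ((j : ℝ) - i) ≠ 0 := sub_ne_zero.mpr (by exact_mod_cast hij.symm)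
  have h := integral_mul_left_eq_self (μ := haarSU2) (fun u : SU2 =>
    (u.1 1 0 ^ i * u.1 0 0 ^ (k - i)) *
      starRingEnd ℂ (u.1 1 0 ^ j * u.1 0 0 ^ (k - j))) (torusElt τ)
  have key : ∀ u : SU2, ((torusElt τ * u).1 1 0 ^ i * (torusElt τ * u).1 0 0 ^ (k - i)) *
      starRingEnd ℂ ((torusElt τ * u).1 1 0 ^ j * (torusElt τ * u).1 0 0 ^ (k - j)) =
      -((u.1 1 0 ^ i * u.1 0 0 ^ (k - i)) *
      starRingEnd ℂ (u.1 1 0 ^ j * u.1 0 0 ^ (k - j))) := by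
    intro u
    rw [mul_apply_zero, mul_apply_one]
    simp only [torusElt_zero_zero, torusElt_one_zero, torusElt_zero_one, torusElt_one_one,
      zero_mul, add_zero, zero_add, mul_pow, map_mul, map_pow, ← Complex.exp_conj, map_neg,
      Complex.conj_ofReal, Complex.conj_I, map_natCast, ← Complex.exp_nat_mul]
    have hE : Complex.exp (i * -(τ * Complex.I)) * Complex.exp ((k - i : ℕ) * (τ * Complex.I)) *
        (Complex.exp (j * -(τ * -Complex.I)) * Complex.exp ((k - j : ℕ) * (τ * -Complex.I)))
        = -1 := by
      rw [← Complex.exp_add, ← Complex.exp_add, ← Complex.exp_add, ← Complex.exp_pi_mul_I]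
      congr 1
      have h2 : (τ : ℂ) * (2 * ((j : ℂ) - i)) = Real.pi := by
        have : τ * (2 * ((j : ℝ) - i)) = Real.pi := by rw [hτ]; field_simp
        exact_mod_cast this
      push_cast [Nat.cast_sub hi, Nat.cast_sub hj]
      linear_combination Complex.I * h2
    linear_combination (u.1 1 0 ^ i * u.1 0 0 ^ (k - i)) *
      (starRingEnd ℂ (u.1 1 0) ^ j * starRingEnd ℂ (u.1 0 0) ^ (k - j)) * hE
  simp only [key, integral_neg] at h
  have h2 : (2 : ℂ) * ∫ u : SU2, (u.1 1 0 ^ i * u.1 0 0 ^ (k - i)) *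
      starRingEnd ℂ (u.1 1 0 ^ j * u.1 0 0 ^ (k - j)) ∂haarSU2 = 0 := by
    linear_combination (-1 : ℂ) * h
  simpa using h2

/-- The binomial expansion of the moments of a linear form in the entries of the first column; the
mixed terms vanish. -/
theorem integral_normSq_add_pow_eq_sum (k : ℕ) (c : ℝ) :
    ∫ u : SU2, Complex.normSq (c * u.1 1 0 + u.1 0 0) ^ k ∂haarSU2 =
      ∑ i ∈ Finset.range (k + 1), (k.choose i : ℝ) ^ 2 *
        (∫ u : SU2, (1 - colWeight u) ^ i * colWeight u ^ (k - i) ∂haarSU2) * (c ^ 2) ^ i := by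
  have hc0 := continuous_entry 0 0
  have hc1 := continuous_entry 1 0
  have hexp : ∀ u : SU2, ((Complex.normSq (c * u.1 1 0 + u.1 0 0) ^ k : ℝ) : ℂ) =
      ∑ i ∈ Finset.range (k + 1), ∑ j ∈ Finset.range (k + 1),
        ((c : ℂ) ^ i * k.choose i * ((c : ℂ) ^ j * k.choose j)) *
        ((u.1 1 0 ^ i * u.1 0 0 ^ (k - i)) *
          starRingEnd ℂ (u.1 1 0 ^ j * u.1 0 0 ^ (k - j))) := by
    intro u
    rw [Complex.ofReal_pow, ← Complex.mul_conj, mul_pow, ← map_pow, add_pow, map_sum,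
      Finset.sum_mul_sum]
    refine Finset.sum_congr rfl fun i _ => Finset.sum_congr rfl fun j _ => ?_
    simp only [mul_pow, map_mul, map_pow, Complex.conj_ofReal, map_natCast]
    ring
  have hint : ∀ (i j : ℕ) (z : ℂ), Integrable (fun u : SU2 => z *
        ((u.1 1 0 ^ i * u.1 0 0 ^ (k - i)) *
          starRingEnd ℂ (u.1 1 0 ^ j * u.1 0 0 ^ (k - j)))) haarSU2 := by
    intro i j z
    apply Continuous.integrable_of_compactSpace
    exact continuous_const.mul (((hc1.pow i).mul (hc0.pow (k - i))).mul
      (Complex.continuous_conj.comp ((hc1.pow j).mul (hc0.pow (k - j)))))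
  apply Complex.ofReal_injective
  rw [← integral_complex_ofReal]
  simp_rw [hexp]
  rw [integral_finsetSum _ fun i _ => integrable_finsetSum _ fun j _ => hint i j _]
  push_cast
  refine Finset.sum_congr rfl fun i hi => ?_
  rw [integral_finsetSum _ fun j _ => hint i j _]
  have hik : i ≤ k := Nat.lt_succ_iff.mp (Finset.mem_range.mp hi)
  rw [Finset.sum_eq_single i]
  · rw [integral_const_mul, ← integral_complex_ofReal]
    have : ∀ u : SU2, (u.1 1 0 ^ i * u.1 0 0 ^ (k - i)) *
          starRingEnd ℂ (u.1 1 0 ^ i * u.1 0 0 ^ (k - i)) =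
          (((1 - colWeight u) ^ i * colWeight u ^ (k - i) : ℝ) : ℂ) := by
      intro u
      rw [Complex.mul_conj, ← normSq_one_zero]
      simp [colWeight]
    simp_rw [this]
    ring
  · intro j hj hji
    have hjk : j ≤ k := Nat.lt_succ_iff.mp (Finset.mem_range.mp hj)
    rw [integral_const_mul, integral_mixed_moment k i j hik hjk (Ne.symm hji), mul_zero]
  · intro h; exact absurd hi h

/-- The moments of the uniform distribution: comparing the two evaluations of the moments of linear
forms as polynomials in `c ^ 2` shows that the terms of the binomial expansion of
`1 = ((1 - colWeight u) + colWeight u) ^ k` all have the same integral. -/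
theorem integral_colWeight_pow (k : ℕ) :
    ∫ u : SU2, colWeight u ^ k ∂haarSU2 = 1 / (k + 1) := by
  set M := ∫ u : SU2, colWeight u ^ k ∂haarSU2 with hM
  set m : ℕ → ℝ := fun i => ∫ u : SU2, (1 - colWeight u) ^ i * colWeight u ^ (k - i) ∂haarSU2
    with hm
  let p : Polynomial ℝ := ∑ i ∈ Finset.range (k + 1),
    Polynomial.C ((k.choose i : ℝ) ^ 2 * m i) * Polynomial.X ^ i
  let q : Polynomial ℝ := (1 + Polynomial.X) ^ k * Polynomial.C M
  have hpq : p = q := by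
    apply Polynomial.eq_of_infinite_eval_eq
    refine (Set.Ici_infinite (0 : ℝ)).mono fun s (hs : 0 ≤ s) => ?_
    have h1 := integral_normSq_add_pow k (Real.sqrt s)
    rw [integral_normSq_add_pow_eq_sum, Real.sq_sqrt hs] at h1
    simp only [Set.mem_ofPred_eq, p, q, Polynomial.eval_finsetSum, Polynomial.eval_mul,
      Polynomial.eval_C, Polynomial.eval_pow, Polynomial.eval_X, Polynomial.eval_add,
      Polynomial.eval_one]
    exact h1
  have hmi : ∀ i ∈ Finset.range (k + 1), (k.choose i : ℝ) * m i = M := by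
    intro i hi
    have h := congrArg (fun r => Polynomial.coeff r i) hpq
    simp only [p, q, Polynomial.finsetSum_coeff, Polynomial.coeff_C_mul, Polynomial.coeff_X_pow,
      Polynomial.coeff_mul_C, Polynomial.coeff_one_add_X_pow, mul_ite, mul_one, mul_zero,
      Finset.sum_ite_eq, hi, if_true] at h
    have hpos : (k.choose i : ℝ) ≠ 0 := by
      exact_mod_cast (Nat.choose_pos (Nat.lt_succ_iff.mp (Finset.mem_range.mp hi))).ne'
    apply mul_left_cancel₀ hpos
    linarith
  have hsum : ∑ i ∈ Finset.range (k + 1), (k.choose i : ℝ) * m i = 1 := by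
    simp only [hm, ← integral_const_mul]
    rw [← integral_finsetSum]
    · have : ∀ u : SU2, ∑ i ∈ Finset.range (k + 1),
          (k.choose i : ℝ) * ((1 - colWeight u) ^ i * colWeight u ^ (k - i)) = 1 := by
        intro u
        have h := add_pow (1 - colWeight u) (colWeight u) k
        rw [sub_add_cancel, one_pow] at h
        refine Eq.trans ?_ h.symm
        exact Finset.sum_congr rfl fun i _ => by ring
      simp [this]
    · intro i _
      apply Continuous.integrable_of_compactSpace
      have := continuous_colWeight
      fun_prop
  rw [Finset.sum_congr rfl hmi] at hsum
  simp at hsum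
  field_simp
  linarith

/-- The squared modulus of the upper left entry is uniformly distributed on `[0, 1]`. -/
theorem map_colWeight_haar :
    haarSU2.map colWeight = volume.restrict (Set.Icc (0 : ℝ) 1) := by
  have hmeas : Measurable colWeight := continuous_colWeight.measurable
  have : IsProbabilityMeasure (haarSU2.map colWeight) :=
    Measure.isProbabilityMeasure_map hmeas.aemeasurable
  have hvol : IsProbabilityMeasure (volume.restrict (Set.Icc (0 : ℝ) 1)) := ⟨by simp⟩
  apply ext_of_forall_integral_eq_of_IsFiniteMeasure
  intro f
  rw [integral_map hmeas.aemeasurable f.continuous.aestronglyMeasurable]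
  have hpoly : ∀ p : Polynomial ℝ, ∫ u, p.eval (colWeight u) ∂haarSU2 =
      ∫ s in Set.Icc (0 : ℝ) 1, p.eval s := by
    intro p
    simp only [Polynomial.eval_eq_sum_range]
    rw [integral_finsetSum, integral_finsetSum]
    · refine Finset.sum_congr rfl fun i _ => ?_
      rw [integral_const_mul, integral_const_mul, integral_colWeight_pow,
        integral_Icc_eq_integral_Ioc, ← intervalIntegral.integral_of_le zero_le_one, integral_pow]
      simp
    · intro i _
      exact (by fun_prop : Continuous fun s : ℝ => p.coeff i * s ^ i).integrableOn_Icc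
    · intro i _
      apply Continuous.integrable_of_compactSpace
      have := continuous_colWeight
      fun_prop
  -- Weierstrass approximation extends the equality from polynomials to continuous functions
  rw [← sub_eq_zero, ← abs_nonpos_iff]
  refine le_of_forall_pos_le_add fun ε hε => ?_
  obtain ⟨p, hp⟩ := exists_polynomial_near_of_continuousOn 0 1 f f.continuous.continuousOn
    (ε / 2) (half_pos hε)
  have hfi : Integrable (fun u => f (colWeight u)) haarSU2 :=
    (f.continuous.comp continuous_colWeight).integrable_of_compactSpace
  have hpi : Integrable (fun u => p.eval (colWeight u)) haarSU2 :=
    (p.continuous.comp continuous_colWeight).integrable_of_compactSpace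
  have hfi' : IntegrableOn f (Set.Icc (0 : ℝ) 1) := f.continuous.integrableOn_Icc
  have hpi' : IntegrableOn (fun s => p.eval s) (Set.Icc (0 : ℝ) 1) :=
    p.continuous.integrableOn_Icc
  have h1 : |(∫ u, f (colWeight u) ∂haarSU2) - ∫ u, p.eval (colWeight u) ∂haarSU2| ≤ ε / 2 := by
    rw [← integral_sub hfi hpi, ← Real.norm_eq_abs]
    refine (norm_integral_le_of_norm_le_const (C := ε / 2) (Eventually.of_forall fun u => ?_)).trans
      (by simp)
    rw [Real.norm_eq_abs, abs_sub_comm]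
    exact (hp _ ⟨colWeight_nonneg u, colWeight_le_one u⟩).le
  have h2 : |(∫ s in Set.Icc (0 : ℝ) 1, f s) - ∫ s in Set.Icc (0 : ℝ) 1, p.eval s| ≤ ε / 2 := by
    rw [← integral_sub hfi' hpi', ← Real.norm_eq_abs]
    refine (norm_integral_le_of_norm_le_const (C := ε / 2) ?_).trans (by simp)
    filter_upwards [ae_restrict_mem measurableSet_Icc] with s hs
    rw [Real.norm_eq_abs, abs_sub_comm]
    exact (hp s hs).le
  rw [hpoly p] at h1
  rw [abs_le] at *
  constructor <;> linarith [h1.1, h1.2, h2.1, h2.2]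

end SU2

/-! ### Torus averages, and the distribution of the trace -/

namespace SU2

/-- The average of a function over left translates by the Cartan subgroup. -/
def torusAverage (f : SU2 → ℂ) (u : SU2) : ℂ :=
  (2 * Real.pi : ℂ)⁻¹ * ∫ τ in (-Real.pi)..Real.pi, f (torusElt τ * u)

theorem torusAverage_mul_left (f : SU2 → ℂ) (α : ℝ) (u : SU2) :
    torusAverage f (torusElt α * u) = torusAverage f u := by
  unfold torusAverage
  congr 1
  have hper : Function.Periodic (fun τ => f (torusElt τ * u)) (2 * Real.pi) := fun τ => by
    simp only [torusElt_periodic τ]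
  have h := hper.intervalIntegral_add_eq (-Real.pi + α) (-Real.pi)
  have h2 := intervalIntegral.integral_comp_add_right (a := -Real.pi) (b := Real.pi)
    (fun τ => f (torusElt τ * u)) α
  rw [show -Real.pi + 2 * Real.pi = Real.pi by ring,
    show -Real.pi + α + 2 * Real.pi = Real.pi + α by ring] at h
  rw [← h, ← h2]
  simp_rw [torusElt_add, mul_assoc]

theorem torusAverage_mul_invariant (f w : SU2 → ℂ) (hw : ∀ τ u, w (torusElt τ * u) = w u)
    (u : SU2) : torusAverage (fun u => f u * w u) u = torusAverage f u * w u := by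
  unfold torusAverage
  simp_rw [hw]
  rw [intervalIntegral.integral_mul_const, mul_assoc]

theorem integral_torusAverage (f : SU2 → ℂ) (hf : Continuous f) :
    ∫ u, torusAverage f u ∂haarSU2 = ∫ u, f u ∂haarSU2 := by
  have hpi : (-Real.pi) ≤ Real.pi := by linarith [Real.pi_pos]
  unfold torusAverage
  rw [integral_const_mul]
  simp_rw [intervalIntegral.integral_of_le hpi]
  rw [integral_integral_swap]
  · simp_rw [integral_mul_left_eq_self f]
    rw [setIntegral_const]
    simp only [Measure.real, Real.volume_Ioc, sub_neg_eq_add]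
    rw [ENNReal.toReal_ofReal (by linarith [Real.pi_pos]), Complex.real_smul]
    push_cast
    have : (Real.pi : ℂ) ≠ 0 := by exact_mod_cast Real.pi_ne_zero
    field_simp
    ring
  · have hc : Continuous fun p : SU2 × ℝ => f (torusElt p.2 * p.1) :=
      hf.comp ((continuous_torusElt.comp continuous_snd).mul continuous_fst)
    have h1 : IntegrableOn (fun p : SU2 × ℝ => f (torusElt p.2 * p.1))
        (Set.univ ×ˢ Set.Icc (-Real.pi) Real.pi) (haarSU2.prod volume) :=
      hc.continuousOn.integrableOn_compact (isCompact_univ.prod isCompact_Icc)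
    rw [IntegrableOn, ← Measure.prod_restrict, Measure.restrict_univ] at h1
    exact h1.mono_measure (Measure.prod_mono le_rfl (Measure.restrict_mono Set.Ioc_subset_Icc_self le_rfl))

theorem continuous_torusAverage {f : SU2 → ℂ} (hf : Continuous f) :
    Continuous (torusAverage f) := by
  unfold torusAverage
  refine continuous_const.mul ?_
  apply intervalIntegral.continuous_parametric_intervalIntegral_of_continuous'
  exact hf.comp ((continuous_torusElt.comp continuous_snd).mul continuous_fst)

/-- The real rotation by the angle `α`. -/
def rotation (α : ℝ) : SU2 := ofColumn (Real.cos α : ℂ) (Real.sin α : ℂ) (by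
  rw [Complex.normSq_ofReal, Complex.normSq_ofReal]
  nlinarith [Real.sin_sq_add_cos_sq α])

theorem continuous_rotation : Continuous rotation := by
  apply Continuous.subtype_mk
  apply continuous_matrix
  intro i j
  fin_cases i <;> fin_cases j <;> simp <;> fun_prop

/-- A rotation whose upper left entry has squared modulus `s`. -/
def weightSection (s : ℝ) : SU2 := rotation (Real.arccos (Real.sqrt s))

theorem continuous_weightSection : Continuous weightSection :=
  continuous_rotation.comp (Real.continuous_arccos.comp Real.continuous_sqrt)

theorem weightSection_zero_zero {s : ℝ} (h1 : s ≤ 1) :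
    (weightSection s).1 0 0 = (Real.sqrt s : ℝ) := by
  have : Real.cos (Real.arccos (Real.sqrt s)) = Real.sqrt s :=
    Real.cos_arccos (by linarith [Real.sqrt_nonneg s]) (Real.sqrt_le_one.mpr h1)
  simp [weightSection, rotation, ofColumn, -Complex.ofReal_cos, this]

theorem weightSection_one_zero {s : ℝ} (h0 : 0 ≤ s) :
    (weightSection s).1 1 0 = (Real.sqrt (1 - s) : ℝ) := by
  have : Real.sin (Real.arccos (Real.sqrt s)) = Real.sqrt (1 - s) := by
    rw [Real.sin_arccos, Real.sq_sqrt h0]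
  simp [weightSection, rotation, ofColumn, -Complex.ofReal_sin, this]

/-- The Cartan decomposition `SU(2) = T A T`. -/
theorem exists_cartan_decomposition (u : SU2) :
    ∃ α β : ℝ, u = torusElt α * weightSection (colWeight u) * torusElt β := by
  refine ⟨(Complex.arg (u.1 0 0) - Complex.arg (u.1 1 0)) / 2,
    (Complex.arg (u.1 0 0) + Complex.arg (u.1 1 0)) / 2, ?_⟩
  have hs0 : Real.sqrt (colWeight u) = ‖u.1 0 0‖ := rfl
  have hs1 : Real.sqrt (1 - colWeight u) = ‖u.1 1 0‖ := by
    rw [← normSq_one_zero]; rfl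
  apply ext_column
  · rw [mul_apply_zero, mul_apply_zero, weightSection_zero_zero (colWeight_le_one u), hs0]
    simp only [torusElt_zero_zero, torusElt_one_zero, torusElt_zero_one, zero_mul, mul_zero,
      add_zero]
    rw [mul_comm (Complex.exp _), mul_assoc, ← Complex.exp_add, ← add_mul]
    conv_lhs => rw [← Complex.norm_mul_exp_arg_mul_I (u.1 0 0)]
    push_cast
    ring_nf
  · rw [mul_apply_one, mul_apply_one, weightSection_one_zero (colWeight_nonneg u), hs1]
    simp only [torusElt_zero_zero, torusElt_one_zero, torusElt_one_one, zero_mul, mul_zero,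
      add_zero, zero_add]
    rw [mul_comm (Complex.exp _), mul_assoc, ← Complex.exp_add]
    conv_lhs => rw [← Complex.norm_mul_exp_arg_mul_I (u.1 1 0)]
    push_cast
    ring_nf

theorem colWeight_torus_mul (α : ℝ) (u : SU2) : colWeight (torusElt α * u) = colWeight u := by
  unfold colWeight
  rw [mul_apply_zero]
  simp [Complex.normSq_eq_norm_sq, Complex.norm_exp_ofReal_mul_I]

theorem integral_comp_colWeight (f : ℝ → ℂ) (hf : Continuous f) :
    ∫ u, f (colWeight u) ∂haarSU2 = ∫ s in (0 : ℝ)..1, f s := by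
  rw [intervalIntegral.integral_of_le zero_le_one, ← integral_Icc_eq_integral_Ioc,
    ← map_colWeight_haar, integral_map continuous_colWeight.aemeasurable
    hf.aestronglyMeasurable]

/-- Disintegration of the Haar measure along `colWeight`, for functions on `SU(2) / T`. -/
theorem integral_mul_comp_colWeight (f : SU2 → ℂ) (hf : Continuous f)
    (hinv : ∀ u τ, f (u * torusElt τ) = f u) (K : ℝ → ℂ) (hK : Continuous K) :
    ∫ u, f u * K (colWeight u) ∂haarSU2 =
      ∫ s in (0 : ℝ)..1, torusAverage f (weightSection s) * K s := by
  have hw : Continuous fun u => K (colWeight u) := hK.comp continuous_colWeight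
  rw [← integral_torusAverage (fun u => f u * K (colWeight u)) (hf.mul hw)]
  have h : ∀ u, torusAverage (fun u => f u * K (colWeight u)) u =
      torusAverage f (weightSection (colWeight u)) * K (colWeight u) := by
    intro u
    rw [torusAverage_mul_invariant f (fun u => K (colWeight u))
      (fun τ u => by simp only [colWeight_torus_mul])]
    congr 1
    obtain ⟨α, β, h⟩ := exists_cartan_decomposition u
    conv_lhs => rw [h, mul_assoc, torusAverage_mul_left]
    unfold torusAverage
    simp_rw [← mul_assoc, hinv]
  simp_rw [h]
  exact integral_comp_colWeight _
    (((continuous_torusAverage hf).comp continuous_weightSection).mul hK)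

/-- The trace of the product of a fixed torus element and a conjugate of another one is an affine
function of `colWeight`. -/
theorem halfTrace_torusElt_mul_conj (ρ b : ℝ) (v : SU2) :
    halfTrace (torusElt ρ * (v * torusElt b * v⁻¹)) =
      Real.cos ρ * Real.cos b - Real.sin ρ * Real.sin b * (2 * colWeight v - 1) := by
  have h1 : v.1 0 0 * starRingEnd ℂ (v.1 0 0) = (colWeight v : ℂ) := by
    rw [Complex.mul_conj]; rfl
  have h2 : starRingEnd ℂ (v.1 1 0) * v.1 1 0 = ((1 - colWeight v : ℝ) : ℂ) := by
    rw [mul_comm, Complex.mul_conj, normSq_one_zero]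
  have h3 : (v * torusElt b * v⁻¹).1 0 0 =
      (Real.cos b : ℂ) + (Real.sin b * (2 * colWeight v - 1) : ℝ) * Complex.I := by
    rw [mul_apply_zero, mul_apply_zero, (entries_eq (v * torusElt b)).1, mul_apply_one]
    simp only [torusElt_zero_zero, torusElt_one_zero, mul_zero, add_zero, (inv_entries v).1,
      (inv_entries v).2, map_mul, ← Complex.exp_conj, Complex.conj_ofReal, Complex.conj_I]
    have e1 : Complex.exp (b * Complex.I) = Real.cos b + Real.sin b * Complex.I := by
      rw [Complex.exp_mul_I]; simp
    have e2 : Complex.exp (b * -Complex.I) = Real.cos b - Real.sin b * Complex.I := by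
      rw [show (b : ℂ) * -Complex.I = ((-b : ℝ) : ℂ) * Complex.I by push_cast; ring,
        Complex.exp_mul_I]; simp; ring
    rw [e1, e2]
    simp only [Complex.ofReal_sub, Complex.ofReal_mul, Complex.ofReal_one,
      Complex.ofReal_ofNat] at h2 ⊢
    linear_combination (Real.cos b + Real.sin b * Complex.I) * h1 +
      (Real.cos b - Real.sin b * Complex.I) * h2
  rw [halfTrace_eq, mul_apply_zero, h3, torusElt_zero_zero, torusElt_zero_one, zero_mul, add_zero,
    Complex.exp_ofReal_mul_I]
  simp [-Complex.ofReal_cos, -Complex.ofReal_sin, -Complex.ofReal_mul]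
  ring

/-- The density of the trace of an element of `SU(2)` is that of the semicircle law. -/
theorem integral_comp_halfTrace (K : ℝ → ℂ) (hK : Continuous K) :
    ∫ u, K (halfTrace u) ∂haarSU2 =
      (2 / Real.pi : ℂ) * ∫ x in (-1 : ℝ)..1, K x * (Real.sqrt (1 - x ^ 2) : ℝ) := by
  have hf : Continuous fun u : SU2 => K (halfTrace u) := hK.comp continuous_halfTrace
  have hpi : (-Real.pi) ≤ Real.pi := by linarith [Real.pi_pos]
  set g : ℝ → ℂ := fun s => torusAverage (fun u => K (halfTrace u)) (weightSection s) with hg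
  have hgc : Continuous g := (continuous_torusAverage hf).comp continuous_weightSection
  -- the torus average of a class function depends on `colWeight u = r ^ 2` only, and is the
  -- average of `K` over the projections of the points of a circle of radius `r`
  have havg : ∀ u, torusAverage (fun u => K (halfTrace u)) u = g (colWeight u) := by
    intro u
    obtain ⟨α, β, h⟩ := exists_cartan_decomposition u
    have h1 : torusAverage (fun u => K (halfTrace u)) (weightSection (colWeight u) * torusElt β) =
        torusAverage (fun u => K (halfTrace u)) (torusElt β * weightSection (colWeight u)) := by
      unfold torusAverage
      congr 2
      ext τ
      change K (halfTrace _) = K (halfTrace _)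
      rw [← mul_assoc, halfTrace_mul_comm, ← mul_assoc, ← mul_assoc, torusElt_mul_comm]
    conv_lhs => rw [h, mul_assoc, torusAverage_mul_left, h1, torusAverage_mul_left]
  have hgr : ∀ r ∈ Set.Ioo (0 : ℝ) 1,
      g (r ^ 2) = (2 * Real.pi : ℂ)⁻¹ * ∫ τ in Set.Ioo (-Real.pi) Real.pi, K (r * Real.cos τ) := by
    intro r hr
    have h1 : r ^ 2 ≤ 1 := pow_le_one₀ hr.1.le hr.2.le
    simp only [hg, torusAverage]
    rw [intervalIntegral.integral_of_le hpi, integral_Ioc_eq_integral_Ioo]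
    congr 2
    ext τ
    congr 1
    rw [halfTrace_eq, mul_apply_zero, weightSection_zero_zero h1, Real.sqrt_sq hr.1.le,
      torusElt_zero_zero, torusElt_zero_one, zero_mul, add_zero, Complex.re_mul_ofReal,
      Complex.exp_ofReal_mul_I_re, mul_comm]
  -- Polar coordinates turn the radial and the torus average into an average over the unit disc.
  set D : Set (ℝ × ℝ) := {p | p.1 ^ 2 + p.2 ^ 2 < 1} with hD
  have hDm : MeasurableSet D := by
    apply IsOpen.measurableSet
    exact isOpen_lt (by fun_prop) continuous_const
  have hcart : ∫ p in D, K p.1 = 2 * ∫ x in (-1 : ℝ)..1, K x * (Real.sqrt (1 - x ^ 2) : ℝ) := by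
    have hint : Integrable (D.indicator fun p => K p.1) (volume.prod volume) := by
      rw [← Measure.volume_eq_prod, integrable_indicator_iff hDm]
      have hc : Continuous fun p : ℝ × ℝ => K p.1 := by fun_prop
      refine (hc.continuousOn.integrableOn_compact
        ((isCompact_Icc (a := (-1 : ℝ)) (b := 1)).prod
          (isCompact_Icc (a := (-1 : ℝ)) (b := 1)))).mono_set ?_
      rintro ⟨x, y⟩ hp
      simp only [hD, Set.mem_ofPred_eq] at hp
      simp only [Set.mem_prod, Set.mem_Icc]
      refine ⟨⟨?_, ?_⟩, ⟨?_, ?_⟩⟩ <;> nlinarith [sq_nonneg x, sq_nonneg y]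
    rw [← integral_indicator hDm, Measure.volume_eq_prod, integral_prod _ hint]
    have hfib : ∀ x : ℝ, ∫ y, D.indicator (fun p => K p.1) (x, y) =
        K x * (2 * (Real.sqrt (1 - x ^ 2) : ℝ)) := by
      intro x
      have h1 : (fun y => D.indicator (fun p => K p.1) (x, y)) =
          (Set.Ioo (-Real.sqrt (1 - x ^ 2)) (Real.sqrt (1 - x ^ 2))).indicator
            fun _ => K x := by
        ext y
        have hiff : (x, y) ∈ D ↔
            y ∈ Set.Ioo (-Real.sqrt (1 - x ^ 2)) (Real.sqrt (1 - x ^ 2)) := by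
          rw [Set.mem_Ioo, ← abs_lt, Real.lt_sqrt (abs_nonneg y), sq_abs]
          simp only [hD, Set.mem_ofPred_eq]
          constructor <;> intro h <;> linarith
        by_cases h : (x, y) ∈ D
        · rw [Set.indicator_of_mem h, Set.indicator_of_mem (hiff.mp h)]
        · rw [Set.indicator_of_notMem h, Set.indicator_of_notMem (fun h' => h (hiff.mpr h'))]
      rw [h1, integral_indicator measurableSet_Ioo, setIntegral_const, Measure.real,
        Real.volume_Ioo, sub_neg_eq_add, ENNReal.toReal_ofReal (by positivity), Complex.real_smul]
      push_cast
      ring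
    simp_rw [hfib]
    rw [intervalIntegral.integral_of_le (by norm_num), ← integral_const_mul,
      ← integral_indicator measurableSet_Ioc]
    congr 1
    ext x
    by_cases hx : x ∈ Set.Ioc (-1 : ℝ) 1
    · rw [Set.indicator_of_mem hx]
      ring
    · rw [Set.indicator_of_notMem hx, Real.sqrt_eq_zero_of_nonpos]
      · simp
      · simp only [Set.mem_Ioc, not_and_or, not_lt, not_le] at hx
        rcases hx with hx | hx <;> nlinarith
  have hpolar : ∫ p in D, K p.1 = ∫ r in Set.Ioo (0 : ℝ) 1,
      (r : ℂ) * ∫ τ in Set.Ioo (-Real.pi) Real.pi, K (r * Real.cos τ) := by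
    rw [← integral_indicator hDm, ← integral_comp_polarCoord_symm]
    have h1 : ∀ p ∈ polarCoord.target, p.1 • D.indicator (fun p => K p.1) (polarCoord.symm p) =
        (Set.Ioo (0 : ℝ) 1 ×ˢ Set.Ioo (-Real.pi) Real.pi).indicator
          (fun p => (p.1 : ℂ) * K (p.1 * Real.cos p.2)) p := by
      rintro ⟨r, τ⟩ hp
      rw [polarCoord_target] at hp
      obtain ⟨hr, hτ⟩ := hp
      simp only [Set.mem_Ioi] at hr
      have hmem : polarCoord.symm (r, τ) ∈ D ↔
          (r, τ) ∈ Set.Ioo (0 : ℝ) 1 ×ˢ Set.Ioo (-Real.pi) Real.pi := by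
        have e : (r * Real.cos τ) ^ 2 + (r * Real.sin τ) ^ 2 = r ^ 2 := by
          linear_combination r ^ 2 * Real.sin_sq_add_cos_sq τ
        simp only [polarCoord_symm_apply, hD, Set.mem_ofPred_eq, Set.mem_prod, Set.mem_Ioo, e]
        constructor
        · intro h
          exact ⟨⟨hr, by nlinarith⟩, hτ⟩
        · rintro ⟨⟨_, h⟩, _⟩
          nlinarith
      by_cases h : (r, τ) ∈ Set.Ioo (0 : ℝ) 1 ×ˢ Set.Ioo (-Real.pi) Real.pi
      · rw [Set.indicator_of_mem h, Set.indicator_of_mem (hmem.mpr h), polarCoord_symm_apply,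
          Complex.real_smul]
      · rw [Set.indicator_of_notMem h, Set.indicator_of_notMem (fun h' => h (hmem.mp h')),
          smul_zero]
    rw [setIntegral_congr_fun polarCoord.open_target.measurableSet h1,
      setIntegral_indicator (measurableSet_Ioo.prod measurableSet_Ioo), Set.inter_eq_self_of_subset_right]
    · rw [Measure.volume_eq_prod, setIntegral_prod]
      · simp_rw [integral_const_mul]
      · have hc : Continuous fun p : ℝ × ℝ => (p.1 : ℂ) * K (p.1 * Real.cos p.2) := by fun_prop
        exact (hc.continuousOn.integrableOn_compact (isCompact_Icc.prod isCompact_Icc)).mono_set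
          (Set.prod_mono Set.Ioo_subset_Icc_self Set.Ioo_subset_Icc_self)
    · rw [polarCoord_target]
      exact Set.prod_mono Set.Ioo_subset_Ioi_self le_rfl
  rw [← integral_torusAverage _ hf]
  simp_rw [havg]
  rw [integral_comp_colWeight g hgc]
  have hsub := intervalIntegral.integral_deriv_smul_comp (a := 0) (b := 1)
    (f := fun r : ℝ => r ^ 2) (f' := fun r => 2 * r) (g := g)
    (fun r _ => by simpa using hasDerivAt_pow 2 r) (by fun_prop) hgc
  simp only [ne_eq, OfNat.ofNat_ne_zero, not_false_eq_true, zero_pow, one_pow] at hsub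
  rw [← hsub, intervalIntegral.integral_of_le zero_le_one, integral_Ioc_eq_integral_Ioo,
    setIntegral_congr_fun (g := fun r : ℝ => (Real.pi : ℂ)⁻¹ *
      ((r : ℂ) * ∫ τ in Set.Ioo (-Real.pi) Real.pi, K (r * Real.cos τ))) measurableSet_Ioo,
    integral_const_mul, ← hpolar, hcart]
  · ring
  · intro r hr
    simp only [Function.comp]
    rw [hgr r hr, Complex.real_smul]
    push_cast
    rw [mul_inv]
    ring

end SU2

/-! ### Regularized class delta functions as functions of the trace -/

section

theorem continuous_integral_of_compactSpace {X Y E : Type*} [TopologicalSpace X]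
    [FirstCountableTopology X] [LocallyCompactSpace X] [TopologicalSpace Y] [CompactSpace Y]
    [MeasurableSpace Y] [OpensMeasurableSpace Y] [NormedAddCommGroup E] [NormedSpace ℝ E]
    [SecondCountableTopologyEither Y E] {μ : Measure Y} [IsFiniteMeasure μ] {f : X → Y → E}
    (hf : Continuous f.uncurry) : Continuous fun x => ∫ y, f x y ∂μ := by
  have := continuous_parametric_integral_of_continuous (μ := μ) hf isCompact_univ
  simpa using this

/-- A continuous function of a parameter and of a point of a compact space is uniformly close to
its restriction to `g₀` for parameters near `g₀`. -/
theorem eventually_forall_norm_sub_lt {X G E : Type*} [TopologicalSpace X] [CompactSpace X]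
    [TopologicalSpace G] [SeminormedAddCommGroup E] (f : G → X → E) (hf : Continuous f.uncurry)
    (g₀ : G) {ε : ℝ} (hε : 0 < ε) : ∀ᶠ g in 𝓝 g₀, ∀ x, ‖f g x - f g₀ x‖ < ε := by
  have h := isCompact_univ.eventually_forall_of_forall_eventually (x₀ := g₀) (K := (Set.univ : Set X))
    (P := fun g x => ‖f g x - f g₀ x‖ < ε) (fun x _ => by
      have hc : Continuous fun z : G × X => ‖f z.1 z.2 - f g₀ z.2‖ :=
        (hf.sub (hf.comp (continuous_const.prodMk continuous_snd))).norm
      exact hc.continuousAt.eventually_lt continuousAt_const (by simpa using hε))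
  filter_upwards [h] with g hg x using hg x (Set.mem_univ x)

namespace SU2

/-- Disintegration over the traces of the products of `A` with the elements of a conjugacy class. -/
theorem integral_conj_mul_comp_halfTrace (A w : SU2) (ρ b : ℝ)
    (hA : A = w * torusElt ρ * w⁻¹) (f : SU2 → ℂ) (hf : Continuous f) (K : ℝ → ℂ)
    (hK : Continuous K) :
    ∫ v : SU2, f (v * torusElt b * v⁻¹) * K (halfTrace (A * (v * torusElt b * v⁻¹))) ∂haarSU2 =
      ∫ s in (0 : ℝ)..1,
        torusAverage (fun v => f (w * (v * torusElt b * v⁻¹) * w⁻¹)) (weightSection s) *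
        K (Real.cos ρ * Real.cos b - Real.sin ρ * Real.sin b * (2 * s - 1)) := by
  have hinv : ∀ u τ, f (w * (u * torusElt τ * torusElt b * (u * torusElt τ)⁻¹) * w⁻¹) =
      f (w * (u * torusElt b * u⁻¹) * w⁻¹) := by
    intro u τ
    have : u * torusElt τ * torusElt b * (u * torusElt τ)⁻¹ = u * torusElt b * u⁻¹ := by
      rw [mul_assoc u, torusElt_mul_comm]
      group
    rw [this]
  have hc : Continuous fun v : SU2 => w * (v * torusElt b * v⁻¹) * w⁻¹ :=
    (continuous_const.mul ((continuous_id.mul continuous_const).mul continuous_inv)).mul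
      continuous_const
  have hfw : Continuous fun v : SU2 => f (w * (v * torusElt b * v⁻¹) * w⁻¹) := hf.comp hc
  have hl : Continuous fun s : ℝ =>
      Real.cos ρ * Real.cos b - Real.sin ρ * Real.sin b * (2 * s - 1) := by fun_prop
  have h := integral_mul_comp_colWeight (fun v => f (w * (v * torusElt b * v⁻¹) * w⁻¹)) hfw hinv
    (fun s => K (Real.cos ρ * Real.cos b - Real.sin ρ * Real.sin b * (2 * s - 1))) (hK.comp hl)
  rw [← h, ← integral_mul_left_eq_self
    (fun v : SU2 => f (v * torusElt b * v⁻¹) * K (halfTrace (A * (v * torusElt b * v⁻¹)))) w]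
  congr 1
  ext v
  have e1 : w * v * torusElt b * (w * v)⁻¹ = w * (v * torusElt b * v⁻¹) * w⁻¹ := by group
  have e2 : A * (w * (v * torusElt b * v⁻¹) * w⁻¹) =
      w * (torusElt ρ * (v * torusElt b * v⁻¹)) * w⁻¹ := by rw [hA]; group
  rw [e1, e2, halfTrace_conj, halfTrace_torusElt_mul_conj]

end SU2

section ClassDelta

variable {φ : SU2 → ℝ} {θ : ℝ}

theorem continuous_classDelta (hφ : Continuous φ) (θ : ℝ) : Continuous (classDelta φ θ) := by
  unfold classDelta
  apply continuous_integral_of_compactSpace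
  simp only [Function.uncurry_def]
  fun_prop

theorem classDelta_nonneg (hφ : ∀ g, 0 ≤ φ g) (θ : ℝ) (g : SU2) : 0 ≤ classDelta φ θ g :=
  integral_nonneg fun _ => hφ _

theorem classDelta_conj (hφ : ∀ x g, φ (x * g * x⁻¹) = φ g) (θ : ℝ) (x g : SU2) :
    classDelta φ θ (x * g * x⁻¹) = classDelta φ θ g := by
  unfold classDelta
  rw [← integral_mul_left_eq_self _ x]
  congr 1
  ext u
  rw [← hφ x (g * (u * torusElt θ * u⁻¹))]
  congr 1
  group

theorem integral_classDelta (hφ : Continuous φ) (θ : ℝ) :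
    ∫ g, classDelta φ θ g ∂haarSU2 = ∫ g, φ g ∂haarSU2 := by
  unfold classDelta
  rw [integral_integral_swap]
  · simp_rw [integral_mul_right_eq_self φ]
    simp
  · apply Continuous.integrable_of_compactSpace
    simp only [Function.uncurry_def]
    fun_prop

/-- The class function `classDelta φ θ` as a function of half the trace. -/
def classProfile (φ : SU2 → ℝ) (θ x : ℝ) : ℝ := classDelta φ θ (torusElt (Real.arccos x))

theorem continuous_classProfile (hφ : Continuous φ) (θ : ℝ) : Continuous (classProfile φ θ) :=
  (continuous_classDelta hφ θ).comp (SU2.continuous_torusElt.comp Real.continuous_arccos)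

theorem classDelta_eq_classProfile (hφ : ∀ x g, φ (x * g * x⁻¹) = φ g) (θ : ℝ) (g : SU2) :
    classDelta φ θ g = classProfile φ θ g.halfTrace := by
  obtain ⟨v, hv⟩ := SU2.exists_diagonalization g
  conv_lhs => rw [hv]
  exact classDelta_conj hφ θ v _

theorem integral_classProfile (hφ : Continuous φ) (hφ' : ∀ x g, φ (x * g * x⁻¹) = φ g)
    (h1 : ∫ g, φ g ∂haarSU2 = 1) (θ : ℝ) :
    ∫ x in (-1 : ℝ)..1, classProfile φ θ x * Real.sqrt (1 - x ^ 2) = Real.pi / 2 := by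
  have h := SU2.integral_comp_halfTrace (fun x => (classProfile φ θ x : ℂ))
    (Complex.continuous_ofReal.comp (continuous_classProfile hφ θ))
  simp_rw [← classDelta_eq_classProfile hφ' θ, ← Complex.ofReal_mul] at h
  rw [integral_complex_ofReal, integral_classDelta hφ, h1, intervalIntegral.integral_ofReal] at h
  have h' : (1 : ℝ) = 2 / Real.pi * ∫ x in (-1 : ℝ)..1, classProfile φ θ x * Real.sqrt (1 - x ^ 2) := by
    exact_mod_cast h
  have := Real.pi_pos
  field_simp at h'
  linarith

end ClassDelta

theorem IsDeltaSequence.classProfile_eventually_eq_zero {φ : ℕ → SU2 → ℝ} (hφ : IsDeltaSequence φ)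
    (θ : ℝ) {δ : ℝ} (hδ : 0 < δ) :
    ∀ᶠ k in atTop, ∀ x ∈ Set.Icc (-1 : ℝ) 1, δ ≤ |x - Real.cos θ| → classProfile (φ k) θ x = 0 := by
  have h := eventually_forall_norm_sub_lt (X := SU2)
    (fun w u : SU2 => SU2.halfTrace (w * (u * torusElt θ * u⁻¹)⁻¹))
    (by
      have := SU2.continuous_halfTrace
      simp only [Function.uncurry_def]
      fun_prop) 1 hδ
  filter_upwards [hφ.support_shrinks _ h] with k hk x hx hxδ
  refine integral_eq_zero_of_ae (Eventually.of_forall fun u => ?_)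
  by_contra hne
  have h1 := hk hne u
  simp only [mul_inv_cancel_right, one_mul, SU2.halfTrace_inv, SU2.halfTrace_conj,
    SU2.halfTrace_torusElt, Real.cos_arccos hx.1 hx.2, Real.norm_eq_abs] at h1
  exact absurd h1 (not_lt.mpr hxδ)

/-- Continuous nonnegative functions on `[-1, 1]` which concentrate at an interior point `x₀`
converge to a multiple of the Dirac measure, the multiple being fixed by their integrals against
the semicircle density. -/
theorem tendsto_integral_of_concentrating {K : ℕ → ℝ → ℝ} {x₀ : ℝ}
    (hK : ∀ k, Continuous (K k)) (hK0 : ∀ k x, 0 ≤ K k x)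
    (hsupp : ∀ δ > 0, ∀ᶠ k in atTop, ∀ x ∈ Set.Icc (-1 : ℝ) 1, δ ≤ |x - x₀| → K k x = 0)
    (hmass : ∀ k, ∫ x in (-1 : ℝ)..1, K k x * Real.sqrt (1 - x ^ 2) = Real.pi / 2)
    {lo hi : ℝ} (hlo : -1 ≤ lo) (hle : lo ≤ hi) (hhi : hi ≤ 1) (hne : x₀ ≠ lo) (hne' : x₀ ≠ hi)
    {g : ℝ → ℂ} (hg : Continuous g) :
    Tendsto (fun k => ∫ x in lo..hi, g x * (K k x : ℂ)) atTop
      (𝓝 (if x₀ ∈ Set.Ioo lo hi then g x₀ * (Real.pi / (2 * Real.sqrt (1 - x₀ ^ 2)) : ℝ) else 0)) := by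
  -- restriction of an integral to a neighbourhood of `x₀`
  have hrestr : ∀ (r : ℝ), 0 < r → ∀ (a b : ℝ), -1 ≤ a → b ≤ 1 → a < x₀ - r → x₀ + r < b →
      ∀ᶠ k in atTop, ∀ f : ℝ → ℂ, ∫ x in a..b, f x * (K k x : ℂ) =
        ∫ x in Set.Icc (x₀ - r) (x₀ + r), f x * (K k x : ℂ) := by
    intro r hr a b ha hb har hbr
    filter_upwards [hsupp r hr] with k hk f
    rw [intervalIntegral.integral_of_le (by linarith)]
    apply setIntegral_eq_of_subset_of_forall_sdiff_eq_zero measurableSet_Ioc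
    · intro x hx
      exact ⟨by linarith [hx.1], by linarith [hx.2]⟩
    · rintro x ⟨hx1, hx2⟩
      rw [hk x ⟨by linarith [hx1.1], by linarith [hx1.2]⟩ ?_]
      · simp
      · by_contra hlt
        rw [not_le, abs_lt] at hlt
        exact hx2 ⟨by linarith [hlt.1], by linarith [hlt.2]⟩
  -- if `x₀` is inside, the semicircle density turns `K k` into a sequence of peak functions
  split_ifs with hin
  · obtain ⟨r, hr, hr1, hr2⟩ : ∃ r, 0 < r ∧ lo < x₀ - r ∧ x₀ + r < hi := by
      refine ⟨min (x₀ - lo) (hi - x₀) / 2, ?_, ?_, ?_⟩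
      · have := hin.1; have := hin.2
        have : 0 < min (x₀ - lo) (hi - x₀) := lt_min (by linarith) (by linarith)
        linarith
      · have := min_le_left (x₀ - lo) (hi - x₀); have := hin.1; linarith
      · have := min_le_right (x₀ - lo) (hi - x₀); have := hin.2; linarith
    set s := Set.Icc (x₀ - r) (x₀ + r) with hs
    set w : ℝ → ℝ := fun x => 2 / Real.pi * Real.sqrt (1 - x ^ 2) with hw
    have hwc : Continuous w := by fun_prop
    have hwpos : ∀ x ∈ s, 0 < w x := by
      intro x hx
      have h1 : 0 < 1 - x ^ 2 := by nlinarith [hx.1, hx.2]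
      have := Real.sqrt_pos.mpr h1
      have := Real.pi_pos
      positivity
    have hx₀s : x₀ ∈ s := ⟨by linarith, by linarith⟩
    have hq : ContinuousOn (fun x => g x * ((w x)⁻¹ : ℝ)) s := by
      refine hg.continuousOn.mul (Complex.continuous_ofReal.comp_continuousOn
        (hwc.continuousOn.inv₀ fun x hx => (hwpos x hx).ne'))
    have hsnhds : s ∈ 𝓝 x₀ := Icc_mem_nhds (by linarith) (by linarith)
    have hpeak := tendsto_setIntegral_peak_smul_of_integrableOn_of_tendsto (μ := volume)
      (l := atTop) (s := s) (t := s) (x₀ := x₀) (φ := fun k x => K k x * w x)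
      (g := fun x => g x * ((w x)⁻¹ : ℝ)) (a := g x₀ * ((w x₀)⁻¹ : ℝ))
      measurableSet_Icc measurableSet_Icc le_rfl
      (by rw [nhdsWithin_eq_nhds.mpr hsnhds]; exact hsnhds) (by simp [hs])
      (Eventually.of_forall fun k x hx => mul_nonneg (hK0 k x) (hwpos x hx).le)
      (by
        intro u hu hxu
        obtain ⟨δ, hδ, hball⟩ := Metric.isOpen_iff.mp hu x₀ hxu
        rw [Metric.tendstoUniformlyOn_iff]
        intro ε hε
        filter_upwards [hsupp δ hδ] with k hk x hx
        rw [hk x ⟨by linarith [hx.1.1], by linarith [hx.1.2]⟩ ?_]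
        · simpa using hε
        · by_contra hlt
          exact hx.2 (hball (by rw [Metric.mem_ball, Real.dist_eq]; linarith)))
      (by
        apply tendsto_const_nhds.congr'
        filter_upwards [hrestr r hr (-1) 1 le_rfl le_rfl (by linarith) (by linarith)] with k hk
        have h1 := hk (fun x => (w x : ℂ))
        have h2 : ∀ x, (w x : ℂ) * (K k x : ℂ) = ((K k x * w x : ℝ) : ℂ) := by
          intro x; push_cast; ring
        simp_rw [h2] at h1
        rw [intervalIntegral.integral_ofReal, integral_complex_ofReal] at h1
        have h3 := Complex.ofReal_injective h1
        rw [← h3]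
        simp only [hw]
        have h4 : ∀ x, K k x * (2 / Real.pi * Real.sqrt (1 - x ^ 2)) =
            2 / Real.pi * (K k x * Real.sqrt (1 - x ^ 2)) := fun x => by ring
        simp_rw [h4]
        rw [intervalIntegral.integral_const_mul, hmass]
        field_simp)
      (Eventually.of_forall fun k => ((hK k).mul hwc).aestronglyMeasurable)
      (hq.integrableOn_compact isCompact_Icc)
      (hq x₀ hx₀s)
    have hval : g x₀ * ((w x₀)⁻¹ : ℝ) = g x₀ * (Real.pi / (2 * Real.sqrt (1 - x₀ ^ 2)) : ℝ) := by
      simp only [hw]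
      congr 2
      rw [mul_inv, inv_div]
      ring
    rw [hval] at hpeak
    refine hpeak.congr' ?_
    filter_upwards [hrestr r hr lo hi hlo hhi hr1 hr2] with k hk
    rw [hk]
    refine setIntegral_congr_fun measurableSet_Icc fun x hx => ?_
    have h1 : (w x : ℂ) ≠ 0 := by exact_mod_cast (hwpos x hx).ne'
    simp only [Complex.real_smul]
    push_cast
    field_simp
  -- if `x₀` is outside, the interval keeps a distance from it
  · obtain ⟨δ, hδ, hδ'⟩ : ∃ δ > 0, ∀ x ∈ Set.Icc lo hi, δ ≤ |x - x₀| := by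
      simp only [Set.mem_Ioo, not_and_or, not_lt] at hin
      rcases hin with h | h
      · have : x₀ < lo := lt_of_le_of_ne h hne
        exact ⟨lo - x₀, by linarith, fun x hx => by
          rw [abs_of_nonneg] <;> linarith [hx.1]⟩
      · have : hi < x₀ := lt_of_le_of_ne h hne'.symm
        exact ⟨x₀ - hi, by linarith, fun x hx => by
          rw [abs_sub_comm, abs_of_nonneg] <;> linarith [hx.2]⟩
    apply tendsto_const_nhds.congr'
    filter_upwards [hsupp δ hδ] with k hk
    symm
    rw [intervalIntegral.integral_congr (g := fun _ => (0 : ℂ)), intervalIntegral.integral_zero]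
    intro x hx
    rw [Set.uIcc_of_le hle] at hx
    simp only
    rw [hk x ⟨by linarith [hx.1], by linarith [hx.2]⟩ (hδ' x hx)]
    simp

end

/-! ### A conjugacy class against a class delta function -/

section

namespace SU2

/-- The sine of the rotation angle of an element of `SU(2)`. -/
def sinAngle (A : SU2) : ℝ := Real.sqrt (1 - halfTrace A ^ 2)

theorem continuous_sinAngle : Continuous sinAngle :=
  Real.continuous_sqrt.comp (continuous_const.sub (continuous_halfTrace.pow 2))

theorem sinAngle_nonneg (A : SU2) : 0 ≤ sinAngle A := Real.sqrt_nonneg _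

theorem sinAngle_sq (A : SU2) : sinAngle A ^ 2 = 1 - halfTrace A ^ 2 := by
  rw [sinAngle, Real.sq_sqrt]
  have := abs_le.mp (abs_halfTrace_le A)
  nlinarith [this.1, this.2]

/-- The average of `f` over the circle of those conjugates of `torusElt b` whose product with `A`
has half trace `x`. -/
def circleAverage (A : SU2) (b : ℝ) (f : SU2 → ℂ) (x : ℝ) : ℂ :=
  torusAverage (fun v => f ((exists_diagonalization A).choose * (v * torusElt b * v⁻¹) *
    (exists_diagonalization A).choose⁻¹))
    (weightSection ((halfTrace A * Real.cos b + sinAngle A * Real.sin b - x) /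
      (2 * (sinAngle A * Real.sin b))))

theorem circleAverage_const (A : SU2) (b : ℝ) (c : ℂ) (x : ℝ) :
    circleAverage A b (fun _ => c) x = c := by
  unfold circleAverage torusAverage
  rw [intervalIntegral.integral_const, Complex.real_smul]
  have : (Real.pi : ℂ) ≠ 0 := by exact_mod_cast Real.pi_ne_zero
  push_cast
  field_simp
  ring

theorem continuous_circleAverage (A : SU2) (b : ℝ) {f : SU2 → ℂ} (hf : Continuous f) :
    Continuous (circleAverage A b f) := by
  unfold circleAverage
  have hc : ∀ w : SU2, Continuous fun v : SU2 => w * (v * torusElt b * v⁻¹) * w⁻¹ := fun w =>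
    (continuous_const.mul ((continuous_id.mul continuous_const).mul continuous_inv)).mul
      continuous_const
  refine (continuous_torusAverage (hf.comp (hc _))).comp (continuous_weightSection.comp ?_)
  fun_prop

theorem halfTrace_mul_cos_add_mem (A : SU2) (b : ℝ) :
    halfTrace A * Real.cos b + sinAngle A * Real.sin b ≤ 1 ∧
      -1 ≤ halfTrace A * Real.cos b - sinAngle A * Real.sin b := by
  have h1 := sinAngle_sq A
  have h2 := Real.sin_sq_add_cos_sq b
  constructor
  · nlinarith [sq_nonneg (halfTrace A - Real.cos b), sq_nonneg (sinAngle A - Real.sin b)]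
  · nlinarith [sq_nonneg (halfTrace A + Real.cos b), sq_nonneg (sinAngle A - Real.sin b)]

/-- Disintegration over the traces of the products of `A` with the elements of a conjugacy class;
the trace is uniformly distributed on an interval. -/
theorem integral_conj_mul_comp_halfTrace' (A : SU2) {b : ℝ} (hb : 0 < sinAngle A * Real.sin b)
    (f : SU2 → ℂ) (hf : Continuous f) (K : ℝ → ℂ) (hK : Continuous K) :
    ∫ v : SU2, f (v * torusElt b * v⁻¹) * K (halfTrace (A * (v * torusElt b * v⁻¹))) ∂haarSU2 =
      (2 * (sinAngle A * Real.sin b) : ℝ)⁻¹ •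
      ∫ x in (halfTrace A * Real.cos b - sinAngle A * Real.sin b)..
        (halfTrace A * Real.cos b + sinAngle A * Real.sin b), circleAverage A b f x * K x := by
  have hy := abs_le.mp (abs_halfTrace_le A)
  have h0 := integral_conj_mul_comp_halfTrace A (exists_diagonalization A).choose
    (Real.arccos (halfTrace A)) b (exists_diagonalization A).choose_spec f hf K hK
  have hc : 2 * (sinAngle A * Real.sin b) ≠ 0 := by positivity
  have h := intervalIntegral.integral_comp_sub_mul (a := 0) (b := 1)
    (fun x => circleAverage A b f x * K x) hc
    (halfTrace A * Real.cos b + sinAngle A * Real.sin b)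
  rw [show halfTrace A * Real.cos b + sinAngle A * Real.sin b - 2 * (sinAngle A * Real.sin b) * 1 =
    halfTrace A * Real.cos b - sinAngle A * Real.sin b by ring, mul_zero, sub_zero] at h
  refine h0.trans (Eq.trans ?_ h)
  refine intervalIntegral.integral_congr fun s _ => ?_
  have hs : (halfTrace A * Real.cos b + sinAngle A * Real.sin b -
      (halfTrace A * Real.cos b + sinAngle A * Real.sin b - 2 * (sinAngle A * Real.sin b) * s)) /
      (2 * (sinAngle A * Real.sin b)) = s := by
    rw [sub_sub_cancel, mul_div_cancel_left₀ _ hc]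
  have hK' : Real.cos (Real.arccos (halfTrace A)) * Real.cos b -
      Real.sin (Real.arccos (halfTrace A)) * Real.sin b * (2 * s - 1) =
      halfTrace A * Real.cos b + sinAngle A * Real.sin b - 2 * (sinAngle A * Real.sin b) * s := by
    rw [Real.cos_arccos hy.1 hy.2, Real.sin_arccos, ← sinAngle]
    ring
  simp only [circleAverage, hs, hK']

/-- The limit of the integral of `f` over the conjugacy class of `torusElt b` against delta
functions of the conjugacy class of `torusElt a`, evaluated at the product with `A`. -/
def fiberLimit (a b : ℝ) (A : SU2) (f : SU2 → ℂ) : ℂ :=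
  if |halfTrace A * Real.cos b - Real.cos a| < sinAngle A * Real.sin b then
    ((Real.pi / (4 * Real.sin a * (sinAngle A * Real.sin b)) : ℝ) : ℂ) *
      circleAverage A b f (Real.cos a)
  else 0

end SU2

open SU2

variable {φ : ℕ → SU2 → ℝ} {a b : ℝ}

theorem sqrt_one_sub_cos_sq (ha : a ∈ Set.Ioo 0 Real.pi) :
    Real.sqrt (1 - Real.cos a ^ 2) = Real.sin a := by
  rw [← Real.sin_sq, Real.sqrt_sq (Real.sin_pos_of_pos_of_lt_pi ha.1 ha.2).le]

theorem IsDeltaSequence.tendsto_integral_classProfile (hφ : IsDeltaSequence φ)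
    (ha : a ∈ Set.Ioo 0 Real.pi) {lo hi : ℝ} (hlo : -1 ≤ lo) (hle : lo ≤ hi) (hhi : hi ≤ 1)
    (hne : Real.cos a ≠ lo) (hne' : Real.cos a ≠ hi) {g : ℝ → ℂ} (hg : Continuous g) :
    Tendsto (fun k => ∫ x in lo..hi, g x * (classProfile (φ k) a x : ℂ)) atTop
      (𝓝 (if Real.cos a ∈ Set.Ioo lo hi then g (Real.cos a) * (Real.pi / (2 * Real.sin a) : ℝ)
        else 0)) := by
  have h := tendsto_integral_of_concentrating
    (fun k => continuous_classProfile (hφ.continuous k) a)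
    (fun k x => classDelta_nonneg (hφ.nonneg k) _ _)
    (fun δ hδ => hφ.classProfile_eventually_eq_zero a hδ)
    (fun k => integral_classProfile (hφ.continuous k) (hφ.conj_invariant k)
      (hφ.integral_eq_one k) a) hlo hle hhi hne hne' hg
  rwa [sqrt_one_sub_cos_sq ha] at h

theorem IsDeltaSequence.tendsto_integral_mul_classDelta (hφ : IsDeltaSequence φ)
    (ha : a ∈ Set.Ioo 0 Real.pi) (hb : b ∈ Set.Ioo 0 Real.pi) {A : SU2} (hA : 0 < sinAngle A)
    (hne : |halfTrace A * Real.cos b - Real.cos a| ≠ sinAngle A * Real.sin b) {f : SU2 → ℂ}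
    (hf : Continuous f) :
    Tendsto (fun k => ∫ v : SU2, f (v * torusElt b * v⁻¹) *
      (classDelta (φ k) a (A * (v * torusElt b * v⁻¹)) : ℂ) ∂haarSU2) atTop
      (𝓝 (fiberLimit a b A f)) := by
  have hsb := Real.sin_pos_of_pos_of_lt_pi hb.1 hb.2
  have hsa := Real.sin_pos_of_pos_of_lt_pi ha.1 ha.2
  have hpos : 0 < sinAngle A * Real.sin b := mul_pos hA hsb
  have hmem := halfTrace_mul_cos_add_mem A b
  have hne1 : Real.cos a ≠ halfTrace A * Real.cos b - sinAngle A * Real.sin b := by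
    intro h
    apply hne
    rw [h, sub_sub_cancel, abs_of_pos hpos]
  have hne2 : Real.cos a ≠ halfTrace A * Real.cos b + sinAngle A * Real.sin b := by
    intro h
    apply hne
    rw [h, sub_add_cancel_left, abs_neg, abs_of_pos hpos]
  have h := (hφ.tendsto_integral_classProfile ha hmem.2 (by linarith) hmem.1 hne1 hne2
    (continuous_circleAverage A b hf)).const_smul ((2 * (sinAngle A * Real.sin b) : ℝ)⁻¹)
  have hlim : (2 * (sinAngle A * Real.sin b) : ℝ)⁻¹ • (if Real.cos a ∈ Set.Ioo
      (halfTrace A * Real.cos b - sinAngle A * Real.sin b)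
      (halfTrace A * Real.cos b + sinAngle A * Real.sin b) then
      circleAverage A b f (Real.cos a) * (Real.pi / (2 * Real.sin a) : ℝ) else 0) =
      fiberLimit a b A f := by
    have hiff : Real.cos a ∈ Set.Ioo
        (halfTrace A * Real.cos b - sinAngle A * Real.sin b)
        (halfTrace A * Real.cos b + sinAngle A * Real.sin b) ↔
        |halfTrace A * Real.cos b - Real.cos a| < sinAngle A * Real.sin b := by
      rw [abs_lt, Set.mem_Ioo]
      constructor <;> rintro ⟨h1, h2⟩ <;> constructor <;> linarith
    unfold fiberLimit
    simp only [hiff]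
    split_ifs
    · rw [Complex.real_smul]
      have h1 : (Real.sin a : ℂ) ≠ 0 := by exact_mod_cast hsa.ne'
      have h2 : (Real.sin b : ℂ) ≠ 0 := by exact_mod_cast hsb.ne'
      have h3 : (sinAngle A : ℂ) ≠ 0 := by exact_mod_cast hA.ne'
      push_cast at h1 h2 ⊢
      field_simp
      ring
    · simp
  rw [hlim] at h
  refine h.congr fun k => ?_
  rw [← integral_conj_mul_comp_halfTrace' A hpos f hf (fun x => (classProfile (φ k) a x : ℂ))
    (Complex.continuous_ofReal.comp (continuous_classProfile (hφ.continuous k) a))]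
  simp_rw [classDelta_eq_classProfile (hφ.conj_invariant k)]

/-- The dominating bound: the mass of a class delta function is at most its total mass on `[-1, 1]`,
divided by the length of the interval over which the trace runs. -/
theorem IsDeltaSequence.exists_integral_classDelta_le (hφ : IsDeltaSequence φ)
    (ha : a ∈ Set.Ioo 0 Real.pi) (hb : b ∈ Set.Ioo 0 Real.pi) :
    ∃ C : ℝ, 0 ≤ C ∧ ∀ᶠ k in atTop, ∀ A : SU2, 0 < sinAngle A →
      ∫ v : SU2, classDelta (φ k) a (A * (v * torusElt b * v⁻¹)) ∂haarSU2 ≤ C / sinAngle A := by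
  have hsb := Real.sin_pos_of_pos_of_lt_pi hb.1 hb.2
  have hsa := Real.sin_pos_of_pos_of_lt_pi ha.1 ha.2
  have hlt1 : Real.cos a < 1 := by
    have := Real.sin_sq_add_cos_sq a; nlinarith
  have hgt1 : -1 < Real.cos a := by
    have := Real.sin_sq_add_cos_sq a; nlinarith
  have h := hφ.tendsto_integral_classProfile ha le_rfl (by norm_num) le_rfl hgt1.ne' hlt1.ne
    (g := fun _ => 1) continuous_const
  rw [if_pos ⟨hgt1, hlt1⟩] at h
  simp only [one_mul, intervalIntegral.integral_ofReal] at h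
  have h' := (Complex.continuous_re.tendsto _).comp h
  simp only [Function.comp_def, Complex.ofReal_re] at h'
  refine ⟨(Real.pi / (2 * Real.sin a) + 1) / (2 * Real.sin b), by positivity, ?_⟩
  filter_upwards [h'.eventually_lt_const (lt_add_one _)] with k hk A hA
  have hpos : 0 < sinAngle A * Real.sin b := mul_pos hA hsb
  have hmem := halfTrace_mul_cos_add_mem A b
  have hKc := continuous_classProfile (hφ.continuous k) a
  have hI := integral_conj_mul_comp_halfTrace' A hpos (fun _ => 1) continuous_const
    (fun x => (classProfile (φ k) a x : ℂ)) (Complex.continuous_ofReal.comp hKc)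
  simp only [circleAverage_const, one_mul, ← classDelta_eq_classProfile (hφ.conj_invariant k),
    integral_complex_ofReal, intervalIntegral.integral_ofReal] at hI
  rw [Complex.real_smul] at hI
  have hI' : ∫ v : SU2, classDelta (φ k) a (A * (v * torusElt b * v⁻¹)) ∂haarSU2 =
      (2 * (sinAngle A * Real.sin b))⁻¹ *
      ∫ x in (halfTrace A * Real.cos b - sinAngle A * Real.sin b)..
        (halfTrace A * Real.cos b + sinAngle A * Real.sin b), classProfile (φ k) a x := by
    exact_mod_cast hI
  rw [hI']
  have hmono : ∫ x in (halfTrace A * Real.cos b - sinAngle A * Real.sin b)..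
        (halfTrace A * Real.cos b + sinAngle A * Real.sin b), classProfile (φ k) a x ≤
      ∫ x in (-1 : ℝ)..1, classProfile (φ k) a x := by
    apply intervalIntegral.integral_mono_interval hmem.2 (by linarith) hmem.1
    · exact Eventually.of_forall fun x => classDelta_nonneg (hφ.nonneg k) _ _
    · exact hKc.intervalIntegrable _ _
  have hle : ∫ x in (halfTrace A * Real.cos b - sinAngle A * Real.sin b)..
        (halfTrace A * Real.cos b + sinAngle A * Real.sin b), classProfile (φ k) a x ≤
      Real.pi / (2 * Real.sin a) + 1 := hmono.trans hk.le
  calc _ ≤ (2 * (sinAngle A * Real.sin b))⁻¹ * (Real.pi / (2 * Real.sin a) + 1) :=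
        mul_le_mul_of_nonneg_left hle (by positivity)
    _ = _ := by field_simp

end

/-! ### Two conjugacy classes against a delta function -/

section

open SU2

theorem SU2.continuous_conj_torusElt (b : ℝ) :
    Continuous fun v : SU2 => v * torusElt b * v⁻¹ :=
  (continuous_id.mul continuous_const).mul continuous_inv

variable {φ : ℕ → SU2 → ℝ} {a b : ℝ}

/-- A bounded function integrated against a delta function of the class of `torusElt a`. -/
theorem norm_integral_integral_mul_le (ψ : SU2 → ℝ) (hψ : Continuous ψ) (hψ0 : ∀ g, 0 ≤ ψ g)
    (A : SU2) (F : SU2 → SU2 → ℂ) {M : ℝ}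
    (hM : ∀ u v : SU2, ψ (A * (v * torusElt b * v⁻¹) * (u * torusElt a * u⁻¹)) ≠ 0 →
      ‖F (u * torusElt a * u⁻¹) (v * torusElt b * v⁻¹)‖ ≤ M) :
    ‖∫ v : SU2, ∫ u : SU2, F (u * torusElt a * u⁻¹) (v * torusElt b * v⁻¹) *
        (ψ (A * (v * torusElt b * v⁻¹) * (u * torusElt a * u⁻¹)) : ℂ) ∂haarSU2 ∂haarSU2‖ ≤
      M * ∫ v : SU2, classDelta ψ a (A * (v * torusElt b * v⁻¹)) ∂haarSU2 := by
  have hcd : Continuous fun v : SU2 => classDelta ψ a (A * (v * torusElt b * v⁻¹)) :=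
    (continuous_classDelta hψ a).comp (continuous_const.mul (continuous_conj_torusElt b))
  rw [← integral_const_mul]
  refine norm_integral_le_of_norm_le ((continuous_const.mul hcd).integrable_of_compactSpace)
    (Eventually.of_forall fun v => ?_)
  have hcu : Continuous fun u : SU2 => ψ (A * (v * torusElt b * v⁻¹) * (u * torusElt a * u⁻¹)) :=
    hψ.comp (continuous_const.mul (continuous_conj_torusElt a))
  unfold classDelta
  rw [← integral_const_mul]
  refine norm_integral_le_of_norm_le ((continuous_const.mul hcu).integrable_of_compactSpace)
    (Eventually.of_forall fun u => ?_)
  rw [norm_mul, Complex.norm_real, Real.norm_of_nonneg (hψ0 _)]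
  by_cases h : ψ (A * (v * torusElt b * v⁻¹) * (u * torusElt a * u⁻¹)) = 0
  · rw [h]; simp
  · exact mul_le_mul_of_nonneg_right (hM u v h) (hψ0 _)

theorem continuous_conj_pair {F : SU2 → SU2 → ℂ} (hF : Continuous F.uncurry) (a b : ℝ) :
    Continuous fun p : SU2 × SU2 => F (p.2 * torusElt a * p.2⁻¹) (p.1 * torusElt b * p.1⁻¹) :=
  hF.comp (((continuous_conj_torusElt a).comp continuous_snd).prodMk
    ((continuous_conj_torusElt b).comp continuous_fst))

/-- The integral over two conjugacy classes against a delta function of the product with `A`. -/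
theorem IsDeltaSequence.tendsto_integral_integral_mul (hφ : IsDeltaSequence φ)
    (ha : a ∈ Set.Ioo 0 Real.pi) (hb : b ∈ Set.Ioo 0 Real.pi) {A : SU2} (hA : 0 < sinAngle A)
    (hne : |halfTrace A * Real.cos b - Real.cos a| ≠ sinAngle A * Real.sin b)
    (F : SU2 → SU2 → ℂ) (hF : Continuous F.uncurry) :
    Tendsto (fun k => ∫ v : SU2, ∫ u : SU2, F (u * torusElt a * u⁻¹) (v * torusElt b * v⁻¹) *
        (φ k (A * (v * torusElt b * v⁻¹) * (u * torusElt a * u⁻¹)) : ℂ) ∂haarSU2 ∂haarSU2) atTop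
      (𝓝 (fiberLimit a b A fun g => F (A * g)⁻¹ g)) := by
  have hf : Continuous fun g : SU2 => F (A * g)⁻¹ g :=
    hF.comp ((continuous_const.mul continuous_id).inv.prodMk continuous_id)
  have h0 := hφ.tendsto_integral_mul_classDelta ha hb hA hne hf
  obtain ⟨C, hC, hbound⟩ := hφ.exists_integral_classDelta_le ha hb
  -- the first argument of `F` may be replaced by the value forced by the delta function
  have hdiff : Tendsto (fun k => (∫ v : SU2, ∫ u : SU2,
      F (u * torusElt a * u⁻¹) (v * torusElt b * v⁻¹) *
        (φ k (A * (v * torusElt b * v⁻¹) * (u * torusElt a * u⁻¹)) : ℂ) ∂haarSU2 ∂haarSU2) -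
      ∫ v : SU2, F (A * (v * torusElt b * v⁻¹))⁻¹ (v * torusElt b * v⁻¹) *
      (classDelta (φ k) a (A * (v * torusElt b * v⁻¹)) : ℂ) ∂haarSU2) atTop (𝓝 0) := by
    rw [Metric.tendsto_nhds]
    intro ε hε
    have hη : 0 < ε / 2 / (C / sinAngle A + 1) := by positivity
    have hnear := eventually_forall_norm_sub_lt (X := SU2)
      (fun w g : SU2 => F ((A * g)⁻¹ * w) g)
      (hF.comp (((continuous_const.mul continuous_snd).inv.mul continuous_fst).prodMk
        continuous_snd)) 1 hη
    filter_upwards [hφ.support_shrinks _ hnear, hbound] with k hk hkb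
    have hcF := continuous_conj_pair hF a b
    have hcf : Continuous fun p : SU2 × SU2 =>
        F (A * (p.1 * torusElt b * p.1⁻¹))⁻¹ (p.1 * torusElt b * p.1⁻¹) :=
      hf.comp ((continuous_conj_torusElt b).comp continuous_fst)
    have hcφ : Continuous fun p : SU2 × SU2 =>
        (φ k (A * (p.1 * torusElt b * p.1⁻¹) * (p.2 * torusElt a * p.2⁻¹)) : ℂ) :=
      Complex.continuous_ofReal.comp ((hφ.continuous k).comp
        ((continuous_const.mul ((continuous_conj_torusElt b).comp continuous_fst)).mul
          ((continuous_conj_torusElt a).comp continuous_snd)))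
    have hsnd : ∀ v : SU2, F (A * (v * torusElt b * v⁻¹))⁻¹ (v * torusElt b * v⁻¹) *
        (classDelta (φ k) a (A * (v * torusElt b * v⁻¹)) : ℂ) =
        ∫ u : SU2, F (A * (v * torusElt b * v⁻¹))⁻¹ (v * torusElt b * v⁻¹) *
        (φ k (A * (v * torusElt b * v⁻¹) * (u * torusElt a * u⁻¹)) : ℂ) ∂haarSU2 := by
      intro v
      rw [integral_const_mul, integral_complex_ofReal]
      rfl
    simp_rw [hsnd]
    rw [dist_zero_right, ← integral_sub]
    rotate_left
    · exact (continuous_integral_of_compactSpace (hcF.mul hcφ)).integrable_of_compactSpace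
    · exact (continuous_integral_of_compactSpace (hcf.mul hcφ)).integrable_of_compactSpace
    have hsub : ∀ v : SU2, (∫ u : SU2, F (u * torusElt a * u⁻¹) (v * torusElt b * v⁻¹) *
        (φ k (A * (v * torusElt b * v⁻¹) * (u * torusElt a * u⁻¹)) : ℂ) ∂haarSU2) -
        ∫ u : SU2, F (A * (v * torusElt b * v⁻¹))⁻¹ (v * torusElt b * v⁻¹) *
        (φ k (A * (v * torusElt b * v⁻¹) * (u * torusElt a * u⁻¹)) : ℂ) ∂haarSU2 =
        ∫ u : SU2, (fun x y => F x y - F (A * y)⁻¹ y) (u * torusElt a * u⁻¹)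
          (v * torusElt b * v⁻¹) *
        (φ k (A * (v * torusElt b * v⁻¹) * (u * torusElt a * u⁻¹)) : ℂ) ∂haarSU2 := by
      intro v
      rw [← integral_sub]
      · simp_rw [sub_mul]
      · exact ((hcF.mul hcφ).comp (Continuous.prodMk_right v)).integrable_of_compactSpace
      · exact ((hcf.mul hcφ).comp (Continuous.prodMk_right v)).integrable_of_compactSpace
    simp_rw [hsub]
    refine (norm_integral_integral_mul_le (φ k) (hφ.continuous k) (hφ.nonneg k) A
      (fun x y => F x y - F (A * y)⁻¹ y)
      (M := ε / 2 / (C / sinAngle A + 1)) ?_).trans_lt ?_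
    · intro u v huv
      have h1 := (hk huv) (v * torusElt b * v⁻¹)
      simp only [mul_one] at h1
      rw [← mul_assoc, inv_mul_cancel, one_mul] at h1
      exact h1.le
    · have h2 := hkb A hA
      calc _ ≤ ε / 2 / (C / sinAngle A + 1) * (C / sinAngle A) :=
            mul_le_mul_of_nonneg_left h2 hη.le
        _ ≤ ε / 2 / (C / sinAngle A + 1) * (C / sinAngle A + 1) :=
            mul_le_mul_of_nonneg_left (by linarith) hη.le
        _ = ε / 2 := by
            have : 0 < C / sinAngle A + 1 := by positivity
            field_simp
        _ < ε := by linarith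
  have := hdiff.add h0
  simpa using this

/-- The two-point functions integrate to a limit over the remaining holonomies, provided the
product `R` of these has an integrable inverse sine and avoids the boundary of the triangle
inequalities. -/
theorem IsDeltaSequence.tendsto_integral_of_integrable {X : Type*} [TopologicalSpace X]
    [CompactSpace X] [LocallyCompactSpace X] [FirstCountableTopology X] [MeasurableSpace X]
    [OpensMeasurableSpace X] {ν : Measure X} [IsFiniteMeasure ν] (hφ : IsDeltaSequence φ)
    (ha : a ∈ Set.Ioo 0 Real.pi) (hb : b ∈ Set.Ioo 0 Real.pi) {R : X → SU2} (hR : Continuous R)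
    (hpos : ∀ᵐ x ∂ν, 0 < sinAngle (R x))
    (hne : ∀ᵐ x ∂ν, |halfTrace (R x) * Real.cos b - Real.cos a| ≠ sinAngle (R x) * Real.sin b)
    (hint : Integrable (fun x => (sinAngle (R x))⁻¹) ν)
    (F : X → SU2 → SU2 → ℂ) (hF : Continuous fun p : X × SU2 × SU2 => F p.1 p.2.1 p.2.2) :
    Tendsto (fun k => ∫ x, ∫ v : SU2, ∫ u : SU2,
        F x (u * torusElt a * u⁻¹) (v * torusElt b * v⁻¹) *
        (φ k (R x * (v * torusElt b * v⁻¹) * (u * torusElt a * u⁻¹)) : ℂ)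
        ∂haarSU2 ∂haarSU2 ∂ν) atTop
      (𝓝 (∫ x, fiberLimit a b (R x) (fun g => F x (R x * g)⁻¹ g) ∂ν)) := by
  obtain ⟨C, hC, hbound⟩ := hφ.exists_integral_classDelta_le ha hb
  have hFx : ∀ x, Continuous (F x).uncurry := fun x => hF.comp (Continuous.prodMk_right x)
  obtain ⟨M, hM⟩ : ∃ M, ∀ p : X × SU2 × SU2, ‖F p.1 p.2.1 p.2.2‖ ≤ M := by
    obtain ⟨M, hM⟩ := isCompact_univ.exists_bound_of_continuousOn hF.continuousOn
    exact ⟨M, fun p => hM p (Set.mem_univ p)⟩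
  refine tendsto_integral_filter_of_dominated_convergence
    (fun x => |M| * (C * (sinAngle (R x))⁻¹)) ?_ ?_ ((hint.const_mul C).const_mul |M|) ?_
  · refine Eventually.of_forall fun k => Continuous.aestronglyMeasurable ?_
    apply continuous_integral_of_compactSpace
    apply continuous_integral_of_compactSpace
    have e1 : Continuous fun p : (X × SU2) × SU2 => p.2 * torusElt a * p.2⁻¹ :=
      (continuous_conj_torusElt a).comp continuous_snd
    have e2 : Continuous fun p : (X × SU2) × SU2 => p.1.2 * torusElt b * p.1.2⁻¹ :=
      (continuous_conj_torusElt b).comp (continuous_snd.comp continuous_fst)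
    have e3 : Continuous fun p : (X × SU2) × SU2 => p.1.1 := continuous_fst.comp continuous_fst
    exact (hF.comp (e3.prodMk (e1.prodMk e2))).mul (Complex.continuous_ofReal.comp
      ((hφ.continuous k).comp (((hR.comp e3).mul e2).mul e1)))
  · filter_upwards [hbound] with k hk
    filter_upwards [hpos] with x hx
    refine (norm_integral_integral_mul_le (φ k) (hφ.continuous k) (hφ.nonneg k) (R x) (F x)
      (M := |M|) (fun u v _ => (hM (x, _, _)).trans (le_abs_self M))).trans ?_
    exact mul_le_mul_of_nonneg_left ((hk (R x) hx).trans_eq (div_eq_mul_inv _ _)) (abs_nonneg M)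
  · filter_upwards [hpos, hne] with x hx hxne
    exact hφ.tendsto_integral_integral_mul ha hb hx hxne (F x) (hFx x)

end

/-! ### Products of random elements of conjugacy classes -/

theorem measurePreserving_finCons {m : ℕ} {G : Type*} [MeasurableSpace G] (μ : Measure G)
    [SigmaFinite μ] :
    MeasurePreserving (fun p : G × (Fin m → G) => (Fin.cons p.1 p.2 : Fin (m + 1) → G))
      (μ.prod (Measure.pi fun _ => μ)) (Measure.pi fun _ => μ) := by
  have h := (measurePreserving_piFinSuccAbove (α := fun _ : Fin (m + 1) => G)
    (fun _ => μ) 0).symm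
  convert h using 1
  ext p i
  simp [MeasurableEquiv.piFinSuccAbove, Fin.insertNthEquiv]

namespace SU2

theorem halfTrace_mul_conj_torusElt (A : SU2) (b : ℝ) : ∃ w : SU2, ∀ v : SU2,
    halfTrace (A * (v * torusElt b * v⁻¹)) =
      halfTrace A * Real.cos b + sinAngle A * Real.sin b -
        2 * (sinAngle A * Real.sin b) * colWeight (w * v) := by
  obtain ⟨w, hw⟩ := exists_diagonalization A
  refine ⟨w⁻¹, fun v => ?_⟩
  have hy := abs_le.mp (abs_halfTrace_le A)
  have h := halfTrace_torusElt_mul_conj (Real.arccos (halfTrace A)) b (w⁻¹ * v)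
  rw [Real.cos_arccos hy.1 hy.2, Real.sin_arccos, ← sinAngle] at h
  have e : A * (v * torusElt b * v⁻¹) = w * (torusElt (Real.arccos (halfTrace A)) *
      (w⁻¹ * v * torusElt b * (w⁻¹ * v)⁻¹)) * w⁻¹ := by
    conv_lhs => rw [hw]
    group
  rw [e, halfTrace_conj, h]
  ring

theorem measurePreserving_colWeight_mul (w : SU2) :
    MeasurePreserving (fun v : SU2 => colWeight (w * v)) haarSU2
      (volume.restrict (Set.Icc (0 : ℝ) 1)) :=
  MeasurePreserving.comp (g := colWeight) ⟨continuous_colWeight.measurable, map_colWeight_haar⟩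
    (measurePreserving_mul_left haarSU2 w)

/-- The trace of the product with a random conjugate has an atomless distribution. -/
theorem ae_halfTrace_mul_conj_ne {A : SU2} {b : ℝ} (h : 0 < sinAngle A * Real.sin b) (y : ℝ) :
    ∀ᵐ v ∂haarSU2, halfTrace (A * (v * torusElt b * v⁻¹)) ≠ y := by
  obtain ⟨w, hw⟩ := halfTrace_mul_conj_torusElt A b
  have h1 : ∀ᵐ s ∂(volume.restrict (Set.Icc (0 : ℝ) 1)),
      s ≠ (halfTrace A * Real.cos b + sinAngle A * Real.sin b - y) /
        (2 * (sinAngle A * Real.sin b)) :=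
    (Measure.ae_ne _ _)
  have h2 := (measurePreserving_colWeight_mul w).quasiMeasurePreserving.ae h1
  filter_upwards [h2] with v hv hy
  apply hv
  rw [hw] at hy
  rw [eq_div_iff (by positivity)]
  linarith

/-- The primitive of `1 / √(1 - x²)` is the arcsine, which is bounded; hence the bound does not
depend on how close the trace comes to `±1`. -/
theorem integrable_inv_sinAngle_mul_conj {A : SU2} {b : ℝ} (h : 0 < sinAngle A * Real.sin b) :
    Integrable (fun v : SU2 => (sinAngle (A * (v * torusElt b * v⁻¹)))⁻¹) haarSU2 ∧
      ∫ v : SU2, (sinAngle (A * (v * torusElt b * v⁻¹)))⁻¹ ∂haarSU2 ≤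
        Real.pi / (2 * (sinAngle A * Real.sin b)) := by
  obtain ⟨w, hw⟩ := halfTrace_mul_conj_torusElt A b
  have hmem := halfTrace_mul_cos_add_mem A b
  set d := halfTrace A * Real.cos b + sinAngle A * Real.sin b with hd
  set c := 2 * (sinAngle A * Real.sin b) with hc
  have hcpos : 0 < c := by positivity
  have hmp := measurePreserving_colWeight_mul w
  set f : ℝ → ℝ := fun s => (Real.sqrt (1 - (d - c * s) ^ 2))⁻¹ with hf
  have hfm : AEStronglyMeasurable f (volume.restrict (Set.Icc (0 : ℝ) 1)) := by
    have : Measurable f := by fun_prop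
    exact this.aestronglyMeasurable
  have hval : ∀ v : SU2, (sinAngle (A * (v * torusElt b * v⁻¹)))⁻¹ = f (colWeight (w * v)) := by
    intro v
    rw [sinAngle, hw]
  have hcont : ContinuousOn (fun s => -Real.arcsin (d - c * s) / c) (Set.Icc 0 1) := by
    apply Continuous.continuousOn
    have := Real.continuous_arcsin
    fun_prop
  have hderiv : ∀ s ∈ Set.Ioo (0 : ℝ) 1,
      HasDerivAt (fun s => -Real.arcsin (d - c * s) / c) (f s) s := by
    intro s hs
    have h1 : d - c * s ≠ -1 := by nlinarith [hs.1, hs.2]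
    have h2 : d - c * s ≠ 1 := by nlinarith [hs.1, hs.2]
    have h3 : HasDerivAt (fun s => d - c * s) (-c) s := by
      simpa using ((hasDerivAt_id s).const_mul c).const_sub d
    have h4 := (((Real.hasDerivAt_arcsin h1 h2).comp s h3).neg).div_const c
    refine h4.congr_deriv ?_
    rw [hf]
    field_simp
  have hpos : ∀ s ∈ Set.Ioo (0 : ℝ) 1, 0 ≤ f s := fun s _ =>
    inv_nonneg.mpr (Real.sqrt_nonneg _)
  have hint := intervalIntegral.integrableOn_deriv_of_nonneg hcont hderiv hpos
  have hint' : Integrable f (volume.restrict (Set.Icc (0 : ℝ) 1)) := by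
    rw [← restrict_Ioc_eq_restrict_Icc]; exact hint
  rw [show (fun v : SU2 => (sinAngle (A * (v * torusElt b * v⁻¹)))⁻¹) =
    f ∘ fun v : SU2 => colWeight (w * v) from funext hval]
  constructor
  · exact (hmp.integrable_comp hfm).mpr hint'
  · have h1 : ∫ v, (f ∘ fun v : SU2 => colWeight (w * v)) v ∂haarSU2 = ∫ s in Set.Icc (0 : ℝ) 1, f s := by
      rw [← hmp.map_eq] at hfm ⊢
      exact (integral_map hmp.measurable.aemeasurable hfm).symm
    rw [h1, integral_Icc_eq_integral_Ioc, ← intervalIntegral.integral_of_le zero_le_one,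
      intervalIntegral.integral_eq_sub_of_hasDerivAt_of_le zero_le_one hcont hderiv
        ((intervalIntegrable_iff_integrableOn_Ioc_of_le zero_le_one).mpr hint), ← sub_div]
    apply div_le_div_of_nonneg_right _ hcpos.le
    have := Real.arcsin_le_pi_div_two (d - c * 0)
    have := Real.neg_pi_div_two_le_arcsin (d - c * 1)
    linarith

theorem sinAngle_pos_of_halfTrace_ne {A : SU2} (h1 : halfTrace A ≠ 1) (h2 : halfTrace A ≠ -1) :
    0 < sinAngle A := by
  have := abs_le.mp (abs_halfTrace_le A)
  have h3 := lt_of_le_of_ne this.2 h1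
  have h4 := lt_of_le_of_ne this.1 h2.symm
  exact Real.sqrt_pos.mpr (by nlinarith)

theorem sinAngle_conj_torusElt {θ : ℝ} (hθ : θ ∈ Set.Ioo 0 Real.pi) (v : SU2) :
    sinAngle (v * torusElt θ * v⁻¹) = Real.sin θ := by
  rw [sinAngle, halfTrace_conj, halfTrace_torusElt, sqrt_one_sub_cos_sq hθ]

/-- The ordered product of conjugates of the torus elements `h_{θ_p}` by the `u_p`. -/
def holonomyProduct {m : ℕ} (θ : Fin m → ℝ) (u : Fin m → SU2) : SU2 :=
  (List.ofFn fun p => u p * torusElt (θ p) * (u p)⁻¹).prod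

theorem holonomyProduct_cons {m : ℕ} (θ : Fin (m + 1) → ℝ) (v : SU2) (u : Fin m → SU2) :
    holonomyProduct θ (Fin.cons v u : Fin (m + 1) → SU2) =
      v * torusElt (θ 0) * v⁻¹ * holonomyProduct (fun p => θ p.succ) u := by
  simp [holonomyProduct, List.ofFn_succ]

theorem continuous_holonomyProduct {m : ℕ} (θ : Fin m → ℝ) :
    Continuous (holonomyProduct θ) := by
  induction m with
  | zero => simpa [holonomyProduct] using! continuous_const
  | succ m ih =>
    have : holonomyProduct θ = fun u : Fin (m + 1) → SU2 =>
        u 0 * torusElt (θ 0) * (u 0)⁻¹ * holonomyProduct (fun p => θ p.succ) (fun p => u p.succ) := by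
      ext1 u
      exact (congrArg _ (Fin.cons_self_tail u)).symm.trans (holonomyProduct_cons θ (u 0) _)
    rw [this]
    exact ((continuous_conj_torusElt _).comp (continuous_apply 0)).mul
      ((ih _).comp (continuous_pi fun p => continuous_apply _))

/-- The product of at least one random conjugate is almost surely noncentral, and the inverse of
the sine of its angle is integrable. -/
theorem holonomyProduct_sinAngle {m : ℕ} (θ : Fin (m + 1) → ℝ)
    (hθ : ∀ p, θ p ∈ Set.Ioo 0 Real.pi) :
    (∀ᵐ u ∂(Measure.pi fun _ : Fin (m + 1) => haarSU2), 0 < sinAngle (holonomyProduct θ u)) ∧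
    Integrable (fun u => (sinAngle (holonomyProduct θ u))⁻¹)
      (Measure.pi fun _ : Fin (m + 1) => haarSU2) := by
  induction m with
  | zero =>
    have h : ∀ u, sinAngle (holonomyProduct θ u) = Real.sin (θ 0) := by
      intro u
      rw [← sinAngle_conj_torusElt (hθ 0) (u 0)]
      simp [holonomyProduct]
    simp_rw [h]
    exact ⟨Eventually.of_forall fun _ => Real.sin_pos_of_pos_of_lt_pi (hθ 0).1 (hθ 0).2,
      integrable_const _⟩
  | succ m ih =>
    obtain ⟨ih1, ih2⟩ := ih (fun p => θ p.succ) fun p => hθ _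
    have hsb := Real.sin_pos_of_pos_of_lt_pi (hθ 0).1 (hθ 0).2
    have hmp := measurePreserving_finCons (m := m + 1) haarSU2
    have hσ : ∀ (v : SU2) (u : Fin (m + 1) → SU2),
        sinAngle (holonomyProduct θ (Fin.cons v u : Fin (m + 2) → SU2)) =
        sinAngle (holonomyProduct (fun p => θ p.succ) u * (v * torusElt (θ 0) * v⁻¹)) := by
      intro v u
      rw [holonomyProduct_cons, sinAngle, halfTrace_mul_comm, ← sinAngle]
    constructor
    · have hmeas : MeasurableSet {u | 0 < sinAngle (holonomyProduct θ u)} :=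
        (isOpen_lt continuous_const
          (continuous_sinAngle.comp (continuous_holonomyProduct θ))).measurableSet
      rw [← hmp.map_eq, ae_map_iff hmp.measurable.aemeasurable hmeas]
      refine (Measure.ae_prod_iff_ae_ae (p := fun z : SU2 × (Fin (m + 1) → SU2) =>
        0 < sinAngle (holonomyProduct θ (Fin.cons z.1 z.2 : Fin (m + 2) → SU2)))
        (hmp.measurable hmeas)).mpr ?_
      refine (Measure.ae_ae_comm (p := fun (v : SU2) (u : Fin (m + 1) → SU2) =>
        0 < sinAngle (holonomyProduct θ (Fin.cons v u : Fin (m + 2) → SU2)))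
        (hmp.measurable hmeas)).mpr ?_
      filter_upwards [ih1] with u hu
      filter_upwards [ae_halfTrace_mul_conj_ne (mul_pos hu hsb) 1,
        ae_halfTrace_mul_conj_ne (mul_pos hu hsb) (-1)] with v hv hv'
      rw [hσ]
      exact sinAngle_pos_of_halfTrace_ne hv hv'
    · have hmeas : Measurable fun u => (sinAngle (holonomyProduct θ u))⁻¹ :=
        (continuous_sinAngle.comp (continuous_holonomyProduct θ)).measurable.inv
      rw [← hmp.map_eq, integrable_map_measure hmeas.aestronglyMeasurable
        hmp.measurable.aemeasurable]
      have hmeas2 := (hmeas.comp hmp.measurable).aestronglyMeasurable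
        (μ := haarSU2.prod (Measure.pi fun _ : Fin (m + 1) => haarSU2))
      rw [integrable_prod_iff' hmeas2]
      simp only [Function.comp_apply, hσ]
      constructor
      · filter_upwards [ih1] with u hu
        exact (integrable_inv_sinAngle_mul_conj (mul_pos hu hsb)).1
      · refine Integrable.mono' (ih2.const_mul (Real.pi / (2 * Real.sin (θ 0)))) ?_ ?_
        · have h := hmeas2.norm.prod_swap.integral_prod_right'
          simpa only [Function.comp_apply, Prod.swap, hσ] using h
        · filter_upwards [ih1] with u hu
          rw [Real.norm_of_nonneg (integral_nonneg fun _ => norm_nonneg _)]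
          simp_rw [Real.norm_of_nonneg (inv_nonneg.mpr (sinAngle_nonneg _))]
          refine (integrable_inv_sinAngle_mul_conj (mul_pos hu hsb)).2.trans_eq ?_
          field_simp

/-- The trace of the product of at least two random conjugates has an atomless distribution. -/
theorem ae_halfTrace_holonomyProduct_ne {m : ℕ} (θ : Fin (m + 2) → ℝ)
    (hθ : ∀ p, θ p ∈ Set.Ioo 0 Real.pi) (y : ℝ) :
    ∀ᵐ u ∂(Measure.pi fun _ : Fin (m + 2) => haarSU2), halfTrace (holonomyProduct θ u) ≠ y := by
  have hb := hθ 0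
  have hsb := Real.sin_pos_of_pos_of_lt_pi hb.1 hb.2
  have hmp := measurePreserving_finCons (m := m + 1) haarSU2
  have hmeas : MeasurableSet {u | halfTrace (holonomyProduct θ u) ≠ y} :=
    (isOpen_ne_fun (continuous_halfTrace.comp (continuous_holonomyProduct θ))
      continuous_const).measurableSet
  rw [← hmp.map_eq, ae_map_iff hmp.measurable.aemeasurable hmeas]
  refine (Measure.ae_prod_iff_ae_ae (p := fun z : SU2 × (Fin (m + 1) → SU2) =>
    halfTrace (holonomyProduct θ (Fin.cons z.1 z.2 : Fin (m + 2) → SU2)) ≠ y)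
    (hmp.measurable hmeas)).mpr ?_
  refine (Measure.ae_ae_comm (p := fun (v : SU2) (u : Fin (m + 1) → SU2) =>
    halfTrace (holonomyProduct θ (Fin.cons v u : Fin (m + 2) → SU2)) ≠ y)
    (hmp.measurable hmeas)).mpr ?_
  filter_upwards [(holonomyProduct_sinAngle (fun p => θ p.succ) fun p => hθ _).1] with u hu
  filter_upwards [ae_halfTrace_mul_conj_ne (mul_pos hu hsb) y] with v hv
  rwa [holonomyProduct_cons, halfTrace_mul_comm]

end SU2

/-! ### Integrals over the flat configurations -/

section

open SU2

/-- The integral of a function of the particle holonomies against a function of their ordered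
product. -/
def reducedIntegral {n : ℕ} (θ : Fin n → ℝ) (F : (Fin n → SU2) → ℂ) (ψ : SU2 → ℝ) : ℂ :=
  ∫ u : Fin n → SU2, F (fun p => u p * torusElt (θ p) * (u p)⁻¹) * (ψ (holonomyProduct θ u) : ℂ)
    ∂Measure.pi fun _ => haarSU2

/-- The limit of `reducedIntegral` for delta functions: the holonomy of particle `1` is determined
by the others, that of particle `0` runs over a circle. -/
def reducedLimit {m : ℕ} (θ : Fin (m + 3) → ℝ) (F : (Fin (m + 3) → SU2) → ℂ) : ℂ :=
  ∫ x : Fin (m + 1) → SU2, fiberLimit (θ 1) (θ 0)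
    (holonomyProduct (fun p => θ p.succ.succ) x)
    (fun g => F (Fin.cons g (Fin.cons (holonomyProduct (fun p => θ p.succ.succ) x * g)⁻¹
      fun p => x p * torusElt (θ p.succ.succ) * (x p)⁻¹)))
    ∂Measure.pi fun _ => haarSU2

theorem continuous_finCons {m : ℕ} {X G : Type*} [TopologicalSpace X] [TopologicalSpace G]
    {f : X → G} {g : X → Fin m → G} (hf : Continuous f) (hg : Continuous g) :
    Continuous fun x => (Fin.cons (f x) (g x) : Fin (m + 1) → G) := by
  refine continuous_pi fun i => ?_
  refine Fin.cases ?_ (fun j => ?_) i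
  · simpa using hf
  · simp only [Fin.cons_succ]
    exact (continuous_apply j).comp hg

theorem integral_pi_finCons {m : ℕ} (f : (Fin (m + 1) → SU2) → ℂ) (hf : Continuous f) :
    ∫ u, f u ∂(Measure.pi fun _ => haarSU2) =
      ∫ v, ∫ w, f (Fin.cons v w : Fin (m + 1) → SU2) ∂(Measure.pi fun _ => haarSU2) ∂haarSU2 := by
  have hmp := measurePreserving_finCons (m := m) haarSU2
  have hc : Continuous fun p : SU2 × (Fin m → SU2) => f (Fin.cons p.1 p.2 : Fin (m + 1) → SU2) :=
    hf.comp (continuous_finCons continuous_fst continuous_snd)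
  rw [← hmp.map_eq, integral_map hmp.measurable.aemeasurable hf.aestronglyMeasurable,
    integral_prod _ hc.integrable_of_compactSpace]

theorem integral_pi_finCons_symm {m : ℕ} (f : (Fin (m + 1) → SU2) → ℂ) (hf : Continuous f) :
    ∫ u, f u ∂(Measure.pi fun _ => haarSU2) =
      ∫ w, ∫ v, f (Fin.cons v w : Fin (m + 1) → SU2) ∂haarSU2 ∂(Measure.pi fun _ => haarSU2) := by
  have hc : Continuous fun p : SU2 × (Fin m → SU2) => f (Fin.cons p.1 p.2 : Fin (m + 1) → SU2) :=
    hf.comp (continuous_finCons continuous_fst continuous_snd)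
  rw [integral_pi_finCons f hf]
  exact integral_integral_swap (f := fun v w => f (Fin.cons v w : Fin (m + 1) → SU2))
    hc.integrable_of_compactSpace

/-- The product of the holonomies is conjugate to `R * g₀ * g₁`, where `R` is the product of those
of the particles other than `0` and `1`. -/
theorem IsDeltaSequence.tendsto_reducedIntegral {m : ℕ} {φ : ℕ → SU2 → ℝ} (hφ : IsDeltaSequence φ)
    {θ : Fin (m + 3) → ℝ} (hθ : ∀ p, θ p ∈ Set.Ioo 0 Real.pi)
    (hne : ∀ᵐ x ∂(Measure.pi fun _ : Fin (m + 1) => haarSU2),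
      |halfTrace (holonomyProduct (fun p => θ p.succ.succ) x) * Real.cos (θ 0) - Real.cos (θ 1)| ≠
        sinAngle (holonomyProduct (fun p => θ p.succ.succ) x) * Real.sin (θ 0))
    (F : (Fin (m + 3) → SU2) → ℂ) (hF : Continuous F) :
    Tendsto (fun k => reducedIntegral θ F (φ k)) atTop (𝓝 (reducedLimit θ F)) := by
  obtain ⟨h1, h2⟩ := holonomyProduct_sinAngle (fun p => θ p.succ.succ) fun p => hθ _
  have hcR := continuous_holonomyProduct (m := m + 1) (fun p => θ p.succ.succ)
  have hcx : Continuous fun x : Fin (m + 1) → SU2 =>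
      fun p => x p * torusElt (θ p.succ.succ) * (x p)⁻¹ :=
    continuous_pi fun p => (continuous_conj_torusElt _).comp (continuous_apply p)
  have hcF : Continuous fun p : (Fin (m + 1) → SU2) × SU2 × SU2 =>
      F (Fin.cons p.2.2 (Fin.cons p.2.1 fun q => p.1 q * torusElt (θ q.succ.succ) * (p.1 q)⁻¹)) :=
    hF.comp (continuous_finCons (continuous_snd.comp continuous_snd)
      (continuous_finCons (continuous_fst.comp continuous_snd) (hcx.comp continuous_fst)))
  have hmain := hφ.tendsto_integral_of_integrable (hθ 1) (hθ 0) hcR h1 hne h2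
    (fun x ga gb => F (Fin.cons gb (Fin.cons ga fun q => x q * torusElt (θ q.succ.succ) * (x q)⁻¹)))
    hcF
  refine hmain.congr fun k => ?_
  set f : (Fin (m + 3) → SU2) → ℂ := fun u =>
    F (fun p => u p * torusElt (θ p) * (u p)⁻¹) * (φ k (holonomyProduct θ u) : ℂ) with hf
  have hfc : Continuous f := by
    refine (hF.comp (continuous_pi fun p => ?_)).mul (Complex.continuous_ofReal.comp
      ((hφ.continuous k).comp (continuous_holonomyProduct θ)))
    exact (continuous_conj_torusElt _).comp (continuous_apply p)
  have hval : ∀ (v u : SU2) (x : Fin (m + 1) → SU2),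
      F (Fin.cons (v * torusElt (θ 0) * v⁻¹) (Fin.cons (u * torusElt (θ 1) * u⁻¹)
        fun q => x q * torusElt (θ q.succ.succ) * (x q)⁻¹)) *
      (φ k (holonomyProduct (fun p => θ p.succ.succ) x * (v * torusElt (θ 0) * v⁻¹) *
        (u * torusElt (θ 1) * u⁻¹)) : ℂ) =
      f (Fin.cons v (Fin.cons u x : Fin (m + 2) → SU2)) := by
    intro v u x
    simp only [hf]
    congr 1
    · congr 1
      ext1 p
      refine Fin.cases rfl (fun p => ?_) p
      refine Fin.cases rfl (fun p => rfl) p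
    · congr 1
      rw [holonomyProduct_cons, holonomyProduct_cons,
        ← hφ.conj_invariant k (holonomyProduct (fun p => θ p.succ.succ) x)⁻¹]
      congr 1
      simp only [Fin.succ_zero_eq_one]
      group
  simp_rw [hval]
  have hc3 : Continuous fun p : ((Fin (m + 1) → SU2) × SU2) × SU2 =>
      f (Fin.cons p.1.2 (Fin.cons p.2 p.1.1 : Fin (m + 2) → SU2)) :=
    hfc.comp (continuous_finCons (continuous_snd.comp continuous_fst)
      (continuous_finCons continuous_snd (continuous_fst.comp continuous_fst)))
  rw [integral_integral_swap]
  swap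
  · exact (continuous_integral_of_compactSpace hc3).integrable_of_compactSpace
  symm
  refine (integral_pi_finCons f hfc).trans ?_
  congr 1
  ext v
  exact integral_pi_finCons_symm (fun w : Fin (m + 2) → SU2 => f (Fin.cons v w : Fin (m + 3) → SU2))
    (hfc.comp (continuous_finCons continuous_const continuous_id))

/-- The traces at the boundary of the triangle inequalities for angles `a` and `b`. -/
theorem SU2.halfTrace_eq_of_abs_eq {A : SU2} {a b : ℝ}
    (h : |halfTrace A * Real.cos b - Real.cos a| = sinAngle A * Real.sin b) :
    halfTrace A = Real.cos (a + b) ∨ halfTrace A = Real.cos (a - b) := by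
  have h1 : (halfTrace A * Real.cos b - Real.cos a) ^ 2 = (sinAngle A * Real.sin b) ^ 2 := by
    rw [← h, sq_abs]
  rw [mul_pow, sinAngle_sq] at h1
  have h2 : (halfTrace A - Real.cos (a + b)) * (halfTrace A - Real.cos (a - b)) = 0 := by
    rw [Real.cos_add, Real.cos_sub]
    have ha := Real.sin_sq_add_cos_sq a
    have hb := Real.sin_sq_add_cos_sq b
    linear_combination h1 + (Real.cos a ^ 2 - halfTrace A ^ 2) * hb - Real.sin b ^ 2 * ha
  rcases mul_eq_zero.mp h2 with h3 | h3
  · exact Or.inl (sub_eq_zero.mp h3)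
  · exact Or.inr (sub_eq_zero.mp h3)

/-- Conjugacy classes of `SU(2)` are level sets of the trace. -/
theorem SU2.isConj_torusElt_iff {θ : ℝ} (hθ : θ ∈ Set.Ioo 0 Real.pi) (g : SU2) :
    IsConj (torusElt θ) g ↔ halfTrace g = Real.cos θ := by
  constructor
  · intro h
    obtain ⟨c, rfl⟩ := isConj_iff.mp h
    rw [halfTrace_conj, halfTrace_torusElt]
  · intro h
    obtain ⟨v, hv⟩ := exists_diagonalization g
    rw [h, Real.arccos_cos hθ.1.le hθ.2.le] at hv
    exact isConj_iff.mpr ⟨v, hv.symm⟩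

/-- If there are no flat configurations, the product of the holonomies keeps away from `1`, by
compactness. -/
theorem IsDeltaSequence.tendsto_reducedIntegral_of_not_flat {n : ℕ} {θ : Fin n → ℝ}
    (h : ∀ g, ¬ IsFlatConfiguration θ g) {φ : ℕ → SU2 → ℝ} (hφ : IsDeltaSequence φ)
    (F : (Fin n → SU2) → ℂ) :
    Tendsto (fun k => reducedIntegral θ F (φ k)) atTop (𝓝 0) := by
  have hU : (Set.range (holonomyProduct θ))ᶜ ∈ 𝓝 (1 : SU2) := by
    apply (isCompact_range (continuous_holonomyProduct θ)).isClosed.isOpen_compl.mem_nhds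
    rintro ⟨u, hu⟩
    exact h (fun p => u p * torusElt (θ p) * (u p)⁻¹)
      ⟨fun p => isConj_iff.mpr ⟨u p, rfl⟩, hu⟩
  apply tendsto_const_nhds.congr'
  filter_upwards [hφ.support_shrinks _ hU] with k hk
  symm
  refine integral_eq_zero_of_ae (Eventually.of_forall fun u => ?_)
  have h0 : φ k (holonomyProduct θ u) = 0 := by
    by_contra hne
    exact hk hne ⟨u, rfl⟩
  simp [h0]

theorem not_isIrreducibleConfiguration_of_lt_three {n : ℕ} (hn : n < 3) {θ : Fin n → ℝ}
    {g : Fin n → SU2} (hg : IsFlatConfiguration θ g) : ¬ IsIrreducibleConfiguration g := by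
  rintro ⟨p, q, hpq⟩
  have h1 := hg.2
  interval_cases n
  · exact p.elim0
  · exact hpq (by rw [Subsingleton.elim p q])
  · simp only [List.ofFn_succ, List.prod_cons, Fin.succ_zero_eq_one, List.ofFn_zero,
      List.prod_nil, mul_one] at h1
    have h2 : g 1 = (g 0)⁻¹ := (inv_eq_of_mul_eq_one_right h1).symm
    apply hpq
    fin_cases p <;> fin_cases q <;> simp [h2]

/-- In the presence of three particles all of whose flat configurations are irreducible, the
angles do not lie on the boundary of the triangle inequalities. -/
theorem cos_ne_of_forall_irreducible {θ : Fin 3 → ℝ} (hθ : ∀ p, θ p ∈ Set.Ioo 0 Real.pi)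
    (hirr : ∀ g, IsFlatConfiguration θ g → IsIrreducibleConfiguration g) (b : ℝ)
    (hb : Real.cos b = Real.cos (θ 0)) : Real.cos (θ 2) ≠ Real.cos (θ 1 + b) := by
  intro h
  -- equality in a triangle inequality is realized by commuting holonomies
  let t : Fin 3 → ℝ := ![b, θ 1, -(θ 1 + b)]
  obtain ⟨p, q, hpq⟩ := hirr (fun p => torusElt (t p)) ⟨fun p => by
    rw [isConj_torusElt_iff (hθ p), halfTrace_torusElt]
    fin_cases p
    · exact hb
    · rfl
    · change Real.cos (-(θ 1 + b)) = Real.cos (θ 2)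
      rw [Real.cos_neg, h], by
    simp only [List.ofFn_succ, List.prod_cons, List.ofFn_zero, List.prod_nil, mul_one,
      ← torusElt_add]
    rw [← torusElt_zero]
    congr 1
    simp [t]⟩
  exact hpq (torusElt_mul_comm _ _)

/-- The measure of the flat configurations exists: integrals against delta functions of the
ordered product of the particle holonomies converge, to a limit that does not depend on the delta
functions. -/
theorem exists_tendsto_reducedIntegral {n : ℕ} {θ : Fin n → ℝ}
    (hθ : ∀ p, θ p ∈ Set.Ioo 0 Real.pi)
    (hreg : 4 ≤ n ∨ ∀ g, IsFlatConfiguration θ g → IsIrreducibleConfiguration g)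
    (F : (Fin n → SU2) → ℂ) (hF : Continuous F) :
    ∃ A : ℂ, ∀ φ : ℕ → SU2 → ℝ, IsDeltaSequence φ →
      Tendsto (fun k => reducedIntegral θ F (φ k)) atTop (𝓝 A) := by
  rcases lt_or_ge n 3 with hn | hn
  · have hirr := hreg.resolve_left (by omega)
    exact ⟨0, fun φ hφ => hφ.tendsto_reducedIntegral_of_not_flat
      (fun g hg => not_isIrreducibleConfiguration_of_lt_three hn hg (hirr g hg)) F⟩
  obtain ⟨m, rfl⟩ : ∃ m, n = m + 3 := ⟨n - 3, by omega⟩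
  refine ⟨reducedLimit θ F, fun φ hφ => hφ.tendsto_reducedIntegral hθ ?_ F hF⟩
  -- the triangle inequalities are strict: for three particles by irreducibility, for more of them
  -- because the trace of the product of the others has no atoms
  rcases Nat.eq_zero_or_pos m with rfl | hm
  · have hirr := hreg.resolve_left (by omega)
    refine Eventually.of_forall fun x h => ?_
    have h2 : halfTrace (holonomyProduct (fun p : Fin 1 => θ p.succ.succ) x) = Real.cos (θ 2) := by
      have h3 : holonomyProduct (fun p : Fin 1 => θ p.succ.succ) x =
          x 0 * torusElt (θ 2) * (x 0)⁻¹ := by simp [holonomyProduct]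
      rw [h3, halfTrace_conj, halfTrace_torusElt]
    rcases halfTrace_eq_of_abs_eq h with h1 | h1
    · exact cos_ne_of_forall_irreducible hθ hirr (θ 0) rfl (h2.symm.trans h1)
    · exact cos_ne_of_forall_irreducible hθ hirr (-θ 0) (Real.cos_neg _) (h2.symm.trans h1)
  · obtain ⟨m, rfl⟩ : ∃ m', m = m' + 1 := ⟨m - 1, by omega⟩
    filter_upwards [ae_halfTrace_holonomyProduct_ne (fun p => θ p.succ.succ) (fun p => hθ _)
      (Real.cos (θ 1 + θ 0)), ae_halfTrace_holonomyProduct_ne (fun p => θ p.succ.succ)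
      (fun p => hθ _) (Real.cos (θ 1 - θ 0))] with x h1 h2 h
    exact (halfTrace_eq_of_abs_eq h).elim h1 h2

end

/-! ### Translations of variables, and potentials along forests -/

section

section PiIntegrals

variable {ι : Type*} [Fintype ι]

/-- Change of variables in an integral over a power of `SU(2)`: the coordinates in `S` may be
translated on both sides by elements which depend on the other coordinates. -/
theorem integral_pi_eq_of_translate (S : ι → Prop) [DecidablePred S]
    {h₁ h₂ : (ι → SU2) → ℂ} (hc₁ : Continuous h₁) (hc₂ : Continuous h₂)
    (l r : (ι → SU2) → ι → SU2)
    (hlr : ∀ g g', (∀ i, ¬ S i → g i = g' i) → l g = l g' ∧ r g = r g')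
    (h : ∀ g, h₁ (fun i => if S i then l g i * g i * r g i else g i) = h₂ g) :
    ∫ g, h₁ g ∂(Measure.pi fun _ => haarSU2) = ∫ g, h₂ g ∂(Measure.pi fun _ => haarSU2) := by
  have hmp := (measurePreserving_piEquivPiSubtypeProd (fun _ : ι => haarSU2) S).symm
  set e := (MeasurableEquiv.piEquivPiSubtypeProd (fun _ : ι => SU2) S).symm with he
  have heq : ∀ x y i, e (x, y) i = if hi : S i then x ⟨i, hi⟩ else y ⟨i, hi⟩ := fun x y i => rfl
  have hec : Continuous e := by
    refine continuous_pi fun i => ?_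
    by_cases hi : S i
    · have : (fun p => e p i) = fun p => p.1 ⟨i, hi⟩ := by
        ext1 ⟨x, y⟩; rw [heq, dif_pos hi]
      rw [this]
      exact (continuous_apply _).comp continuous_fst
    · have : (fun p => e p i) = fun p => p.2 ⟨i, hi⟩ := by
        ext1 ⟨x, y⟩; rw [heq, dif_neg hi]
      rw [this]
      exact (continuous_apply _).comp continuous_snd
  have hfub : ∀ f : (ι → SU2) → ℂ, Continuous f → ∫ g, f g ∂(Measure.pi fun _ => haarSU2) =
      ∫ y, ∫ x, f (e (x, y)) ∂(Measure.pi fun _ => haarSU2) ∂(Measure.pi fun _ => haarSU2) := by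
    intro f hf
    rw [← hmp.map_eq, integral_map hmp.measurable.aemeasurable hf.aestronglyMeasurable]
    exact integral_prod_symm _ (hf.comp hec).integrable_of_compactSpace
  rw [hfub h₁ hc₁, hfub h₂ hc₂]
  congr 1
  ext y
  set g₀ := e (fun _ => 1, y) with hg₀
  have hoff : ∀ x, l (e (x, y)) = l g₀ ∧ r (e (x, y)) = r g₀ := by
    intro x
    apply hlr
    intro i hi
    rw [hg₀, heq, heq, dif_neg hi, dif_neg hi]
  have hpres : MeasurePreserving
      (fun (x : {i // S i} → SU2) (i : {i // S i}) => l g₀ i * x i * r g₀ i)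
      (Measure.pi fun _ => haarSU2) (Measure.pi fun _ => haarSU2) :=
    measurePreserving_pi (fun _ : {i // S i} => haarSU2) (fun _ => haarSU2)
      (f := fun (i : {i // S i}) x => l g₀ i * x * r g₀ i) fun i =>
      (measurePreserving_mul_right haarSU2 (r g₀ i)).comp (measurePreserving_mul_left haarSU2 (l g₀ i))
  have hcx : Continuous fun x => h₁ (e (x, y)) := hc₁.comp (hec.comp (Continuous.prodMk_left y))
  conv_lhs => rw [← hpres.map_eq]
  rw [integral_map hpres.measurable.aemeasurable hcx.aestronglyMeasurable]
  congr 1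
  ext x
  rw [← h]
  congr 1
  ext1 i
  by_cases hi : S i
  · rw [if_pos hi, heq, heq, dif_pos hi, dif_pos hi, (hoff x).1, (hoff x).2]
  · rw [if_neg hi, heq, heq, dif_neg hi, dif_neg hi]

theorem measurePreserving_restrict (S : ι → Prop) [DecidablePred S] :
    MeasurePreserving (fun (g : ι → SU2) (i : {i // S i}) => g i)
      (Measure.pi fun _ => haarSU2) (Measure.pi fun _ => haarSU2) :=
  measurePreserving_fst.comp (measurePreserving_piEquivPiSubtypeProd (fun _ : ι => haarSU2) S)

end PiIntegrals

section Potentials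

variable {V E G : Type*} [Group G] (src tgt : E → V)

/-- The partition of the vertices into the connected components of a set of edges. -/
def edgeSetoid (T : Finset E) : Setoid V :=
  Relation.EqvGen.setoid fun a b => ∃ e ∈ T, src e = a ∧ tgt e = b

/-- A path using the additional edge `e` consists of a path to one end of `e` and a path from the
other end. -/
theorem edgeSetoid_insert [DecidableEq E] {T : Finset E} {e : E} {a b : V}
    (h : edgeSetoid src tgt (insert e T) a b) :
    edgeSetoid src tgt T a b ∨
      (edgeSetoid src tgt T a (src e) ∧ edgeSetoid src tgt T (tgt e) b) ∨
      (edgeSetoid src tgt T a (tgt e) ∧ edgeSetoid src tgt T (src e) b) := by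
  have hs : ∀ {x y}, edgeSetoid src tgt T x y → edgeSetoid src tgt T y x := fun h =>
    (edgeSetoid src tgt T).symm' h
  have ht : ∀ {x y z}, edgeSetoid src tgt T x y → edgeSetoid src tgt T y z →
    edgeSetoid src tgt T x z := fun h h' => (edgeSetoid src tgt T).trans' h h'
  have hr : ∀ x, edgeSetoid src tgt T x x := (edgeSetoid src tgt T).refl'
  induction h with
  | rel x y h =>
    obtain ⟨e', he', rfl, rfl⟩ := h
    rcases Finset.mem_insert.mp he' with rfl | h
    · exact Or.inr (Or.inl ⟨hr _, hr _⟩)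
    · exact Or.inl (Relation.EqvGen.rel _ _ ⟨e', h, rfl, rfl⟩)
  | refl x => exact Or.inl (hr x)
  | symm x y _ ih =>
    rcases ih with h | ⟨h1, h2⟩ | ⟨h1, h2⟩
    · exact Or.inl (hs h)
    · exact Or.inr (Or.inr ⟨hs h2, hs h1⟩)
    · exact Or.inr (Or.inl ⟨hs h2, hs h1⟩)
  | trans x y z _ _ ih1 ih2 =>
    rcases ih1 with h | ⟨h1, h2⟩ | ⟨h1, h2⟩ <;> rcases ih2 with h' | ⟨h3, h4⟩ | ⟨h3, h4⟩
    · exact Or.inl (ht h h')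
    · exact Or.inr (Or.inl ⟨ht h h3, h4⟩)
    · exact Or.inr (Or.inr ⟨ht h h3, h4⟩)
    · exact Or.inr (Or.inl ⟨h1, ht h2 h'⟩)
    · exact Or.inl (ht h1 (ht (hs (ht h2 h3)) h4))
    · exact Or.inl (ht h1 h4)
    · exact Or.inr (Or.inr ⟨h1, ht h2 h'⟩)
    · exact Or.inl (ht h1 h4)
    · exact Or.inl (ht h1 (ht (hs (ht h2 h3)) h4))

/-- A set of edges has at least as many components as there are vertices in excess of edges; in
the case of equality it is a forest, along which every `G`-valued function is a coboundary. -/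
theorem card_le_and_exists_potential [Fintype V] [DecidableEq E] (T : Finset E) :
    Fintype.card V ≤ Nat.card (Quotient (edgeSetoid src tgt T)) + T.card ∧
    (Fintype.card V = Nat.card (Quotient (edgeSetoid src tgt T)) + T.card →
      ∀ g : E → G, ∃ k : V → G, ∀ e ∈ T, k (tgt e) = g e * k (src e)) := by
  classical
  induction T using Finset.induction_on with
  | empty =>
    constructor
    · rw [Finset.card_empty, add_zero, ← Nat.card_eq_fintype_card]
      refine Nat.card_le_card_of_injective (Quotient.mk (edgeSetoid src tgt ∅)) ?_
      intro a b hab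
      have h : edgeSetoid src tgt ∅ a b := Quotient.exact hab
      induction h with
      | rel x y h => simp at h
      | refl x => rfl
      | symm x y _ ih => exact (ih (Quotient.sound (by assumption))).symm
      | trans x y z _ _ ih1 ih2 =>
        exact (ih1 (Quotient.sound (by assumption))).trans (ih2 (Quotient.sound (by assumption)))
    · exact fun _ g => ⟨fun _ => 1, by simp⟩
  | insert e T he ih =>
    obtain ⟨ih1, ih2⟩ := ih
    set S := edgeSetoid src tgt T with hS
    set S' := edgeSetoid src tgt (insert e T) with hS'
    have hle : ∀ a b, S a b → S' a b := by
      intro a b h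
      refine Relation.EqvGen.mono ?_ _ _ h
      rintro x y ⟨e', h1, h2⟩
      exact ⟨e', Finset.mem_insert_of_mem h1, h2⟩
    rw [Finset.card_insert_of_notMem he]
    by_cases hcon : S (src e) (tgt e)
    -- `e` closes a cycle, so the number of components does not change
    · have hSS : S' = S := by
        ext a b
        constructor
        · intro h
          rcases edgeSetoid_insert src tgt h with h | ⟨h1, h2⟩ | ⟨h1, h2⟩
          · exact h
          · exact S.trans' h1 (S.trans' hcon h2)
          · exact S.trans' h1 (S.trans' (S.symm' hcon) h2)
        · exact hle a b
      rw [hSS]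
      exact ⟨by omega, fun h => by omega⟩
    -- `e` joins two different components, so the potential can be adjusted on one of them
    · have hcard : Nat.card (Quotient S) ≤ Nat.card (Quotient S') + 1 := by
        rw [← Finite.card_option]
        let f : Quotient S → Option (Quotient S') := fun q =>
          if q = Quotient.mk S (tgt e) then none else
            some (Quotient.map' (s₁ := S) (s₂ := S') id hle q)
        refine Nat.card_le_card_of_injective f ?_
        intro q q' hqq
        simp only [f] at hqq
        split_ifs at hqq with h1 h2 h2
        · rw [h1, h2]
        · induction q using Quotient.inductionOn with | _ a
          induction q' using Quotient.inductionOn with | _ b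
          have hab : S' a b := Quotient.exact (Option.some.inj hqq)
          apply Quotient.sound
          rcases edgeSetoid_insert src tgt hab with h | ⟨_, h⟩ | ⟨h, _⟩
          · exact h
          · exact absurd (Quotient.sound (S.symm' h)) h2
          · exact absurd (Quotient.sound h) h1
      refine ⟨by omega, fun h g => ?_⟩
      obtain ⟨k, hk⟩ := ih2 (by omega) g
      refine ⟨fun v => if S v (tgt e) then k v * ((k (tgt e))⁻¹ * g e * k (src e)) else k v, ?_⟩
      intro e' he'
      rcases Finset.mem_insert.mp he' with rfl | hmem
      · beta_reduce
        rw [if_pos (S.refl' _), if_neg hcon]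
        group
      · have hst : S (src e') (tgt e') := Relation.EqvGen.rel _ _ ⟨e', hmem, rfl, rfl⟩
        beta_reduce
        by_cases h1 : S (tgt e') (tgt e)
        · rw [if_pos h1, if_pos (S.trans' hst h1), hk e' hmem, mul_assoc]
        · rw [if_neg h1, if_neg (fun h2 => h1 (S.trans' (S.symm' hst) h2)), hk e' hmem]

end Potentials

variable {n : ℕ} [NeZero n]

/-- Along a maximal tree, every connection is a pure gauge. -/
theorem IsMaximalDualTree.exists_potential {G : Type*} [Group G] {T : Finset (DualEdge n)}
    (hT : IsMaximalDualTree T) (g : DualEdge n → G) :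
    ∃ k : DualVertex n → G, ∀ e ∈ T, k e.tgt = g e * k e.src := by
  apply (card_le_and_exists_potential DualEdge.src DualEdge.tgt T).2
  have : Nat.card (Quotient (edgeSetoid DualEdge.src DualEdge.tgt T)) = 1 := by
    rw [Nat.card_eq_one_iff_unique]
    constructor
    · constructor
      intro a b
      induction a using Quotient.inductionOn
      induction b using Quotient.inductionOn
      exact Quotient.sound (hT.2 _ _)
    · exact ⟨Quotient.mk _ ((0, true), 0)⟩
  rw [this, ← hT.1, add_comm]

end

/-! ### Curvature, gauge transformations and gauge fixing -/

section

variable {n : ℕ} [NeZero n]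

section Curvature

theorem pathHolonomy_foldl (g : DualEdge n → SU2) (path : List (DualEdge n × Bool)) (a : SU2) :
    path.foldl (fun acc s => (if s.2 then g s.1 else (g s.1)⁻¹) * acc) a =
      pathHolonomy g path * a := by
  induction path generalizing a with
  | nil => simp [pathHolonomy]
  | cons s l ih =>
    rw [pathHolonomy, List.foldl_cons, List.foldl_cons, ih, ih (_ * 1), mul_one, mul_assoc]

@[simp]
theorem pathHolonomy_nil (g : DualEdge n → SU2) : pathHolonomy g [] = 1 := rfl

@[simp]
theorem pathHolonomy_cons (g : DualEdge n → SU2) (s : DualEdge n × Bool)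
    (path : List (DualEdge n × Bool)) :
    pathHolonomy g (s :: path) = pathHolonomy g path * if s.2 then g s.1 else (g s.1)⁻¹ := by
  rw [pathHolonomy, List.foldl_cons, pathHolonomy_foldl, mul_one]

theorem pathHolonomy_append (g : DualEdge n → SU2) (l l' : List (DualEdge n × Bool)) :
    pathHolonomy g (l ++ l') = pathHolonomy g l' * pathHolonomy g l := by
  induction l with
  | nil => simp
  | cons s l ih => rw [List.cons_append, pathHolonomy_cons, ih, pathHolonomy_cons, mul_assoc]

/-- The holonomy of the column above `t` from its foot up to level `j`. -/
def columnHolonomy (g : DualEdge n → SU2) (t : Tri n) : Fin 5 → SU2 :=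
  ![1, g (.column t 0), g (.column t 1) * g (.column t 0),
    g (.column t 2) * g (.column t 1) * g (.column t 0),
    g (.column t 3) * g (.column t 2) * g (.column t 1) * g (.column t 0)]

theorem pathHolonomy_columnUp (g : DualEdge n → SU2) (t : Tri n) {i j : Fin 5} (hij : i ≤ j) :
    pathHolonomy g (columnUp t i j) = columnHolonomy g t j * (columnHolonomy g t i)⁻¹ := by
  have h4 : List.finRange 4 = [0, 1, 2, 3] := rfl
  fin_cases i <;> fin_cases j <;> first
    | exact absurd hij (by decide)
    | (simp [columnUp, h4, columnHolonomy, List.filter, mul_assoc])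

theorem pathHolonomy_columnDown (g : DualEdge n → SU2) (t : Tri n) {i j : Fin 5} (hij : i ≤ j) :
    pathHolonomy g (columnDown t i j) = columnHolonomy g t i * (columnHolonomy g t j)⁻¹ := by
  have h : ∀ l : List (DualEdge n × Bool), (∀ s ∈ l, s.2 = true) →
      pathHolonomy g (l.map fun s => (s.1, false)).reverse = (pathHolonomy g l)⁻¹ := by
    intro l hl
    induction l with
    | nil => simp
    | cons s l ih =>
      rw [List.map_cons, List.reverse_cons, pathHolonomy_append,
        ih fun s hs => hl s (List.mem_cons_of_mem _ hs), pathHolonomy_cons,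
        pathHolonomy_cons, hl s List.mem_cons_self]
      simp
  rw [columnDown, h, pathHolonomy_columnUp g t hij]
  · group
  · intro s hs
    simp only [columnUp, List.mem_map] at hs
    obtain ⟨k, _, rfl⟩ := hs
    rfl

theorem SurfEdge.srcLevel_le (e : SurfEdge n) (k : Fin 3) :
    e.srcLevel k.castSucc ≤ e.srcLevel k.succ := by
  cases e <;> fin_cases k <;> simp [SurfEdge.srcLevel]

theorem SurfEdge.tgtLevel_le (e : SurfEdge n) (k : Fin 3) :
    e.tgtLevel k.castSucc ≤ e.tgtLevel k.succ := by
  cases e <;> fin_cases k <;> simp [SurfEdge.tgtLevel]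

/-- The holonomy of a crossing edge, transported to the feet of its two columns. -/
def crossHolonomy (g : DualEdge n → SU2) (e : SurfEdge n) (k : Fin 4) : SU2 :=
  (columnHolonomy g e.tgt (e.tgtLevel k))⁻¹ * g (.cross e k) *
    columnHolonomy g e.src (e.srcLevel k)

theorem curvature_quad (g : DualEdge n → SU2) (e : SurfEdge n) (k : Fin 3) :
    curvature g (.quad e k) = columnHolonomy g e.src (e.srcLevel k.castSucc) *
      ((crossHolonomy g e k.succ)⁻¹ * crossHolonomy g e k.castSucc) *
        (columnHolonomy g e.src (e.srcLevel k.castSucc))⁻¹ := by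
  rw [curvature, DualFace.boundary, pathHolonomy_append, pathHolonomy_append, pathHolonomy_append,
    pathHolonomy_columnUp g _ (e.tgtLevel_le k), pathHolonomy_columnDown g _ (e.srcLevel_le k)]
  simp only [pathHolonomy_cons, pathHolonomy_nil, crossHolonomy, if_true, Bool.false_eq_true,
    if_false]
  group

theorem curvature_particle (g : DualEdge n → SU2) (p : Fin n) :
    curvature g (.particle p) =
      (g (.cross (.equator (p - 1)) 1))⁻¹ * g (.cross (.meridian p false) 1) *
        g (.cross (.equator p) 2) * (g (.cross (.meridian p true) 1))⁻¹ := by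
  simp [curvature, DualFace.boundary, mul_assoc]

theorem curvature_pole (g : DualEdge n → SU2) (s : Bool) :
    curvature g (.pole s) = (List.ofFn fun p => g (.cross (.meridian p s) 2)).prod := by
  have h : ∀ l : List (Fin n), pathHolonomy g
      (l.reverse.map fun p => ((.cross (.meridian p s) 2 : DualEdge n), true)) =
      (l.map fun p => g (.cross (.meridian p s) 2)).prod := by
    intro l
    induction l with
    | nil => simp
    | cons p l ih =>
      rw [List.reverse_cons, List.map_append, pathHolonomy_append, ih]
      simp
  rw [curvature, DualFace.boundary, h, List.ofFn_eq_map]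

end Curvature

section Gauge

/-- The gauge transformations of a discrete connection on the dual 2-complex. -/
def dualGauge (k : DualVertex n → SU2) (g : DualEdge n → SU2) : DualEdge n → SU2 :=
  fun e => (k e.tgt)⁻¹ * g e * k e.src

theorem columnHolonomy_dualGauge (k : DualVertex n → SU2) (g : DualEdge n → SU2) (t : Tri n)
    (j : Fin 5) :
    columnHolonomy (dualGauge k g) t j = (k (t, j))⁻¹ * columnHolonomy g t j * k (t, 0) := by
  fin_cases j <;> simp [columnHolonomy, dualGauge, DualEdge.src, DualEdge.tgt] <;> group

theorem crossHolonomy_dualGauge (k : DualVertex n → SU2) (g : DualEdge n → SU2) (e : SurfEdge n)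
    (j : Fin 4) :
    crossHolonomy (dualGauge k g) e j = (k (e.tgt, 0))⁻¹ * crossHolonomy g e j * k (e.src, 0) := by
  rw [crossHolonomy, crossHolonomy, columnHolonomy_dualGauge, columnHolonomy_dualGauge]
  simp only [dualGauge, DualEdge.src, DualEdge.tgt]
  group

theorem prod_ofFn_telescope {G : Type*} [Group G] (f : ℕ → G) (m : ℕ) (x : Fin m → G) :
    (List.ofFn fun i => (f i)⁻¹ * x i * f (i + 1)).prod = (f 0)⁻¹ * (List.ofFn x).prod * f m := by
  induction m generalizing f with
  | zero => simp
  | succ m ih =>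
    rw [List.ofFn_succ, List.ofFn_succ, List.prod_cons, List.prod_cons]
    have := ih (fun i => f (i + 1)) (fun i => x i.succ)
    simp only [Fin.val_succ, Fin.val_zero] at this ⊢
    rw [this]
    group

open Fin.CommRing in
/-- Gauge transformations conjugate the curvatures. -/
theorem exists_curvature_dualGauge (k : DualVertex n → SU2) (g : DualEdge n → SU2)
    (f : DualFace n) :
    ∃ a : SU2, curvature (dualGauge k g) f = a * curvature g f * a⁻¹ := by
  cases f with
  | quad e j =>
    refine ⟨(k (e.src, e.srcLevel j.castSucc))⁻¹, ?_⟩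
    rw [curvature_quad, curvature_quad, columnHolonomy_dualGauge, crossHolonomy_dualGauge,
      crossHolonomy_dualGauge]
    group
  | particle p =>
    refine ⟨(k ((p - 1, true), 1))⁻¹, ?_⟩
    rw [curvature_particle, curvature_particle]
    simp only [dualGauge, DualEdge.src, DualEdge.tgt, SurfEdge.src, SurfEdge.tgt,
      SurfEdge.srcLevel, SurfEdge.tgtLevel]
    simp
    group
  | pole s =>
    refine ⟨(k ((0 - 1, s), 3))⁻¹, ?_⟩
    rw [curvature_pole, curvature_pole]
    have h := prod_ofFn_telescope (fun i : ℕ => k (((i : Fin n) - 1, s), 3)) n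
      (fun p => g (.cross (.meridian p s) 2))
    have h2 : (fun p : Fin n => dualGauge k g (.cross (.meridian p s) 2)) =
        fun i : Fin n => (k ((((i : ℕ) : Fin n) - 1, s), 3))⁻¹ * g (.cross (.meridian i s) 2) *
          k (((((i : ℕ) + 1 : ℕ) : Fin n) - 1, s), 3) := by
      ext1 p
      have h3 : ((p : ℕ) : Fin n) = p := Fin.cast_val_eq_self p
      have h4 : ((((p : ℕ) + 1 : ℕ) : Fin n) - 1) = p := by
        push_cast
        simp
      rw [h3, h4]
      rfl
    rw [h2, h]
    simp

theorem initialConnection_dualGauge (k : DualVertex n → SU2) (g : DualEdge n → SU2) :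
    initialConnection (dualGauge k g) =
      gaugeTransform (fun t => k (t, 0)) (initialConnection g) := by
  ext1 e
  cases e <;> rfl

theorem finalConnection_dualGauge (k : DualVertex n → SU2) (g : DualEdge n → SU2) :
    finalConnection (dualGauge k g) =
      gaugeTransform (fun t => k (t, 4)) (finalConnection g) := by
  ext1 e
  cases e <;> rfl

/-- The integrand of the regularized amplitude before gauge fixing, a function of the holonomies
along all dual edges. -/
def amplitudeIntegrand (θ : Fin n → ℝ) (Φf Φi : (SurfEdge n → SU2) → ℂ) (φ : DualFace n → SU2 → ℝ)
    (g : DualEdge n → SU2) : ℂ :=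
  ((∏ f : DualFace n, faceFactor θ φ f (curvature g f) : ℝ) : ℂ) *
    (starRingEnd ℂ (Φf (finalConnection g)) * Φi (initialConnection g))

theorem faceFactor_conj (θ : Fin n → ℝ) {φ : DualFace n → SU2 → ℝ}
    (hφ : ∀ f x g, φ f (x * g * x⁻¹) = φ f g) (f : DualFace n) (a g : SU2) :
    faceFactor θ φ f (a * g * a⁻¹) = faceFactor θ φ f g := by
  cases f with
  | particle p => exact classDelta_conj (hφ _) _ _ _
  | quad e k => exact hφ _ _ _
  | pole s => exact hφ _ _ _

theorem continuous_faceFactor (θ : Fin n → ℝ) {φ : DualFace n → SU2 → ℝ}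
    (hφ : ∀ f, Continuous (φ f)) (f : DualFace n) : Continuous (faceFactor θ φ f) := by
  cases f with
  | particle p => exact continuous_classDelta (hφ _) _
  | quad e k => exact hφ _
  | pole s => exact hφ _

theorem continuous_curvature (f : DualFace n) :
    Continuous fun g : DualEdge n → SU2 => curvature g f := by
  have h : ∀ l : List (DualEdge n × Bool), Continuous fun g => pathHolonomy g l := by
    intro l
    induction l with
    | nil => exact continuous_const
    | cons s l ih =>
      simp only [pathHolonomy_cons]
      rcases s.2 with _ | _
      · exact ih.mul (continuous_apply _).inv
      · exact ih.mul (continuous_apply _)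
  exact h _

theorem amplitudeIntegrand_dualGauge (θ : Fin n → ℝ) {Φf Φi : (SurfEdge n → SU2) → ℂ}
    (hf : ∀ k g, Φf (gaugeTransform k g) = Φf g) (hi : ∀ k g, Φi (gaugeTransform k g) = Φi g)
    {φ : DualFace n → SU2 → ℝ} (hφ : ∀ f x g, φ f (x * g * x⁻¹) = φ f g)
    (k : DualVertex n → SU2) (g : DualEdge n → SU2) :
    amplitudeIntegrand θ Φf Φi φ (dualGauge k g) = amplitudeIntegrand θ Φf Φi φ g := by
  have h : ∀ f, faceFactor θ φ f (curvature (dualGauge k g) f) =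
      faceFactor θ φ f (curvature g f) := by
    intro f
    obtain ⟨a, ha⟩ := exists_curvature_dualGauge k g f
    rw [ha, faceFactor_conj θ hφ]
  simp only [amplitudeIntegrand, h, initialConnection_dualGauge, finalConnection_dualGauge, hf, hi]

theorem continuous_amplitudeIntegrand (θ : Fin n → ℝ) {Φf Φi : (SurfEdge n → SU2) → ℂ}
    (hf : Continuous Φf) (hi : Continuous Φi) {φ : DualFace n → SU2 → ℝ}
    (hφ : ∀ f, Continuous (φ f)) : Continuous (amplitudeIntegrand θ Φf Φi φ) := by
  refine Continuous.mul (Complex.continuous_ofReal.comp ?_)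
    (Continuous.mul (Complex.continuous_conj.comp (hf.comp ?_)) (hi.comp ?_))
  · exact continuous_finsetProd _ fun f _ =>
      (continuous_faceFactor θ hφ f).comp (continuous_curvature f)
  · exact continuous_pi fun e => continuous_apply _
  · exact continuous_pi fun e => continuous_apply _

/-- Gauge fixing: an integral of a gauge invariant function is not changed if the holonomies
along a forest are set to `1`. -/
theorem integral_eq_integral_trivialized {T : Finset (DualEdge n)}
    (hT : ∀ g : DualEdge n → SU2, ∃ k : DualVertex n → SU2, ∀ e ∈ T, k e.tgt = g e * k e.src)
    {h : (DualEdge n → SU2) → ℂ} (hc : Continuous h) (hk : ∀ k g, h (dualGauge k g) = h g) :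
    ∫ g, h g ∂(Measure.pi fun _ => haarSU2) =
      ∫ g, h (fun e => if e ∈ T then 1 else g e) ∂(Measure.pi fun _ => haarSU2) := by
  -- The gauge transformation trivializing `g` along `T` depends on the variables in `T` only, so
  -- it acts on the other variables by translations.
  choose κ hκ using hT
  let cut : (DualEdge n → SU2) → DualEdge n → SU2 := fun g e => if e ∈ T then g e else 1
  refine integral_pi_eq_of_translate (fun e => e ∉ T) hc (hc.comp ?_)
    (fun g e => κ (cut g) e.tgt) (fun g e => (κ (cut g) e.src)⁻¹) ?_ ?_
  · refine continuous_pi fun e => ?_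
    split_ifs
    · exact continuous_const
    · exact continuous_apply _
  · intro g g' hgg
    have : cut g = cut g' := by
      ext1 e
      by_cases he : e ∈ T
      · simp only [cut, if_pos he]; exact hgg e (not_not_intro he)
      · simp only [cut, if_neg he]
    rw [this]
    exact ⟨rfl, rfl⟩
  · intro g
    rw [← hk (κ (cut g))]
    congr 1
    ext1 e
    by_cases he : e ∈ T
    · have := hκ (cut g) e he
      simp only [cut, if_pos he] at this
      simp only [dualGauge, he, not_true_eq_false, if_false, if_true]
      rw [mul_assoc, ← this, inv_mul_cancel]
    · simp only [dualGauge, he, not_false_eq_true, if_false, if_true]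
      group

/-- The gauge fixed amplitude is the integral over all connections, so it does not depend on the
tree. -/
theorem regularizedAmplitude_eq_integral {T : Finset (DualEdge n)} (hT : IsMaximalDualTree T)
    (θ : Fin n → ℝ) {Φf Φi : (SurfEdge n → SU2) → ℂ}
    (hf : ∀ k g, Φf (gaugeTransform k g) = Φf g) (hi : ∀ k g, Φi (gaugeTransform k g) = Φi g)
    (hfc : Continuous Φf) (hic : Continuous Φi)
    {φ : DualFace n → SU2 → ℝ} (hφ : ∀ f x g, φ f (x * g * x⁻¹) = φ f g)
    (hφc : ∀ f, Continuous (φ f)) :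
    regularizedAmplitude θ T Φf Φi φ =
      ∫ g, amplitudeIntegrand θ Φf Φi φ g ∂(Measure.pi fun _ => haarSU2) := by
  have hc := continuous_amplitudeIntegrand θ hfc hic hφc
  rw [integral_eq_integral_trivialized (fun g => hT.exists_potential g) hc
    (amplitudeIntegrand_dualGauge θ hf hi hφ)]
  have hmp := measurePreserving_restrict (fun e : DualEdge n => e ∉ T)
  have hext : Continuous (extendByOne T) := by
    refine continuous_pi fun e => ?_
    unfold extendByOne
    split_ifs
    · exact continuous_const
    · exact continuous_apply _
  have h := integral_map (μ := Measure.pi fun _ : DualEdge n => haarSU2)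
    (f := fun g => amplitudeIntegrand θ Φf Φi φ (extendByOne T g))
    hmp.measurable.aemeasurable (hc.comp hext).aestronglyMeasurable
  rw [hmp.map_eq] at h
  exact h

end Gauge

section RadialTree

/-- The edges of a spanning tree: all columns, the edges crossing the equator at the first
tetrahedra, and, in the northern hemisphere, all but one of the edges joining neighbouring prisms
below the diagonals. -/
def IsRadial : DualEdge n → Prop
  | .column _ _ => True
  | .cross (.equator _) k => k = 1
  | .cross (.meridian p s) k => k = 1 ∧ s = true ∧ p ≠ 0

instance : DecidablePred (IsRadial (n := n)) := fun e => by
  rcases e with ⟨t, k⟩ | ⟨⟨p, s⟩ | ⟨p⟩, k⟩ <;> unfold IsRadial <;> infer_instance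

/-- `IsRadial` is a forest: the potentials are obtained by going around the north pole, then across
the equator, and then up the columns. -/
theorem exists_potential_isRadial (g : DualEdge n → SU2) :
    ∃ k : DualVertex n → SU2, ∀ e, IsRadial e → k e.tgt = g e * k e.src := by
  let M : Fin n → SU2 := fun p => crossHolonomy g (.meridian p true) 1
  -- the potential at the foot of the column above the northern triangle `i`
  let a : ℕ → SU2 := fun i => Nat.rec 1 (fun i x => (M (Fin.ofNat n (i + 1)))⁻¹ * x) i
  have ha : ∀ p : Fin n, p ≠ 0 → a (p - 1 : Fin n).val = M p * a p.val := by
    intro p hp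
    have h1 : (p - 1 : Fin n).val + 1 = p.val := by
      have hp0 : p.val ≠ 0 := fun h => hp (Fin.ext (by simpa using h))
      have h2 := p.2
      have h3 : ((1 : Fin n) : ℕ) = 1 := by
        rw [Fin.val_one', Nat.mod_eq_of_lt (by omega)]
      rw [Fin.sub_def]
      simp only [h3]
      rw [show n - 1 + p.val = (p.val - 1) + n by omega, Nat.add_mod_right,
        Nat.mod_eq_of_lt (by omega)]
      omega
    have h2 : Fin.ofNat n ((p - 1 : Fin n).val + 1) = p := by
      rw [h1]; exact Fin.ext (Nat.mod_eq_of_lt p.2)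
    have h3 : a p.val = (M (Fin.ofNat n ((p - 1 : Fin n).val + 1)))⁻¹ * a (p - 1 : Fin n).val := by
      rw [← h1]
    rw [h3, h2]
    group
  let K : Tri n → SU2 := fun t =>
    if t.2 then a t.1.val else crossHolonomy g (.equator t.1) 1 * a t.1.val
  refine ⟨fun v => columnHolonomy g v.1 v.2 * K v.1, fun e he => ?_⟩
  rcases e with ⟨t, k⟩ | ⟨⟨p, s⟩ | p, k⟩
  · fin_cases k <;> simp [DualEdge.src, DualEdge.tgt, columnHolonomy, mul_assoc]
  · obtain ⟨rfl, rfl, hp⟩ := he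
    simp only [DualEdge.src, DualEdge.tgt, SurfEdge.src, SurfEdge.tgt, K, if_true, ha p hp, M,
      crossHolonomy]
    group
  · obtain rfl : k = 1 := he
    simp only [DualEdge.src, DualEdge.tgt, SurfEdge.src, SurfEdge.tgt, K, if_true,
      Bool.false_eq_true, if_false, crossHolonomy]
    group

end RadialTree

end

/-! ### The integrand in the gauge of a spanning tree -/

section

variable {n : ℕ} [NeZero n]

section Delta

/-- `torusElt θ` is conjugate to its inverse, so the class delta function may as well be defined by
the inverses. -/
theorem classDelta_eq_integral_inv (φ : SU2 → ℝ) (θ : ℝ) (G : SU2) :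
    classDelta φ θ G = ∫ u, φ (G * (u * torusElt θ * u⁻¹)⁻¹) ∂haarSU2 := by
  rw [classDelta, ← integral_mul_right_eq_self _ SU2.weyl]
  congr 1
  ext u
  congr 2
  have h := SU2.weyl_conj θ
  rw [SU2.torusElt_neg] at h
  rw [mul_inv_rev, mul_inv_rev, mul_inv_rev, inv_inv, ← h]
  group

end Delta

/-- The values of a connection on the crossing edges below the diagonals, with those of the
spanning tree `IsRadial` set to `1`. -/
def lowerCross (g : DualEdge n → SU2) : SurfEdge n → SU2
  | .meridian p false => g (.cross (.meridian p false) 1)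
  | .meridian p true => if p = 0 then g (.cross (.meridian p true) 1) else 1
  | .equator _ => 1

/-- The integrand of the regularized amplitude in the gauge `IsRadial`, with the regularized class
delta functions of the particles written as averages over `u`. -/
def fixedIntegrand (θ : Fin n → ℝ) (Φf Φi : (SurfEdge n → SU2) → ℂ) (φ : DualFace n → SU2 → ℝ)
    (u : Fin n → SU2) (g : DualEdge n → SU2) : ℂ :=
  (((∏ e, (φ (.quad e 0) ((lowerCross g e)⁻¹ * g (.cross e 0)) *
      φ (.quad e 1) ((g (.cross e 2))⁻¹ * lowerCross g e) *
      φ (.quad e 2) ((g (.cross e 3))⁻¹ * g (.cross e 2)))) *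
    (∏ p, φ (.particle p) (lowerCross g (.meridian p false) * g (.cross (.equator p) 2) *
      (lowerCross g (.meridian p true))⁻¹ * (u p * torusElt (θ p) * (u p)⁻¹)⁻¹)) *
    φ (.pole true) (List.ofFn fun p => g (.cross (.meridian p true) 2)).prod *
    φ (.pole false) (List.ofFn fun p => g (.cross (.meridian p false) 2)).prod : ℝ) : ℂ) *
  (starRingEnd ℂ (Φf (finalConnection g)) * Φi (initialConnection g))

/-- The faces of the dual complex, grouped into kinds. -/
def dualFaceEquiv : DualFace n ≃ (SurfEdge n × Fin 3) ⊕ Fin n ⊕ Bool where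
  toFun
    | .quad e k => .inl (e, k)
    | .particle p => .inr (.inl p)
    | .pole s => .inr (.inr s)
  invFun
    | .inl (e, k) => .quad e k
    | .inr (.inl p) => .particle p
    | .inr (.inr s) => .pole s
  left_inv f := by cases f <;> rfl
  right_inv f := by rcases f with _ | _ | _ <;> rfl

theorem prod_dualFace (f : DualFace n → ℝ) :
    ∏ x, f x = (∏ e, (f (.quad e 0) * f (.quad e 1) * f (.quad e 2))) * (∏ p, f (.particle p)) *
      f (.pole true) * f (.pole false) := by
  rw [← dualFaceEquiv.symm.prod_comp, Fintype.prod_sum_type, Fintype.prod_sum_type,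
    Fintype.prod_prod_type, Fintype.prod_bool]
  simp only [Fin.prod_univ_three, dualFaceEquiv, Equiv.coe_fn_symm_mk]
  ring

theorem integral_ofReal_prod (f : Fin n → SU2 → ℝ) :
    ∫ u : Fin n → SU2, ((∏ p, f p (u p) : ℝ) : ℂ) ∂(Measure.pi fun _ => haarSU2) =
      ((∏ p, ∫ v, f p v ∂haarSU2 : ℝ) : ℂ) := by
  rw [integral_complex_ofReal, integral_fintype_prod_eq_prod]

theorem crossHolonomy_of_column_eq_one {g : DualEdge n → SU2} (hg : ∀ t k, g (.column t k) = 1)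
    (e : SurfEdge n) (k : Fin 4) : crossHolonomy g e k = g (.cross e k) := by
  have h : ∀ t j, columnHolonomy g t j = 1 := by
    intro t j
    fin_cases j <;> simp [columnHolonomy, hg]
  simp [crossHolonomy, h]

/-- In the radial gauge the curvatures involve the crossing edges only. -/
theorem amplitudeIntegrand_radial (θ : Fin n → ℝ) (Φf Φi : (SurfEdge n → SU2) → ℂ)
    (φ : DualFace n → SU2 → ℝ) (g : DualEdge n → SU2) :
    amplitudeIntegrand θ Φf Φi φ (fun e => if IsRadial e then 1 else g e) =
      ∫ u, fixedIntegrand θ Φf Φi φ u g ∂(Measure.pi fun _ => haarSU2) := by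
  set g' : DualEdge n → SU2 := fun e => if IsRadial e then 1 else g e with hg'
  have hcol : ∀ t k, g' (.column t k) = 1 := fun t k => if_pos trivial
  have h1 : ∀ e, g' (.cross e 1) = lowerCross g e := by
    rintro (⟨p, _ | _⟩ | p)
    · simp [hg', IsRadial, lowerCross]
    · by_cases hp : p = 0 <;> simp [hg', IsRadial, lowerCross, hp]
    · simp [hg', IsRadial, lowerCross]
  have h2 : ∀ e k, k ≠ 1 → g' (.cross e k) = g (.cross e k) := by
    rintro (⟨p, s⟩ | p) k hk <;> simp [hg', IsRadial, hk]
  have hquad : ∀ e k, curvature g' (.quad e k) = (g' (.cross e k.succ))⁻¹ * g' (.cross e k.castSucc) := by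
    intro e k
    have h : ∀ t j, columnHolonomy g' t j = 1 := by
      intro t j
      fin_cases j <;> simp [columnHolonomy, hcol]
    rw [curvature_quad, crossHolonomy_of_column_eq_one hcol, crossHolonomy_of_column_eq_one hcol, h]
    simp
  have hi : initialConnection g' = initialConnection g := funext fun e => h2 e 0 (by decide)
  have hf : finalConnection g' = finalConnection g := funext fun e => h2 e 3 (by decide)
  have hp : ∀ p, classDelta (φ (.particle p)) (θ p) (curvature g' (.particle p)) =
      ∫ v, φ (.particle p) (lowerCross g (.meridian p false) * g (.cross (.equator p) 2) *
      (lowerCross g (.meridian p true))⁻¹ * (v * torusElt (θ p) * v⁻¹)⁻¹) ∂haarSU2 := by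
    intro p
    rw [classDelta_eq_integral_inv, curvature_particle, h1, h1, h1, h2 _ 2 (by decide)]
    simp [lowerCross]
  rw [amplitudeIntegrand, prod_dualFace]
  simp only [faceFactor, hp, hquad, hi, hf, curvature_pole]
  simp only [fixedIntegrand]
  rw [integral_mul_const]
  congr 1
  have e0 : ∀ e, g' (.cross e (Fin.castSucc (0 : Fin 3))) = g (.cross e 0) := fun e => h2 e 0 (by decide)
  have e1 : ∀ e, g' (.cross e (Fin.succ (0 : Fin 3))) = lowerCross g e := h1
  have e2 : ∀ e, g' (.cross e (Fin.castSucc (1 : Fin 3))) = lowerCross g e := h1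
  have e3 : ∀ e, g' (.cross e (Fin.succ (1 : Fin 3))) = g (.cross e 2) := fun e => h2 e 2 (by decide)
  have e4 : ∀ e, g' (.cross e (Fin.castSucc (2 : Fin 3))) = g (.cross e 2) := fun e => h2 e 2 (by decide)
  have e5 : ∀ e, g' (.cross e (Fin.succ (2 : Fin 3))) = g (.cross e 3) := fun e => h2 e 3 (by decide)
  have e6 : ∀ e, g' (.cross e 2) = g (.cross e 2) := fun e => h2 e 2 (by decide)
  simp only [e0, e1, e2, e3, e4, e5, e6]
  simp only [Complex.ofReal_mul]
  rw [integral_mul_const, integral_mul_const, integral_const_mul, integral_ofReal_prod (fun p v =>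
    φ (.particle p) (lowerCross g (.meridian p false) * g (.cross (.equator p) 2) *
      (lowerCross g (.meridian p true))⁻¹ * (v * torusElt (θ p) * v⁻¹)⁻¹))]

end

/-! ### Substitutions solving the flatness constraints -/

section

variable {n : ℕ} [NeZero n]

section Substitution

theorem continuous_prod_ofFn {X G : Type*} [TopologicalSpace X] [TopologicalSpace G] [Monoid G]
    [ContinuousMul G] {m : ℕ} {f : X → Fin m → G} (hf : ∀ i, Continuous fun x => f x i) :
    Continuous fun x => (List.ofFn (f x)).prod := by
  simp only [List.ofFn_eq_map]
  exact continuous_list_prod _ fun i _ => hf i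

theorem continuous_lowerCross (e : SurfEdge n) :
    Continuous fun g : DualEdge n → SU2 => lowerCross g e := by
  rcases e with ⟨p, _ | _⟩ | p
  · exact continuous_apply _
  · by_cases hp : p = 0
    · simp only [lowerCross, if_pos hp]; exact continuous_apply _
    · simp only [lowerCross, if_neg hp]; exact continuous_const
  · exact continuous_const

theorem Continuous.fixedIntegrand {X : Type*} [TopologicalSpace X] (θ : Fin n → ℝ)
    {Φf Φi : (SurfEdge n → SU2) → ℂ} (hf : Continuous Φf) (hi : Continuous Φi)
    {φ : DualFace n → SU2 → ℝ} (hφ : ∀ f, Continuous (φ f)) {v : X → Fin n → SU2}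
    {y : X → DualEdge n → SU2} (hv : Continuous v) (hy : Continuous y) :
    Continuous fun x => _root_.fixedIntegrand θ Φf Φi φ (v x) (y x) := by
  have hg : ∀ e, Continuous fun x => y x e := fun e => (continuous_apply e).comp hy
  have hl : ∀ e, Continuous fun x => lowerCross (y x) e :=
    fun e => (continuous_lowerCross e).comp hy
  have hu : ∀ p, Continuous fun x => v x p * torusElt (θ p) * (v x p)⁻¹ := fun p =>
    (SU2.continuous_conj_torusElt (θ p)).comp ((continuous_apply p).comp hv)
  unfold _root_.fixedIntegrand
  refine Continuous.mul (Complex.continuous_ofReal.comp ?_)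
    (Continuous.mul (Complex.continuous_conj.comp (hf.comp (continuous_pi fun e => hg _)))
      (hi.comp (continuous_pi fun e => hg _)))
  refine ((Continuous.mul ?_ ?_).mul ((hφ _).comp (continuous_prod_ofFn fun p => hg _))).mul
    ((hφ _).comp (continuous_prod_ofFn fun p => hg _))
  · exact continuous_finsetProd _ fun e _ =>
      (((hφ _).comp ((hl e).inv.mul (hg _))).mul ((hφ _).comp ((hg _).inv.mul (hl e)))).mul
        ((hφ _).comp ((hg _).inv.mul (hg _)))
  · exact continuous_finsetProd _ fun p _ =>
      (hφ _).comp ((((hl _).mul (hg _)).mul (hl _).inv).mul (hu p).inv)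

/-- Substitution making the edges in the final boundary relative to those above the diagonals. -/
def shiftFinal (g : DualEdge n → SU2) : DualEdge n → SU2
  | .cross e 3 => g (.cross e 2) * g (.cross e 3)
  | e => g e

/-- Substitution making the edges in the initial boundary and those above the diagonals relative
to those below the diagonals. -/
def shiftLower (g : DualEdge n → SU2) : DualEdge n → SU2
  | .cross e 0 => lowerCross g e * g (.cross e 0)
  | .cross e 2 => lowerCross g e * g (.cross e 2)
  | e => g e

/-- Substitution solving the constraints of the particles, with prescribed holonomies `C`. -/
def shiftParticle (C : Fin n → SU2) (g : DualEdge n → SU2) : DualEdge n → SU2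
  | .cross (.meridian p false) 1 => g (.cross (.meridian p false) 1) *
      (C p * lowerCross g (.meridian p true) * (g (.cross (.equator p) 2))⁻¹)
  | e => g e

/-- Substitution solving the constraint of the north pole. -/
def shiftPole (g : DualEdge n → SU2) : DualEdge n → SU2
  | .cross (.meridian p true) 1 => g (.cross (.meridian p true) 1) *
      (List.ofFn fun p => g (.cross (.meridian p true) 2)).prod⁻¹
  | e => g e

theorem continuous_shiftFinal : Continuous (shiftFinal (n := n)) := by
  refine continuous_pi fun e => ?_
  rcases e with ⟨t, k⟩ | ⟨e, k⟩
  · exact continuous_apply _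
  · fin_cases k
    · exact continuous_apply _
    · exact continuous_apply _
    · exact continuous_apply _
    · exact (continuous_apply _).mul (continuous_apply _)

theorem continuous_shiftLower : Continuous (shiftLower (n := n)) := by
  refine continuous_pi fun e => ?_
  rcases e with ⟨t, k⟩ | ⟨e, k⟩
  · exact continuous_apply _
  · fin_cases k
    · exact (continuous_lowerCross e).mul (continuous_apply _)
    · exact continuous_apply _
    · exact (continuous_lowerCross e).mul (continuous_apply _)
    · exact continuous_apply _

theorem continuous_shiftParticle :
    Continuous fun x : (Fin n → SU2) × (DualEdge n → SU2) => shiftParticle x.1 x.2 := by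
  have hg : ∀ e, Continuous fun x : (Fin n → SU2) × (DualEdge n → SU2) => x.2 e :=
    fun e => (continuous_apply e).comp continuous_snd
  refine continuous_pi fun e => ?_
  rcases e with ⟨t, k⟩ | ⟨⟨p, _ | _⟩ | p, k⟩
  · exact hg _
  · fin_cases k
    · exact hg _
    · exact (hg _).mul ((((continuous_apply p).comp continuous_fst).mul
        ((continuous_lowerCross (.meridian p true)).comp continuous_snd)).mul (hg _).inv)
    · exact hg _
    · exact hg _
  · fin_cases k <;> exact hg _
  · exact hg _

theorem Continuous.shiftParticle {X : Type*} [TopologicalSpace X] {C : X → Fin n → SU2}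
    {g : X → DualEdge n → SU2} (hC : Continuous C) (hg : Continuous g) :
    Continuous fun x => _root_.shiftParticle (C x) (g x) :=
  continuous_shiftParticle.comp (hC.prodMk hg)

theorem continuous_shiftPole : Continuous (shiftPole (n := n)) := by
  refine continuous_pi fun e => ?_
  rcases e with ⟨t, k⟩ | ⟨⟨p, _ | _⟩ | p, k⟩
  · exact continuous_apply _
  · fin_cases k <;> exact continuous_apply _
  · fin_cases k
    · exact continuous_apply _
    · have h : Continuous fun g : DualEdge n → SU2 =>
          (List.ofFn fun p => g (.cross (.meridian p true) 2)).prod :=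
        continuous_prod_ofFn fun p => continuous_apply _
      exact (continuous_apply (DualEdge.cross (.meridian p true) 1)).mul h.inv
    · exact continuous_apply _
    · exact continuous_apply _
  · exact continuous_apply _

variable {h : (DualEdge n → SU2) → ℂ}

theorem integral_comp_shiftFinal (hc : Continuous h) :
    ∫ g, h (shiftFinal g) ∂(Measure.pi fun _ => haarSU2) = ∫ g, h g ∂(Measure.pi fun _ => haarSU2) := by
  classical
  refine (integral_pi_eq_of_translate (fun e => ∃ e', e = .cross e' 3) hc
    (hc.comp continuous_shiftFinal)
    (fun g e => match e with | .cross e _ => g (.cross e 2) | _ => 1) (fun g e => 1) ?_ ?_).symm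
  · intro g g' hgg
    refine ⟨funext fun e => ?_, rfl⟩
    rcases e with ⟨t, k⟩ | ⟨e, k⟩
    · rfl
    · exact hgg _ (by rintro ⟨e', h⟩; cases h)
  · intro g
    refine congrArg h (funext fun e => ?_)
    rcases e with ⟨t, k⟩ | ⟨e, k⟩
    · simp [shiftFinal]
    · fin_cases k <;> simp [shiftFinal]

theorem integral_comp_shiftLower (hc : Continuous h) :
    ∫ g, h (shiftLower g) ∂(Measure.pi fun _ => haarSU2) = ∫ g, h g ∂(Measure.pi fun _ => haarSU2) := by
  classical
  refine (integral_pi_eq_of_translate (fun e => ∃ e', e = .cross e' 0 ∨ e = .cross e' 2) hc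
    (hc.comp continuous_shiftLower)
    (fun g e => match e with | .cross e _ => lowerCross g e | _ => 1) (fun g e => 1) ?_ ?_).symm
  · intro g g' hgg
    refine ⟨funext fun e => ?_, rfl⟩
    rcases e with ⟨t, k⟩ | ⟨⟨p, _ | _⟩ | p, k⟩
    · rfl
    · exact hgg _ (by rintro ⟨e', h | h⟩ <;> cases h)
    · simp only [lowerCross]
      rw [hgg _ (by rintro ⟨e', h | h⟩ <;> cases h)]
    · rfl
  · intro g
    refine congrArg h (funext fun e => ?_)
    rcases e with ⟨t, k⟩ | ⟨e, k⟩
    · simp [shiftLower]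
    · fin_cases k <;> simp [shiftLower]

theorem integral_comp_shiftParticle (C : Fin n → SU2) (hc : Continuous h) :
    ∫ g, h (shiftParticle C g) ∂(Measure.pi fun _ => haarSU2) =
      ∫ g, h g ∂(Measure.pi fun _ => haarSU2) := by
  classical
  refine (integral_pi_eq_of_translate (fun e => ∃ p, e = .cross (.meridian p false) 1) hc
    (hc.comp (continuous_shiftParticle.comp (Continuous.prodMk_right C)))
    (fun g e => 1) (fun g e => match e with
      | .cross (.meridian p _) _ =>
        (C p * lowerCross g (.meridian p true) * (g (.cross (.equator p) 2))⁻¹)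
      | _ => 1) ?_ ?_).symm
  · intro g g' hgg
    refine ⟨rfl, funext fun e => ?_⟩
    rcases e with ⟨t, k⟩ | ⟨⟨p, s⟩ | p, k⟩
    · rfl
    · simp only [lowerCross]
      rw [hgg _ (by rintro ⟨e', h⟩; cases h), hgg _ (by rintro ⟨e', h⟩; cases h)]
    · rfl
  · intro g
    refine congrArg h (funext fun e => ?_)
    rcases e with ⟨t, k⟩ | ⟨⟨p, _ | _⟩ | p, k⟩
    · simp [shiftParticle]
    · fin_cases k <;> simp [shiftParticle]
    · fin_cases k <;> simp [shiftParticle]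
    · simp [shiftParticle]

theorem integral_comp_shiftPole (hc : Continuous h) :
    ∫ g, h (shiftPole g) ∂(Measure.pi fun _ => haarSU2) = ∫ g, h g ∂(Measure.pi fun _ => haarSU2) := by
  classical
  refine (integral_pi_eq_of_translate (fun e => ∃ p, e = .cross (.meridian p true) 1) hc
    (hc.comp continuous_shiftPole)
    (fun g e => 1) (fun g _ => (List.ofFn fun p => g (.cross (.meridian p true) 2)).prod⁻¹)
    ?_ ?_).symm
  · intro g g' hgg
    refine ⟨rfl, funext fun e => ?_⟩
    congr 3
    ext1 p
    exact hgg _ (by rintro ⟨e', h⟩; cases h)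
  · intro g
    refine congrArg h (funext fun e => ?_)
    rcases e with ⟨t, k⟩ | ⟨⟨p, _ | _⟩ | p, k⟩
    · simp [shiftPole]
    · fin_cases k <;> simp [shiftPole]
    · fin_cases k <;> simp [shiftPole]
    · simp [shiftPole]

/-- The composition of the four substitutions. Each of them translates some variables by functions
of the others, so their composition preserves the Haar measure. -/
def solveConstraints (C : Fin n → SU2) (g : DualEdge n → SU2) : DualEdge n → SU2 :=
  shiftFinal (shiftLower (shiftParticle C (shiftPole g)))

theorem Continuous.solveConstraints {X : Type*} [TopologicalSpace X] {C : X → Fin n → SU2}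
    {g : X → DualEdge n → SU2} (hC : Continuous C) (hg : Continuous g) :
    Continuous fun x => _root_.solveConstraints (C x) (g x) := by
  have h1 : Continuous fun x => shiftPole (g x) := continuous_shiftPole.comp hg
  have h2 : Continuous fun x => _root_.shiftParticle (C x) (shiftPole (g x)) :=
    hC.shiftParticle h1
  exact continuous_shiftFinal.comp (continuous_shiftLower.comp h2)

theorem integral_comp_solveConstraints (C : Fin n → SU2) (hc : Continuous h) :
    ∫ g, h (solveConstraints C g) ∂(Measure.pi fun _ => haarSU2) =
      ∫ g, h g ∂(Measure.pi fun _ => haarSU2) := by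
  have h1 : Continuous fun g => h (shiftFinal g) := hc.comp continuous_shiftFinal
  have h2 : Continuous fun g => h (shiftFinal (shiftLower g)) := h1.comp continuous_shiftLower
  have h3 : Continuous fun g => h (shiftFinal (shiftLower (shiftParticle C g))) :=
    h2.comp (continuous_shiftParticle.comp (Continuous.prodMk_right C))
  unfold solveConstraints
  rw [integral_comp_shiftPole h3, integral_comp_shiftParticle C h2, integral_comp_shiftLower h1,
    integral_comp_shiftFinal hc]

end Substitution

end

/-! ### The integrand after the substitutions -/

section

variable {n : ℕ} [NeZero n]

section Solved

/-- The face factor which remains, after the constraints are solved, as a density for the variable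
of a dual edge; it is `1` for the edges of the spanning tree. -/
def edgeWeight (φ : DualFace n → SU2 → ℝ) : DualEdge n → SU2 → ℝ
  | .column _ _, _ => 1
  | .cross e 0, x => φ (.quad e 0) x
  | .cross e 2, x => φ (.quad e 1) x⁻¹
  | .cross e 3, x => φ (.quad e 2) x⁻¹
  | .cross (.meridian p false) 1, x => φ (.particle p) x
  | .cross (.meridian p true) 1, x => if p = 0 then φ (.pole true) x else 1
  | .cross (.equator _) 1, _ => 1

/-- The holonomy around the south pole after the substitution `solveConstraints C`. -/
def southHolonomy (C : Fin n → SU2) (g : DualEdge n → SU2) : SU2 :=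
  (List.ofFn fun p => g (.cross (.meridian p false) 1) * C p *
    (lowerCross (shiftPole g) (.meridian p true) * (g (.cross (.equator p) 2))⁻¹ *
      g (.cross (.meridian p false) 2))).prod

/-- The dual edges, grouped into kinds. -/
def dualEdgeEquiv : DualEdge n ≃ (Tri n × Fin 4) ⊕ (SurfEdge n × Fin 4) where
  toFun
    | .column t k => .inl (t, k)
    | .cross e k => .inr (e, k)
  invFun
    | .inl (t, k) => .column t k
    | .inr (e, k) => .cross e k
  left_inv f := by cases f <;> rfl
  right_inv f := by rcases f with _ | _ <;> rfl

/-- The edges of the surface, grouped into kinds. -/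
def surfEdgeEquiv : SurfEdge n ≃ (Fin n × Bool) ⊕ Fin n where
  toFun
    | .meridian p s => .inl (p, s)
    | .equator p => .inr p
  invFun
    | .inl (p, s) => .meridian p s
    | .inr p => .equator p
  left_inv f := by cases f <;> rfl
  right_inv f := by rcases f with _ | _ <;> rfl

theorem prod_edgeWeight (φ : DualFace n → SU2 → ℝ) (g : DualEdge n → SU2) :
    ∏ e, edgeWeight φ e (g e) =
      (∏ e, (φ (.quad e 0) (g (.cross e 0)) * φ (.quad e 1) (g (.cross e 2))⁻¹ *
        φ (.quad e 2) (g (.cross e 3))⁻¹)) *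
      (∏ p, φ (.particle p) (g (.cross (.meridian p false) 1))) *
      φ (.pole true) (g (.cross (.meridian 0 true) 1)) := by
  have h1 : ∏ e : SurfEdge n, edgeWeight φ (.cross e 1) (g (.cross e 1)) =
      (∏ p, φ (.particle p) (g (.cross (.meridian p false) 1))) *
      φ (.pole true) (g (.cross (.meridian 0 true) 1)) := by
    rw [← surfEdgeEquiv.symm.prod_comp, Fintype.prod_sum_type, Fintype.prod_prod_type]
    simp only [Fintype.prod_bool, Finset.prod_mul_distrib, surfEdgeEquiv, Equiv.coe_fn_symm_mk,
      edgeWeight, Finset.prod_const_one, mul_one]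
    rw [Finset.prod_ite_eq' Finset.univ (0 : Fin n)
      (fun p => φ (.pole true) (g (.cross (.meridian p true) 1))), if_pos (Finset.mem_univ _), mul_comm]
  have w0 : ∀ e x, edgeWeight φ (.cross e 0) x = φ (.quad e 0) x := by rintro (_ | _) <;> intros <;> rfl
  have w2 : ∀ e x, edgeWeight φ (.cross e 2) x = φ (.quad e 1) x⁻¹ := by
    rintro (_ | _) <;> intros <;> rfl
  have w3 : ∀ e x, edgeWeight φ (.cross e 3) x = φ (.quad e 2) x⁻¹ := by
    rintro (_ | _) <;> intros <;> rfl
  rw [← dualEdgeEquiv.symm.prod_comp, Fintype.prod_sum_type]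
  change (∏ x : Tri n × Fin 4, (1 : ℝ)) *
    (∏ x : SurfEdge n × Fin 4, edgeWeight φ (.cross x.1 x.2) (g (.cross x.1 x.2))) = _
  rw [Fintype.prod_prod_type (f := fun x : SurfEdge n × Fin 4 =>
    edgeWeight φ (.cross x.1 x.2) (g (.cross x.1 x.2)))]
  simp only [Fin.prod_univ_four, Finset.prod_mul_distrib, h1, w0, w2, w3, Finset.prod_const_one]
  ring

/-- The first factor absorbs the inverse of the product. -/
theorem prod_ofFn_correction {G : Type*} [Group G] (x : G) (b : Fin n → G) :
    (List.ofFn fun p => (if p = 0 then x * (List.ofFn b).prod⁻¹ else 1) * b p).prod = x := by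
  obtain ⟨m, rfl⟩ : ∃ m, n = m + 1 := ⟨n - 1, by have := NeZero.pos n; omega⟩
  rw [List.ofFn_succ, List.prod_cons, if_pos rfl]
  have : (fun i : Fin m => (if i.succ = 0 then x * (List.ofFn b).prod⁻¹ else 1) * b i.succ) =
      fun i => b i.succ := by
    ext1 i
    rw [if_neg (Fin.succ_ne_zero i), one_mul]
  rw [this, mul_assoc, ← List.prod_cons, ← List.ofFn_succ (f := b)]
  group

/-- After the substitutions, all delta functions except that of the south pole depend on a single
variable. -/
theorem fixedIntegrand_solveConstraints (θ : Fin n → ℝ) (Φf Φi : (SurfEdge n → SU2) → ℂ)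
    (φ : DualFace n → SU2 → ℝ) (u : Fin n → SU2) (g : DualEdge n → SU2) :
    fixedIntegrand θ Φf Φi φ u
      (solveConstraints (fun p => u p * torusElt (θ p) * (u p)⁻¹) g) =
    (((∏ e, edgeWeight φ e (g e)) * φ (.pole false)
      (southHolonomy (fun p => u p * torusElt (θ p) * (u p)⁻¹) g) : ℝ) : ℂ) *
    (starRingEnd ℂ (Φf (finalConnection
        (solveConstraints (fun p => u p * torusElt (θ p) * (u p)⁻¹) g))) *
      Φi (initialConnection (solveConstraints (fun p => u p * torusElt (θ p) * (u p)⁻¹) g))) := by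
  set C : Fin n → SU2 := fun p => u p * torusElt (θ p) * (u p)⁻¹ with hC
  set x := solveConstraints C g with hx
  set ℓ := lowerCross (shiftParticle C (shiftPole g)) with hℓ
  have hl : lowerCross x = ℓ := by
    ext1 e
    rcases e with ⟨p, _ | _⟩ | p <;> rfl
  have x0 : ∀ e, x (.cross e 0) = ℓ e * g (.cross e 0) := by
    rintro (⟨p, _ | _⟩ | p) <;> rfl
  have x2 : ∀ e, x (.cross e 2) = ℓ e * g (.cross e 2) := by
    rintro (⟨p, _ | _⟩ | p) <;> rfl
  have x3 : ∀ e, x (.cross e 3) = x (.cross e 2) * g (.cross e 3) := by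
    rintro (⟨p, _ | _⟩ | p) <;> rfl
  have lN : ∀ p, ℓ (.meridian p true) = lowerCross (shiftPole g) (.meridian p true) := fun p => rfl
  have lN' : ∀ p, ℓ (.meridian p true) = if p = 0 then
      g (.cross (.meridian 0 true) 1) * (List.ofFn fun p => g (.cross (.meridian p true) 2)).prod⁻¹
      else 1 := by
    intro p
    rw [lN]
    by_cases hp : p = 0
    · subst hp; simp [lowerCross, shiftPole]
    · simp [lowerCross, hp]
  have lS : ∀ p, ℓ (.meridian p false) = g (.cross (.meridian p false) 1) *
      (C p * ℓ (.meridian p true) * (g (.cross (.equator p) 2))⁻¹) := fun p => rfl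
  have lE : ∀ p, ℓ (.equator p) = 1 := fun p => rfl
  -- from here on only the equations above are used
  clear_value x ℓ
  rw [fixedIntegrand, prod_edgeWeight, hl]
  congr 2
  congr 1
  · congr 1
    · congr 1
      · refine Finset.prod_congr rfl fun e _ => ?_
        rw [x0, x3, x2]
        congr 1
        · congr 1
          · congr 1; group
          · congr 1; group
        · congr 1; group
      · refine Finset.prod_congr rfl fun p _ => ?_
        rw [lS, x2, lE]
        congr 1
        simp only [hC]
        group
    · congr 1
      simp only [x2, lN']
      exact prod_ofFn_correction _ _
  · congr 1
    rw [southHolonomy]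
    congr 2
    ext1 p
    rw [x2, lS, lN]
    group

end Solved

end

/-! ### Collecting the particle holonomies at the south pole -/

section

variable {n : ℕ} [NeZero n]

section ConjugationInvariance

/-- Every element of `SU(2)` is conjugate to its inverse, by the Weyl element. -/
theorem SU2.classFunction_inv {α : Type*} {φ : SU2 → α} (hφ : ∀ x g, φ (x * g * x⁻¹) = φ g)
    (g : SU2) : φ g⁻¹ = φ g := by
  obtain ⟨v, hv⟩ := exists_diagonalization g
  set t := torusElt (Real.arccos (halfTrace g))
  have h : t⁻¹ = weyl * t * weyl⁻¹ := by rw [weyl_conj, torusElt_neg]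
  rw [hv, mul_inv_rev, mul_inv_rev, inv_inv, ← mul_assoc, hφ, hφ, h, hφ]

theorem integral_pi_conj {ι E : Type*} [Fintype ι] [NormedAddCommGroup E] [NormedSpace ℝ E]
    [SecondCountableTopology E] {f : (ι → SU2) → E} (hf : Continuous f) (κ : ι → SU2) :
    ∫ g, f (fun i => κ i * g i * (κ i)⁻¹) ∂(Measure.pi fun _ => haarSU2) =
      ∫ g, f g ∂(Measure.pi fun _ => haarSU2) := by
  have hp : MeasurePreserving (fun (g : ι → SU2) i => κ i * g i * (κ i)⁻¹)
      (Measure.pi fun _ => haarSU2) (Measure.pi fun _ => haarSU2) :=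
    measurePreserving_pi (fun _ : ι => haarSU2) (fun _ => haarSU2)
      (f := fun i x => κ i * x * (κ i)⁻¹) fun i =>
        (measurePreserving_mul_right haarSU2 (κ i)⁻¹).comp (measurePreserving_mul_left haarSU2 (κ i))
  have h := integral_map (μ := Measure.pi fun _ : ι => haarSU2) (f := f)
    hp.measurable.aemeasurable hf.aestronglyMeasurable
  rw [hp.map_eq] at h
  exact h.symm

theorem prod_ofFn_conj {G : Type*} [Group G] {m : ℕ} (a : G) (x : Fin m → G) :
    (List.ofFn fun i => a * x i * a⁻¹).prod = a * (List.ofFn x).prod * a⁻¹ := by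
  have := prod_ofFn_telescope (fun _ => a⁻¹) m x
  simpa using this

/-- The product of the elements of `C` from position `i` on. -/
def suffixProd (C : Fin n → SU2) (i : ℕ) : SU2 := ((List.ofFn C).drop i).prod

theorem suffixProd_eq_mul (C : Fin n → SU2) (p : Fin n) :
    suffixProd C p = C p * suffixProd C (p + 1) := by
  rw [suffixProd, suffixProd, List.drop_eq_getElem_cons (by simp), List.prod_cons]
  simp

theorem suffixProd_zero (C : Fin n → SU2) : suffixProd C 0 = (List.ofFn C).prod := rfl

theorem suffixProd_self (C : Fin n → SU2) : suffixProd C n = 1 := by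
  rw [suffixProd, List.drop_eq_nil_of_le (by simp), List.prod_nil]

/-- The elements by which the variables of the dual edges are to be conjugated in order to collect
the elements of `C` on the left of `southHolonomy C`. -/
def collector (C : Fin n → SU2) : DualEdge n → SU2
  | .cross (.meridian p false) 1 => suffixProd C p
  | .cross (.meridian p false) 2 => suffixProd C (p + 1)
  | .cross (.equator p) 2 => suffixProd C (p + 1)
  | .cross (.meridian _ true) _ => suffixProd C 1
  | _ => 1

/-- Conjugating the small variables collects the particle holonomies in front. -/
theorem southHolonomy_collector (C : Fin n → SU2) (g : DualEdge n → SU2) :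
    southHolonomy C (fun e => collector C e * g e * (collector C e)⁻¹) =
      (List.ofFn C).prod * southHolonomy (fun _ => 1) g := by
  set g' : DualEdge n → SU2 := fun e => collector C e * g e * (collector C e)⁻¹ with hg'
  have hν : ∀ p, lowerCross (shiftPole g') (.meridian p true) = suffixProd C (p + 1) *
      lowerCross (shiftPole g) (.meridian p true) * (suffixProd C (p + 1))⁻¹ := by
    intro p
    by_cases hp : p = 0
    · subst hp
      simp only [lowerCross, if_true, shiftPole, hg', collector, prod_ofFn_conj]
      simp
      group
    · simp [lowerCross, hp]
  have h := prod_ofFn_telescope (fun i => (suffixProd C i)⁻¹) n fun p =>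
    g (.cross (.meridian p false) 1) * 1 *
    (lowerCross (shiftPole g) (.meridian p true) * (g (.cross (.equator p) 2))⁻¹ *
      g (.cross (.meridian p false) 2))
  simp only [inv_inv, suffixProd_zero, suffixProd_self, inv_one, mul_one] at h
  rw [southHolonomy, southHolonomy]
  simp only [mul_one] at h ⊢
  rw [← h]
  congr 2
  ext1 p
  rw [hν]
  simp only [hg', collector]
  have := suffixProd_eq_mul C p
  rw [this]
  group

theorem southHolonomy_conj (a : SU2) (g : DualEdge n → SU2) :
    southHolonomy (fun _ => 1) (fun e => a * g e * a⁻¹) =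
      a * southHolonomy (fun _ => 1) g * a⁻¹ := by
  rw [southHolonomy, southHolonomy, ← prod_ofFn_conj]
  congr 2
  ext1 p
  by_cases hp : p = 0
  · subst hp
    simp only [lowerCross, if_true, shiftPole, prod_ofFn_conj]
    group
  · simp only [lowerCross, if_neg hp]
    group

theorem Continuous.southHolonomy {X : Type*} [TopologicalSpace X] {C : X → Fin n → SU2}
    {g : X → DualEdge n → SU2} (hC : Continuous C) (hg : Continuous g) :
    Continuous fun x => _root_.southHolonomy (C x) (g x) := by
  have hge : ∀ e, Continuous fun x => g x e := fun e => (continuous_apply e).comp hg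
  have hs : Continuous fun x => shiftPole (g x) := continuous_shiftPole.comp hg
  have hl : ∀ e, Continuous fun x => lowerCross (shiftPole (g x)) e := fun e =>
    (continuous_lowerCross e).comp hs
  refine continuous_prod_ofFn fun p => ?_
  exact ((hge _).mul ((continuous_apply p).comp hC)).mul (((hl _).mul (hge _).inv).mul (hge _))

/-- A connection made trivial along the spanning tree. -/
def trivialize (g : DualEdge n → SU2) : DualEdge n → SU2 := fun e => if IsRadial e then 1 else g e

theorem trivialize_cross_of_ne {k : Fin 4} (hk : k ≠ 1) (g : DualEdge n → SU2) (e : SurfEdge n) :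
    trivialize g (.cross e k) = g (.cross e k) := by
  rcases e with ⟨p, s⟩ | p <;> simp [trivialize, IsRadial, hk]

theorem trivialize_southern (g : DualEdge n → SU2) (p : Fin n) :
    trivialize g (.cross (.meridian p false) 1) = g (.cross (.meridian p false) 1) := by
  simp [trivialize, IsRadial]

theorem lowerCross_shiftPole_trivialize (g : DualEdge n → SU2) (p : Fin n) :
    lowerCross (shiftPole (trivialize g)) (.meridian p true) =
      lowerCross (shiftPole g) (.meridian p true) := by
  by_cases hp : p = 0
  · subst hp
    have : trivialize g (.cross (.meridian 0 true) 1) = g (.cross (.meridian 0 true) 1) := by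
      simp [trivialize, IsRadial]
    simp only [lowerCross, if_true, shiftPole, this, trivialize_cross_of_ne (k := 2) (by decide)]
  · simp [lowerCross, hp]

theorem southHolonomy_trivialize (C : Fin n → SU2) (g : DualEdge n → SU2) :
    southHolonomy C (trivialize g) = southHolonomy C g := by
  simp only [southHolonomy, lowerCross_shiftPole_trivialize, trivialize_southern,
    trivialize_cross_of_ne (k := 2) (by decide)]

theorem lowerCross_shiftParticle_north (C : Fin n → SU2) (g : DualEdge n → SU2) (p : Fin n) :
    lowerCross (shiftParticle C g) (.meridian p true) = lowerCross g (.meridian p true) := rfl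

theorem lowerCross_solve_trivialize (C : Fin n → SU2) (g : DualEdge n → SU2) (e : SurfEdge n) :
    lowerCross (shiftParticle C (shiftPole (trivialize g))) e =
      lowerCross (shiftParticle C (shiftPole g)) e := by
  rcases e with ⟨p, _ | _⟩ | p
  · change trivialize g (.cross (.meridian p false) 1) *
        (C p * lowerCross (shiftPole (trivialize g)) (.meridian p true) *
          (trivialize g (.cross (.equator p) 2))⁻¹) =
      g (.cross (.meridian p false) 1) * (C p * lowerCross (shiftPole g) (.meridian p true) *
        (g (.cross (.equator p) 2))⁻¹)
    rw [lowerCross_shiftPole_trivialize, trivialize_southern,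
      trivialize_cross_of_ne (k := 2) (by decide)]
  · exact Eq.trans (lowerCross_shiftParticle_north C (shiftPole (trivialize g)) p)
      (Eq.trans (lowerCross_shiftPole_trivialize g p)
        (lowerCross_shiftParticle_north C (shiftPole g) p).symm)
  · simp only [lowerCross]

theorem initialConnection_solveConstraints (C : Fin n → SU2) (g : DualEdge n → SU2)
    (e : SurfEdge n) : initialConnection (solveConstraints C g) e =
      lowerCross (shiftParticle C (shiftPole g)) e * g (.cross e 0) := by
  rcases e with ⟨p, _ | _⟩ | p <;> rfl

theorem finalConnection_solveConstraints (C : Fin n → SU2) (g : DualEdge n → SU2)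
    (e : SurfEdge n) : finalConnection (solveConstraints C g) e =
      lowerCross (shiftParticle C (shiftPole g)) e * g (.cross e 2) * g (.cross e 3) := by
  rcases e with ⟨p, _ | _⟩ | p <;> rfl

/-- If the small variables are `1`, the substitutions produce the gauge fixed connection with
holonomies `C` around the particles. -/
theorem lowerCross_solve_one (C : Fin n → SU2) (e : SurfEdge n) :
    lowerCross (shiftParticle C (shiftPole fun _ => 1)) e = gaugeFixedConnection C e := by
  have h : ∀ p, lowerCross (shiftPole (n := n) fun _ => 1) (.meridian p true) = 1 := by
    intro p
    by_cases hp : p = 0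
    · simp [lowerCross, shiftPole]
    · simp [lowerCross, hp]
  rcases e with ⟨p, _ | _⟩ | p
  · change 1 * (C p * lowerCross (shiftPole (n := n) fun _ => 1) (.meridian p true) * 1⁻¹) = C p
    rw [h]; simp
  · rw [lowerCross_shiftParticle_north]; exact h p
  · rfl

/-- The boundary states as a function of the holonomies of the particles and of the remaining
variables. -/
def boundaryValue (Φf Φi : (SurfEdge n → SU2) → ℂ) (g : DualEdge n → SU2) (C : Fin n → SU2) : ℂ :=
  starRingEnd ℂ (Φf (finalConnection (solveConstraints C g))) *
    Φi (initialConnection (solveConstraints C g))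

/-- The boundary states do not see the variables of the spanning tree, which are not concentrated
at `1`. -/
theorem boundaryValue_trivialize (Φf Φi : (SurfEdge n → SU2) → ℂ) (g : DualEdge n → SU2)
    (C : Fin n → SU2) : boundaryValue Φf Φi (trivialize g) C = boundaryValue Φf Φi g C := by
  have h1 : finalConnection (solveConstraints C (trivialize g)) =
      finalConnection (solveConstraints C g) := by
    ext1 e
    rw [finalConnection_solveConstraints, finalConnection_solveConstraints,
      lowerCross_solve_trivialize, trivialize_cross_of_ne (by decide),
      trivialize_cross_of_ne (by decide)]
  have h2 : initialConnection (solveConstraints C (trivialize g)) =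
      initialConnection (solveConstraints C g) := by
    ext1 e
    rw [initialConnection_solveConstraints, initialConnection_solveConstraints,
      lowerCross_solve_trivialize, trivialize_cross_of_ne (by decide)]
  rw [boundaryValue, boundaryValue, h1, h2]

theorem boundaryValue_one (Φf Φi : (SurfEdge n → SU2) → ℂ) (C : Fin n → SU2) :
    boundaryValue Φf Φi (fun _ => 1) C =
      starRingEnd ℂ (Φf (gaugeFixedConnection C)) * Φi (gaugeFixedConnection C) := by
  have h1 : finalConnection (solveConstraints C fun _ => 1) = gaugeFixedConnection C := by
    ext1 e
    rw [finalConnection_solveConstraints, lowerCross_solve_one, mul_one, mul_one]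
  have h2 : initialConnection (solveConstraints C fun _ => 1) = gaugeFixedConnection C := by
    ext1 e
    rw [initialConnection_solveConstraints, lowerCross_solve_one, mul_one]
  rw [boundaryValue, h1, h2]

theorem Continuous.boundaryValue {X : Type*} [TopologicalSpace X] {C : X → Fin n → SU2}
    {g : X → DualEdge n → SU2} {Φf Φi : (SurfEdge n → SU2) → ℂ} (hf : Continuous Φf)
    (hi : Continuous Φi) (hg : Continuous g) (hC : Continuous C) :
    Continuous fun x => _root_.boundaryValue Φf Φi (g x) (C x) := by
  have hx : ∀ e, Continuous fun x => _root_.solveConstraints (C x) (g x) e := fun e =>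
    (continuous_apply e).comp (hC.solveConstraints hg)
  exact (Complex.continuous_conj.comp (hf.comp (continuous_pi fun e => hx _))).mul
    (hi.comp (continuous_pi fun e => hx _))

end ConjugationInvariance

end

/-! ### The limit of the regularized amplitude -/

section

variable {n : ℕ} [NeZero n]

section AmplitudeLimit

theorem edgeWeight_nonneg {φ : DualFace n → SU2 → ℝ} (hφ : ∀ f x, 0 ≤ φ f x) (e : DualEdge n)
    (x : SU2) : 0 ≤ edgeWeight φ e x := by
  unfold edgeWeight
  split <;> first | exact hφ _ _ | exact zero_le_one | skip
  split_ifs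
  · exact hφ _ _
  · exact zero_le_one

theorem continuous_edgeWeight {φ : DualFace n → SU2 → ℝ} (hφ : ∀ f, Continuous (φ f))
    (e : DualEdge n) : Continuous (edgeWeight φ e) := by
  rcases e with ⟨t, k⟩ | ⟨e, k⟩
  · exact continuous_const
  · fin_cases k
    · rcases e with _ | _ <;> exact hφ _
    · rcases e with ⟨p, _ | _⟩ | p
      · exact hφ _
      · by_cases hp : p = 0
        · have : edgeWeight φ (.cross (.meridian p true) 1) = φ (.pole true) :=
            funext fun x => if_pos hp
          exact this ▸ hφ _
        · have : edgeWeight φ (.cross (.meridian p true) 1) = fun _ => 1 :=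
            funext fun x => if_neg hp
          exact this ▸ continuous_const
      · exact continuous_const
    · rcases e with _ | _ <;> exact (hφ _).comp continuous_inv
    · rcases e with _ | _ <;> exact (hφ _).comp continuous_inv

/-- The weight of a dual edge is constant for the edges of the spanning tree, and one of the
given class functions otherwise. -/
theorem edgeWeight_cases {φ : DualFace n → SU2 → ℝ} (hφ : ∀ f x g, φ f (x * g * x⁻¹) = φ f g)
    (e : DualEdge n) :
    (IsRadial e ∧ edgeWeight φ e = fun _ => 1) ∨ ∃ f, edgeWeight φ e = φ f := by
  rcases e with ⟨t, k⟩ | ⟨e, k⟩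
  · exact Or.inl ⟨trivial, rfl⟩
  · fin_cases k
    · rcases e with _ | _ <;> exact Or.inr ⟨_, rfl⟩
    · rcases e with ⟨p, _ | _⟩ | p
      · exact Or.inr ⟨_, rfl⟩
      · by_cases hp : p = 0
        · exact Or.inr ⟨.pole true, funext fun x => if_pos hp⟩
        · exact Or.inl ⟨⟨rfl, rfl, hp⟩, funext fun x => if_neg hp⟩
      · exact Or.inl ⟨rfl, rfl⟩
    · rcases e with _ | _ <;>
        exact Or.inr ⟨.quad _ 1, funext fun x => SU2.classFunction_inv (hφ (.quad _ 1)) x⟩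
    · rcases e with _ | _ <;>
        exact Or.inr ⟨.quad _ 2, funext fun x => SU2.classFunction_inv (hφ (.quad _ 2)) x⟩

variable {φ : DualFace n → ℕ → SU2 → ℝ} (hφ : ∀ f, IsDeltaSequence (φ f))

/-- The joint density of the variables which remain after the constraints are solved. -/
def connectionWeight (φ : DualFace n → ℕ → SU2 → ℝ) (k : ℕ) (g : DualEdge n → SU2) : ℝ :=
  ∏ e, edgeWeight (fun f => φ f k) e (g e)

include hφ

theorem connectionWeight_nonneg (k : ℕ) (g : DualEdge n → SU2) : 0 ≤ connectionWeight φ k g :=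
  Finset.prod_nonneg fun e _ => edgeWeight_nonneg (fun f => (hφ f).nonneg k) e _

theorem continuous_connectionWeight (k : ℕ) : Continuous (connectionWeight φ k) :=
  continuous_finsetProd _ fun e _ =>
    (continuous_edgeWeight (fun f => (hφ f).continuous k) e).comp (continuous_apply e)

theorem connectionWeight_conj (k : ℕ) (κ g : DualEdge n → SU2) :
    connectionWeight φ k (fun e => κ e * g e * (κ e)⁻¹) = connectionWeight φ k g := by
  refine Finset.prod_congr rfl fun e _ => ?_
  rcases edgeWeight_cases (φ := fun f => φ f k) (fun f => (hφ f).conj_invariant k) e with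
    ⟨_, h⟩ | ⟨f, h⟩
  · rw [h]
  · rw [h, (hφ f).conj_invariant k]

theorem integral_connectionWeight (k : ℕ) :
    ∫ g, connectionWeight φ k g ∂(Measure.pi fun _ => haarSU2) = 1 := by
  unfold connectionWeight
  rw [integral_fintype_prod_eq_prod]
  refine Finset.prod_eq_one fun e _ => ?_
  rcases edgeWeight_cases (φ := fun f => φ f k) (fun f => (hφ f).conj_invariant k) e with
    ⟨_, h⟩ | ⟨f, h⟩
  · rw [h]; simp
  · rw [h, (hφ f).integral_eq_one k]

/-- The variables off the spanning tree are concentrated at `1`. -/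
theorem eventually_trivialize_mem {U : Set (DualEdge n → SU2)} (hU : U ∈ 𝓝 fun _ => 1) :
    ∀ᶠ k in atTop, ∀ g, connectionWeight φ k g ≠ 0 → trivialize g ∈ U := by
  rw [nhds_pi, Filter.mem_pi] at hU
  obtain ⟨I, hI, t, ht, hsub⟩ := hU
  have h : ∀ᶠ k in atTop, ∀ f : DualFace n, ∀ e : DualEdge n,
      Function.support (φ f k) ⊆ t e := by
    simp only [eventually_all]
    exact fun f e => (hφ f).support_shrinks _ (ht e)
  filter_upwards [h] with k hk g hg
  apply hsub
  intro e _
  by_cases he : IsRadial e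
  · rw [trivialize, if_pos he]; exact mem_of_mem_nhds (ht e)
  · rw [trivialize, if_neg he]
    have h1 : edgeWeight (fun f => φ f k) e (g e) ≠ 0 := fun h => hg (Finset.prod_eq_zero (Finset.mem_univ e) h)
    rcases edgeWeight_cases (φ := fun f => φ f k) (fun f => (hφ f).conj_invariant k) e with
      ⟨h, _⟩ | ⟨f, h⟩
    · exact absurd h he
    · rw [h] at h1
      exact hk f e h1

omit hφ in
/-- The delta function of the south pole smeared with all other delta functions. -/
def smearedDelta (φ : DualFace n → ℕ → SU2 → ℝ) (k : ℕ) (x : SU2) : ℝ :=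
  ∫ g, connectionWeight φ k g * φ (.pole false) k (x * southHolonomy (fun _ => 1) g)
    ∂(Measure.pi fun _ => haarSU2)

theorem continuous_smear (k : ℕ) : Continuous fun y : SU2 × (DualEdge n → SU2) =>
    connectionWeight φ k y.2 * φ (.pole false) k (y.1 * southHolonomy (fun _ => 1) y.2) := by
  have h : Continuous fun y : SU2 × (DualEdge n → SU2) => southHolonomy (fun _ => 1) y.2 :=
    continuous_const.southHolonomy continuous_snd
  exact ((continuous_connectionWeight hφ k).comp continuous_snd).mul
    (((hφ _).continuous k).comp (continuous_fst.mul h))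

theorem isDeltaSequence_smearedDelta : IsDeltaSequence (smearedDelta φ) where
  continuous k := continuous_integral_of_compactSpace (continuous_smear hφ k)
  nonneg k x := integral_nonneg fun g =>
    mul_nonneg (connectionWeight_nonneg hφ k g) ((hφ _).nonneg k _)
  conj_invariant k y x := by
    have h := integral_pi_conj ((continuous_smear hφ k).comp (Continuous.prodMk_right (y * x * y⁻¹)))
      (fun _ => y)
    simp only [Function.comp_apply, connectionWeight_conj hφ k, southHolonomy_conj] at h
    rw [smearedDelta, ← h, smearedDelta]
    congr 1
    ext g
    congr 1
    rw [← (hφ _).conj_invariant k y (x * _)]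
    congr 1
    group
  integral_eq_one k := by
    have hc := continuous_smear hφ k
    unfold smearedDelta
    rw [integral_integral_swap hc.integrable_of_compactSpace]
    simp only [integral_const_mul]
    have h : ∀ g : DualEdge n → SU2,
        ∫ x, φ (.pole false) k (x * southHolonomy (fun _ => 1) g) ∂haarSU2 = 1 := fun g => by
      rw [integral_mul_right_eq_self (φ (.pole false) k), (hφ _).integral_eq_one k]
    simp only [h, mul_one]
    exact integral_connectionWeight hφ k
  support_shrinks U hU := by
    have hE : Continuous fun g : DualEdge n → SU2 => southHolonomy (fun _ => 1) g :=
      continuous_const.southHolonomy continuous_id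
    have hE1 : southHolonomy (n := n) (fun _ => 1) (fun _ => 1) = 1 := by
      have h := southHolonomy_conj (n := n) 1 fun _ => 1
      have h2 : ∀ p, lowerCross (shiftPole (n := n) fun _ => 1) (.meridian p true) = 1 := by
        intro p
        by_cases hp : p = 0
        · simp [lowerCross, shiftPole]
        · simp [lowerCross, hp]
      simp [southHolonomy, h2]
    have hcont : Continuous fun y : SU2 × (DualEdge n → SU2) =>
        y.1 * (southHolonomy (fun _ => 1) y.2)⁻¹ :=
      continuous_fst.mul (hE.comp continuous_snd).inv
    have hU' : (fun y : SU2 × (DualEdge n → SU2) => y.1 * (southHolonomy (fun _ => 1) y.2)⁻¹) ⁻¹' U ∈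
        𝓝 ((1 : SU2), fun _ : DualEdge n => (1 : SU2)) := by
      apply hcont.continuousAt.preimage_mem_nhds
      simpa [hE1] using hU
    rw [nhds_prod_eq, mem_prod_iff] at hU'
    obtain ⟨V, hV, W, hW, hVW⟩ := hU'
    filter_upwards [(hφ (.pole false)).support_shrinks V hV, eventually_trivialize_mem hφ hW]
      with k hk1 hk2 x hx
    by_contra hxU
    apply hx
    rw [smearedDelta]
    apply integral_eq_zero_of_ae
    refine Eventually.of_forall fun g => ?_
    by_contra hne
    have h1 := left_ne_zero_of_mul hne
    have h2 := hk1 (right_ne_zero_of_mul hne)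
    have h3 := hVW (Set.mk_mem_prod h2 (hk2 g h1))
    simp only [Set.mem_preimage, southHolonomy_trivialize] at h3
    exact hxU (by simpa using h3)

/-- The smeared delta function gives the integral over the remaining variables. -/
theorem integral_connectionWeight_mul (k : ℕ) (C : Fin n → SU2) :
    ∫ g, connectionWeight φ k g * φ (.pole false) k (southHolonomy C g)
      ∂(Measure.pi fun _ => haarSU2) = smearedDelta φ k (List.ofFn C).prod := by
  have h2 : Continuous fun g => southHolonomy C g :=
    continuous_const.southHolonomy continuous_id
  have hc : Continuous fun g => connectionWeight φ k g * φ (.pole false) k (southHolonomy C g) :=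
    (continuous_connectionWeight hφ k).mul (((hφ _).continuous k).comp h2)
  rw [← integral_pi_conj hc (collector C), smearedDelta]
  simp only [connectionWeight_conj hφ k, southHolonomy_collector]

omit hφ in
theorem continuous_conjugates (θ : Fin n → ℝ) :
    Continuous fun (u : Fin n → SU2) p => u p * torusElt (θ p) * (u p)⁻¹ :=
  continuous_pi fun p => (SU2.continuous_conj_torusElt (θ p)).comp (continuous_apply p)

theorem integral_fixedIntegrand (θ : Fin n → ℝ) {Φf Φi : (SurfEdge n → SU2) → ℂ}
    (hfc : Continuous Φf) (hic : Continuous Φi) (k : ℕ) (u : Fin n → SU2) :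
    ∫ g, fixedIntegrand θ Φf Φi (fun f => φ f k) u g ∂(Measure.pi fun _ => haarSU2) =
      ∫ g, ((connectionWeight φ k g * φ (.pole false) k
          (southHolonomy (fun p => u p * torusElt (θ p) * (u p)⁻¹) g) : ℝ) : ℂ) *
        boundaryValue Φf Φi g (fun p => u p * torusElt (θ p) * (u p)⁻¹)
        ∂(Measure.pi fun _ => haarSU2) := by
  have hu : Continuous fun g => fixedIntegrand θ Φf Φi (fun f => φ f k) u g :=
    hfc.fixedIntegrand θ hic (fun f => (hφ f).continuous k) continuous_const continuous_id
  have h1 := integral_comp_solveConstraints (fun p => u p * torusElt (θ p) * (u p)⁻¹) hu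
  simp only [fixedIntegrand_solveConstraints] at h1
  exact h1.symm

/-- The amplitude with gauge fixing along `IsRadial` and with the constraints solved. -/
theorem regularizedAmplitude_eq_solved {T : Finset (DualEdge n)} (hT : IsMaximalDualTree T)
    (θ : Fin n → ℝ) {Φf Φi : (SurfEdge n → SU2) → ℂ}
    (hf : ∀ k g, Φf (gaugeTransform k g) = Φf g) (hi : ∀ k g, Φi (gaugeTransform k g) = Φi g)
    (hfc : Continuous Φf) (hic : Continuous Φi) (k : ℕ) :
    regularizedAmplitude θ T Φf Φi (fun f => φ f k) =
      ∫ u : Fin n → SU2, ∫ g,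
        ((connectionWeight φ k g * φ (.pole false) k
          (southHolonomy (fun p => u p * torusElt (θ p) * (u p)⁻¹) g) : ℝ) : ℂ) *
        boundaryValue Φf Φi g (fun p => u p * torusElt (θ p) * (u p)⁻¹)
        ∂(Measure.pi fun _ => haarSU2) ∂(Measure.pi fun _ => haarSU2) := by
  have hφc : ∀ f, Continuous (φ f k) := fun f => (hφ f).continuous k
  have hφk : ∀ f x g, φ f k (x * g * x⁻¹) = φ f k g := fun f => (hφ f).conj_invariant k
  have hamp := continuous_amplitudeIntegrand θ hfc hic (φ := fun f => φ f k) hφc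
  rw [regularizedAmplitude_eq_integral hT θ hf hi hfc hic hφk hφc,
    integral_eq_integral_trivialized (T := Finset.univ.filter IsRadial) (fun g => by
      obtain ⟨κ, hκ⟩ := exists_potential_isRadial g
      exact ⟨κ, fun e he => hκ e (Finset.mem_filter.mp he).2⟩) hamp
      (amplitudeIntegrand_dualGauge θ hf hi hφk)]
  simp only [Finset.mem_filter, Finset.mem_univ, true_and, amplitudeIntegrand_radial]
  have hswap : Integrable (Function.uncurry fun (g : DualEdge n → SU2) (u : Fin n → SU2) =>
      fixedIntegrand θ Φf Φi (fun f => φ f k) u g)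
      ((Measure.pi fun _ => haarSU2).prod (Measure.pi fun _ => haarSU2)) :=
    (hfc.fixedIntegrand θ hic hφc continuous_snd continuous_fst).integrable_of_compactSpace
  rw [integral_integral_swap hswap]
  congr 1
  ext u
  exact integral_fixedIntegrand hφ θ hfc hic k u

/-- The regularized amplitudes converge to the limit of the reduced integrals. -/
theorem tendsto_regularizedAmplitude {T : Finset (DualEdge n)} (hT : IsMaximalDualTree T)
    (θ : Fin n → ℝ) {Φf Φi : (SurfEdge n → SU2) → ℂ}
    (hf : ∀ k g, Φf (gaugeTransform k g) = Φf g) (hi : ∀ k g, Φi (gaugeTransform k g) = Φi g)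
    (hfc : Continuous Φf) (hic : Continuous Φi) {A B : ℂ}
    (hA : ∀ ψ, IsDeltaSequence ψ → Tendsto (fun k => reducedIntegral θ (fun C =>
      starRingEnd ℂ (Φf (gaugeFixedConnection C)) * Φi (gaugeFixedConnection C)) (ψ k))
      atTop (𝓝 A))
    (hB : ∀ ψ, IsDeltaSequence ψ → Tendsto (fun k => reducedIntegral θ (fun _ => 1) (ψ k))
      atTop (𝓝 B)) :
    Tendsto (fun k => regularizedAmplitude θ T Φf Φi fun f => φ f k) atTop (𝓝 A) := by
  set Ψ := smearedDelta φ with hΨ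
  have hΨd : IsDeltaSequence Ψ := isDeltaSequence_smearedDelta hφ
  let C : (Fin n → SU2) → Fin n → SU2 := fun u p => u p * torusElt (θ p) * (u p)⁻¹
  have hC : Continuous C := continuous_conjugates θ
  have hP : Continuous fun u => (List.ofFn (C u)).prod :=
    continuous_prod_ofFn fun p => (continuous_apply p).comp hC
  -- the total mass of the smeared delta function, which stays bounded
  set M : ℕ → ℝ := fun k => ∫ u, Ψ k (List.ofFn (C u)).prod ∂(Measure.pi fun _ => haarSU2) with hM
  have hMB : ∀ᶠ k in atTop, M k < ‖B‖ + 1 := by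
    have h := (hB Ψ hΨd).norm.eventually (gt_mem_nhds (lt_add_one ‖B‖))
    filter_upwards [h] with k hk
    refine lt_of_le_of_lt (le_abs_self _) ?_
    rw [reducedIntegral] at hk
    simp only [one_mul] at hk
    rw [integral_complex_ofReal, Complex.norm_real] at hk
    exact hk
  rw [← sub_zero A]
  have key : Tendsto (fun k => reducedIntegral θ (fun C =>
      starRingEnd ℂ (Φf (gaugeFixedConnection C)) * Φi (gaugeFixedConnection C)) (Ψ k) -
      regularizedAmplitude θ T Φf Φi fun f => φ f k) atTop (𝓝 0) := by
    rw [Metric.tendsto_atTop']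
    intro ε hε
    have hε' : 0 < ε / (‖B‖ + 1) := by positivity
    have hnear := eventually_forall_norm_sub_lt (fun (y : DualEdge n → SU2) (u : Fin n → SU2) =>
      boundaryValue Φf Φi y (C u))
      (hfc.boundaryValue hic continuous_fst (hC.comp continuous_snd)) (fun _ => 1) hε'
    obtain ⟨N, hN⟩ := eventually_atTop.mp ((eventually_trivialize_mem hφ hnear).and hMB)
    refine ⟨N, fun k hk => ?_⟩
    obtain ⟨h1, h2⟩ := hN k hk.le
    set w : (Fin n → SU2) → (DualEdge n → SU2) → ℝ := fun u g =>
      connectionWeight φ k g * φ (.pole false) k (southHolonomy (C u) g) with hw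
    have hwc : Continuous fun x : (Fin n → SU2) × (DualEdge n → SU2) => w x.1 x.2 := by
      have : Continuous fun x : (Fin n → SU2) × (DualEdge n → SU2) => southHolonomy (C x.1) x.2 :=
        (hC.comp continuous_fst).southHolonomy continuous_snd
      exact ((continuous_connectionWeight hφ k).comp continuous_snd).mul
        (((hφ _).continuous k).comp this)
    have hwu : ∀ u, Continuous (w u) := fun u => hwc.comp (Continuous.prodMk_right u)
    have hw0 : ∀ u g, 0 ≤ w u g := fun u g =>
      mul_nonneg (connectionWeight_nonneg hφ k g) ((hφ _).nonneg k _)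
    have hwint : ∀ u, ∫ g, w u g ∂(Measure.pi fun _ => haarSU2) = Ψ k (List.ofFn (C u)).prod :=
      fun u => integral_connectionWeight_mul hφ k (C u)
    have hb2 : Continuous fun x : (Fin n → SU2) × (DualEdge n → SU2) =>
        ((w x.1 x.2 : ℝ) : ℂ) * boundaryValue Φf Φi x.2 (C x.1) :=
      (Complex.continuous_ofReal.comp hwc).mul
        (hfc.boundaryValue hic continuous_snd (hC.comp continuous_fst))
    have hb1 : Continuous fun u : Fin n → SU2 => boundaryValue Φf Φi (fun _ => 1) (C u) :=
      hfc.boundaryValue hic continuous_const hC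
    have hb3 : Continuous fun x : (Fin n → SU2) × (DualEdge n → SU2) =>
        ((w x.1 x.2 : ℝ) : ℂ) * boundaryValue Φf Φi (fun _ => 1) (C x.1) :=
      (Complex.continuous_ofReal.comp hwc).mul (hb1.comp continuous_fst)
    have hred : reducedIntegral θ (fun C =>
        starRingEnd ℂ (Φf (gaugeFixedConnection C)) * Φi (gaugeFixedConnection C)) (Ψ k) =
        ∫ u, ∫ g, ((w u g : ℝ) : ℂ) * boundaryValue Φf Φi (fun _ => 1) (C u)
          ∂(Measure.pi fun _ => haarSU2) ∂(Measure.pi fun _ => haarSU2) := by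
      rw [reducedIntegral]
      congr 1
      ext u
      rw [integral_mul_const, integral_complex_ofReal, hwint, boundaryValue_one, mul_comm]
      rfl
    rw [dist_zero_right, hred, regularizedAmplitude_eq_solved hφ hT θ hf hi hfc hic, ← integral_sub
      (continuous_integral_of_compactSpace hb3).integrable_of_compactSpace
      (continuous_integral_of_compactSpace hb2).integrable_of_compactSpace]
    have hΨc : Continuous fun u => ε / (‖B‖ + 1) * Ψ k (List.ofFn (C u)).prod :=
      continuous_const.mul ((hΨd.continuous k).comp hP)
    calc _ ≤ ∫ u, ε / (‖B‖ + 1) * Ψ k (List.ofFn (C u)).prod ∂(Measure.pi fun _ => haarSU2) := by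
          refine norm_integral_le_of_norm_le hΨc.integrable_of_compactSpace
            (Eventually.of_forall fun u => ?_)
          have hi3 : Integrable (fun g : DualEdge n → SU2 => ((w u g : ℝ) : ℂ) *
              boundaryValue Φf Φi (fun _ => 1) (C u)) (Measure.pi fun _ => haarSU2) :=
            (hb3.comp (Continuous.prodMk_right u)).integrable_of_compactSpace
          have hi2 : Integrable (fun g : DualEdge n → SU2 => ((w u g : ℝ) : ℂ) *
              boundaryValue Φf Φi g (C u)) (Measure.pi fun _ => haarSU2) :=
            (hb2.comp (Continuous.prodMk_right u)).integrable_of_compactSpace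
          change ‖(∫ g, ((w u g : ℝ) : ℂ) * boundaryValue Φf Φi (fun _ => 1) (C u)
            ∂(Measure.pi fun _ => haarSU2)) - ∫ g, ((w u g : ℝ) : ℂ) * boundaryValue Φf Φi g (C u)
            ∂(Measure.pi fun _ => haarSU2)‖ ≤ _
          rw [← integral_sub hi3 hi2, ← hwint, ← integral_const_mul]
          refine norm_integral_le_of_norm_le
            (continuous_const.mul (hwu u)).integrable_of_compactSpace
            (Eventually.of_forall fun g => ?_)
          rw [← mul_sub, norm_mul, Complex.norm_real, Real.norm_of_nonneg (hw0 u g), mul_comm]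
          by_cases hg : connectionWeight φ k g = 0
          · have : w u g = 0 := by rw [hw]; simp [hg]
            rw [this]; simp
          · refine mul_le_mul_of_nonneg_right ?_ (hw0 u g)
            have := h1 g hg u
            rw [norm_sub_rev, ← boundaryValue_trivialize Φf Φi g]
            exact this.le
      _ = ε / (‖B‖ + 1) * M k := by rw [integral_const_mul]
      _ < ε / (‖B‖ + 1) * (‖B‖ + 1) := by gcongr
      _ = ε := by field_simp
  have := (hA Ψ hΨd).sub key
  simpa using this

end AmplitudeLimit

end

/-! ### The algebra of matrix elements -/

section

section WignerAlgebra

open Polynomial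

/-- The coefficient of `X ^ m` in `(g₀₀ X + g₁₀) ^ k * (g₀₁ X + g₁₁) ^ l`. -/
def monomialCoeff (k l m : ℕ) (g : SU2) : ℂ :=
  ((C (g.1 0 0) * X + C (g.1 1 0)) ^ k * (C (g.1 0 1) * X + C (g.1 1 1)) ^ l).coeff m

/-- The span of the matrix elements of the irreducible representations of `SU(2)`. -/
def wignerSpan : Submodule ℂ (SU2 → ℂ) :=
  Submodule.span ℂ {f | ∃ (d : ℕ) (m k : Fin (d + 1)), f = fun g => wigner d g m k}

theorem monomialCoeff_mem (k l m : ℕ) : monomialCoeff k l m ∈ wignerSpan := by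
  by_cases hm : m < k + l + 1
  · refine Submodule.subset_span ⟨k + l, ⟨m, hm⟩, ⟨k, by omega⟩, ?_⟩
    ext1 g
    simp [monomialCoeff, wigner]
  · have : monomialCoeff k l m = 0 := by
      ext1 g
      apply coeff_eq_zero_of_natDegree_lt
      refine lt_of_le_of_lt natDegree_mul_le ?_
      have h : ∀ (a b : ℂ) (j : ℕ), ((C a * X + C b) ^ j).natDegree ≤ j := fun a b j =>
        natDegree_pow_le_of_le j natDegree_linear_le |>.trans (by simp)
      have := h (g.1 0 0) (g.1 1 0) k
      have := h (g.1 0 1) (g.1 1 1) l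
      omega
    rw [this]; exact Submodule.zero_mem _

theorem SU2.det_entries (g : SU2) : g.1 0 0 * g.1 1 1 - g.1 0 1 * g.1 1 0 = 1 := by
  rw [← Matrix.det_fin_two]
  exact (Matrix.mem_specialUnitaryGroup_iff.mp g.2).2

/-- Multiplication by an entry in the first row comes from differentiating a product of powers of
the two linear forms and using that their determinant is `1`. -/
theorem entry_zero_zero_mul_monomialCoeff (k l m : ℕ) (g : SU2) :
    (k + l + 1 : ℂ) * (g.1 0 0 * monomialCoeff k l m g) =
      (m + 1) * monomialCoeff (k + 1) l (m + 1) g + l * monomialCoeff k (l - 1) m g := by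
  have hdet := SU2.det_entries g
  unfold monomialCoeff
  set a := g.1 0 0
  set b := g.1 1 0
  set c := g.1 0 1
  set e := g.1 1 1
  have hC : C a * C e - C c * C b = (1 : ℂ[X]) := by rw [← C_mul, ← C_mul, ← C_sub, hdet, C_1]
  have key : C (k + l + 1 : ℂ) * (C a * ((C a * X + C b) ^ k * (C c * X + C e) ^ l)) =
      derivative ((C a * X + C b) ^ (k + 1) * (C c * X + C e) ^ l) +
        C (l : ℂ) * ((C a * X + C b) ^ k * (C c * X + C e) ^ (l - 1)) := by
    rcases l with _ | l
    · simp [derivative_pow]; ring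
    · simp only [derivative_mul, derivative_pow, derivative_C, derivative_X,
        map_natCast, map_add, map_one, Nat.add_sub_cancel, Nat.cast_add, Nat.cast_one]
      linear_combination (((l : ℂ[X]) + 1) * (C a * X + C b) ^ k * (C c * X + C e) ^ l) * hC
  have := congrArg (fun P => P.coeff m) key
  simp only [coeff_add, coeff_C_mul, coeff_derivative] at this
  rw [this]
  ring

theorem entry_zero_one_mul_monomialCoeff (k l m : ℕ) (g : SU2) :
    (k + l + 1 : ℂ) * (g.1 0 1 * monomialCoeff k l m g) =
      (m + 1) * monomialCoeff k (l + 1) (m + 1) g - k * monomialCoeff (k - 1) l m g := by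
  have hdet := SU2.det_entries g
  unfold monomialCoeff
  set a := g.1 0 0
  set b := g.1 1 0
  set c := g.1 0 1
  set e := g.1 1 1
  have hC : C a * C e - C c * C b = (1 : ℂ[X]) := by rw [← C_mul, ← C_mul, ← C_sub, hdet, C_1]
  have key : C (k + l + 1 : ℂ) * (C c * ((C a * X + C b) ^ k * (C c * X + C e) ^ l)) =
      derivative ((C a * X + C b) ^ k * (C c * X + C e) ^ (l + 1)) -
        C (k : ℂ) * ((C a * X + C b) ^ (k - 1) * (C c * X + C e) ^ l) := by
    rcases k with _ | k
    · simp [derivative_pow]; ring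
    · simp only [derivative_mul, derivative_pow, derivative_C, derivative_X,
        map_natCast, map_add, map_one, Nat.add_sub_cancel, Nat.cast_add, Nat.cast_one]
      linear_combination (-(((k : ℂ[X]) + 1) * (C a * X + C b) ^ k * (C c * X + C e) ^ l)) * hC
  have := congrArg (fun P => P.coeff m) key
  simp only [coeff_sub, coeff_C_mul, coeff_derivative] at this
  rw [this]
  ring

/-- Multiplication by an entry in the second row reduces to that by the entry above it, by expanding
one more factor of the product. -/
theorem entry_one_mul_monomialCoeff (k l m : ℕ) (g : SU2) :
    g.1 1 0 * monomialCoeff k l m g = monomialCoeff (k + 1) l m g -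
      (if m = 0 then 0 else g.1 0 0 * monomialCoeff k l (m - 1) g) ∧
    g.1 1 1 * monomialCoeff k l m g = monomialCoeff k (l + 1) m g -
      (if m = 0 then 0 else g.1 0 1 * monomialCoeff k l (m - 1) g) := by
  have h : ∀ (a b : ℂ) (P : ℂ[X]), b * P.coeff m = ((C a * X + C b) * P).coeff m -
      (if m = 0 then 0 else a * P.coeff (m - 1)) := by
    intro a b P
    rcases m with _ | m
    · simp [add_mul, mul_assoc]
    · simp [add_mul, mul_assoc]
  constructor
  · rw [monomialCoeff, h (g.1 0 0), ← mul_assoc, ← pow_succ']; rfl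
  · rw [monomialCoeff, h (g.1 0 1), mul_left_comm, ← pow_succ']; rfl

/-- The special case of the Clebsch-Gordan decomposition in which one factor is the defining
representation. -/
theorem entry_mul_monomialCoeff_mem (i j : Fin 2) (k l m : ℕ) :
    (fun g : SU2 => g.1 i j * monomialCoeff k l m g) ∈ wignerSpan := by
  have h0 : (k + l + 1 : ℂ) ≠ 0 := by exact_mod_cast Nat.succ_ne_zero (k + l)
  have h00 : ∀ m, (fun g : SU2 => g.1 0 0 * monomialCoeff k l m g) ∈ wignerSpan := by
    intro m
    have : (fun g : SU2 => g.1 0 0 * monomialCoeff k l m g) = (k + l + 1 : ℂ)⁻¹ •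
        ((m + 1 : ℂ) • monomialCoeff (k + 1) l (m + 1) + (l : ℂ) • monomialCoeff k (l - 1) m) := by
      ext1 g
      simp only [Pi.smul_apply, Pi.add_apply, smul_eq_mul, ← entry_zero_zero_mul_monomialCoeff]
      rw [inv_mul_cancel_left₀ h0]
    rw [this]
    exact Submodule.smul_mem _ _ (Submodule.add_mem _ (Submodule.smul_mem _ _ (monomialCoeff_mem _ _ _))
      (Submodule.smul_mem _ _ (monomialCoeff_mem _ _ _)))
  have h01 : ∀ m, (fun g : SU2 => g.1 0 1 * monomialCoeff k l m g) ∈ wignerSpan := by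
    intro m
    have : (fun g : SU2 => g.1 0 1 * monomialCoeff k l m g) = (k + l + 1 : ℂ)⁻¹ •
        ((m + 1 : ℂ) • monomialCoeff k (l + 1) (m + 1) - (k : ℂ) • monomialCoeff (k - 1) l m) := by
      ext1 g
      simp only [Pi.smul_apply, Pi.sub_apply, smul_eq_mul, ← entry_zero_one_mul_monomialCoeff]
      rw [inv_mul_cancel_left₀ h0]
    rw [this]
    exact Submodule.smul_mem _ _ (Submodule.sub_mem _ (Submodule.smul_mem _ _ (monomialCoeff_mem _ _ _))
      (Submodule.smul_mem _ _ (monomialCoeff_mem _ _ _)))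
  fin_cases i <;> fin_cases j
  · exact h00 m
  · exact h01 m
  · have : (fun g : SU2 => g.1 1 0 * monomialCoeff k l m g) = monomialCoeff (k + 1) l m -
        (if m = 0 then 0 else fun g : SU2 => g.1 0 0 * monomialCoeff k l (m - 1) g) := by
      ext1 g
      rw [(entry_one_mul_monomialCoeff k l m g).1]
      split_ifs <;> rfl
    change (fun g : SU2 => g.1 1 0 * monomialCoeff k l m g) ∈ wignerSpan
    rw [this]
    refine Submodule.sub_mem _ (monomialCoeff_mem _ _ _) ?_
    split_ifs
    · exact Submodule.zero_mem _
    · exact h00 _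
  · have : (fun g : SU2 => g.1 1 1 * monomialCoeff k l m g) = monomialCoeff k (l + 1) m -
        (if m = 0 then 0 else fun g : SU2 => g.1 0 1 * monomialCoeff k l (m - 1) g) := by
      ext1 g
      rw [(entry_one_mul_monomialCoeff k l m g).2]
      split_ifs <;> rfl
    change (fun g : SU2 => g.1 1 1 * monomialCoeff k l m g) ∈ wignerSpan
    rw [this]
    refine Submodule.sub_mem _ (monomialCoeff_mem _ _ _) ?_
    split_ifs
    · exact Submodule.zero_mem _
    · exact h01 _

theorem continuous_monomialCoeff (k l m : ℕ) : Continuous (monomialCoeff k l m) := by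
  -- every coefficient of a product of polynomials with continuous coefficients is continuous
  have hmul : ∀ P Q : SU2 → ℂ[X], (∀ i, Continuous fun g => (P g).coeff i) →
      (∀ i, Continuous fun g => (Q g).coeff i) → ∀ i, Continuous fun g => (P g * Q g).coeff i := by
    intro P Q hP hQ i
    simp only [coeff_mul]
    exact continuous_finsetSum _ fun x _ => (hP _).mul (hQ _)
  have hpow : ∀ P : SU2 → ℂ[X], (∀ i, Continuous fun g => (P g).coeff i) →
      ∀ j i, Continuous fun g => (P g ^ j).coeff i := by
    intro P hP j
    induction j with
    | zero => intro i; simp only [pow_zero]; exact continuous_const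
    | succ j ih => simp only [pow_succ]; exact hmul _ _ ih hP
  have hlin : ∀ a b : SU2 → ℂ, Continuous a → Continuous b →
      ∀ i, Continuous fun g => (C (a g) * X + C (b g)).coeff i := by
    intro a b ha hb i
    rcases i with _ | _ | i
    · simpa using hb
    · simpa [coeff_C] using ha
    · simpa [coeff_C, coeff_X] using continuous_const
  exact hmul _ _ (hpow _ (hlin _ _ (SU2.continuous_entry 0 0) (SU2.continuous_entry 1 0)) k)
    (hpow _ (hlin _ _ (SU2.continuous_entry 0 1) (SU2.continuous_entry 1 1)) l) m

end WignerAlgebra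

section SpinNetworkSpace

variable {n : ℕ}

variable (n) in
/-- The span of the products over the edges of matrix elements of irreducible representations. -/
def edgeProductSpan : Submodule ℂ ((SurfEdge n → SU2) → ℂ) :=
  Submodule.span ℂ {F | ∃ (d : SurfEdge n → ℕ) (m k : ∀ e, Fin (d e + 1)),
    F = fun g => ∏ e, wigner (d e) (g e) (m e) (k e)}

theorem prod_mem_edgeProductSpan (f : SurfEdge n → SU2 → ℂ) (hf : ∀ e, f e ∈ wignerSpan) :
    (fun g : SurfEdge n → SU2 => ∏ e, f e (g e)) ∈ edgeProductSpan n := by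
  suffices h : ∀ (s : Finset (SurfEdge n)) (f : SurfEdge n → SU2 → ℂ), (∀ e, f e ∈ wignerSpan) →
      (∀ e ∉ s, ∃ (d : ℕ) (m k : Fin (d + 1)), f e = fun g => wigner d g m k) →
      (fun g : SurfEdge n → SU2 => ∏ e, f e (g e)) ∈ edgeProductSpan n from
    h Finset.univ f hf (by simp)
  intro s
  induction s using Finset.induction_on with
  | empty =>
    intro f _ h
    choose d m k h using fun e => h e (Finset.notMem_empty e)
    refine Submodule.subset_span ⟨d, m, k, ?_⟩
    ext1 g
    exact Finset.prod_congr rfl fun e _ => congrFun (h e) (g e)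
  | insert e₀ s _ ih =>
    intro f hf h
    -- the product is linear in the factor of the edge `e₀`
    let L : (SU2 → ℂ) →ₗ[ℂ] ((SurfEdge n → SU2) → ℂ) :=
      { toFun := fun a g => a (g e₀) * ∏ e ∈ Finset.univ.erase e₀, f e (g e)
        map_add' := fun a b => by ext1 g; simp [add_mul]
        map_smul' := fun c a => by ext1 g; simp [mul_assoc] }
    have hL : ∀ a, L a = fun g => ∏ e, Function.update f e₀ a e (g e) := by
      intro a
      ext1 g
      rw [← Finset.mul_prod_erase _ _ (Finset.mem_univ e₀), Function.update_self]
      refine congrArg (a (g e₀) * ·) (Finset.prod_congr rfl fun e he => ?_)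
      rw [Function.update_of_ne (Finset.ne_of_mem_erase he)]
    have hle : wignerSpan ≤ (edgeProductSpan n).comap L := by
      refine Submodule.span_le.mpr ?_
      rintro _ ⟨d, m, k, rfl⟩
      rw [SetLike.mem_coe, Submodule.mem_comap, hL]
      refine ih _ (fun e => ?_) fun e he => ?_
      · by_cases hee : e = e₀
        · subst hee; rw [Function.update_self]; exact Submodule.subset_span ⟨d, m, k, rfl⟩
        · rw [Function.update_of_ne hee]; exact hf e
      · by_cases hee : e = e₀
        · subst hee; rw [Function.update_self]; exact ⟨d, m, k, rfl⟩
        · rw [Function.update_of_ne hee]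
          exact h e fun hmem => (Finset.mem_insert.mp hmem).elim hee he
    have := hle (hf e₀)
    rw [Submodule.mem_comap, hL, Function.update_eq_self] at this
    exact this

theorem continuous_of_mem_edgeProductSpan {F : (SurfEdge n → SU2) → ℂ}
    (hF : F ∈ edgeProductSpan n) : Continuous F := by
  induction hF using Submodule.span_induction with
  | mem F h =>
    obtain ⟨d, m, k, rfl⟩ := h
    exact continuous_finsetProd _ fun e _ =>
      (continuous_monomialCoeff (k e) (d e - k e) (m e)).comp (continuous_apply e)
  | zero => exact continuous_const
  | add F G _ _ hF hG => exact hF.add hG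
  | smul c F _ hF => exact hF.const_smul c

variable (n) in
/-- The functions that multiply the span of products of matrix elements into itself. -/
def multiplierAlgebra : Subalgebra ℂ ((SurfEdge n → SU2) → ℂ) where
  carrier := {h | ∀ F ∈ edgeProductSpan n, h * F ∈ edgeProductSpan n}
  mul_mem' := fun {a b} ha hb F hF => by rw [mul_assoc]; exact ha _ (hb _ hF)
  add_mem' := fun {a b} ha hb F hF => by
    rw [add_mul]; exact Submodule.add_mem _ (ha _ hF) (hb _ hF)
  algebraMap_mem' := fun c F hF => by
    rw [← Algebra.smul_def]; exact Submodule.smul_mem _ c hF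

theorem mem_edgeProductSpan_of_mem_multiplierAlgebra {h : (SurfEdge n → SU2) → ℂ}
    (hh : h ∈ multiplierAlgebra n) : h ∈ edgeProductSpan n := by
  have h1 : (1 : (SurfEdge n → SU2) → ℂ) ∈ edgeProductSpan n := by
    refine Submodule.subset_span ⟨fun _ => 0, fun _ => 0, fun _ => 0, ?_⟩
    ext1 g
    simp [wigner]
  simpa using hh 1 h1

theorem entry_mem_multiplierAlgebra (e₀ : SurfEdge n) (i j : Fin 2) :
    (fun g : SurfEdge n → SU2 => (g e₀).1 i j) ∈ multiplierAlgebra n := by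
  intro F hF
  induction hF using Submodule.span_induction with
  | mem F h =>
    obtain ⟨d, m, k, rfl⟩ := h
    let f : SurfEdge n → SU2 → ℂ := fun e => monomialCoeff (k e) (d e - k e) (m e)
    have := prod_mem_edgeProductSpan
      (Function.update f e₀ fun g => g.1 i j * f e₀ g) fun e => by
        by_cases hee : e = e₀
        · subst hee; rw [Function.update_self]; exact entry_mul_monomialCoeff_mem _ _ _ _ _
        · rw [Function.update_of_ne hee]; exact monomialCoeff_mem _ _ _
    convert this using 1
    ext1 g
    rw [← Finset.mul_prod_erase _ _ (Finset.mem_univ e₀), Function.update_self, Pi.mul_apply,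
      ← Finset.mul_prod_erase _ _ (Finset.mem_univ e₀), ← mul_assoc]
    refine congrArg (_ * ·) (Finset.prod_congr rfl fun e he => ?_)
    rw [Function.update_of_ne (Finset.ne_of_mem_erase he)]
    rfl
  | zero => rw [mul_zero]; exact Submodule.zero_mem _
  | add F G _ _ hF hG => rw [mul_add]; exact Submodule.add_mem _ hF hG
  | smul c F _ hF => rw [mul_smul_comm]; exact Submodule.smul_mem _ c hF

/-- A group valued function of the holonomies is polynomial if its matrix elements multiply the span
of products of matrix elements into itself. -/
def IsPolynomialHolonomy (H : (SurfEdge n → SU2) → SU2) : Prop :=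
  ∀ i j, (fun g => (H g).1 i j) ∈ multiplierAlgebra n

theorem isPolynomialHolonomy_apply (e : SurfEdge n) :
    IsPolynomialHolonomy fun g : SurfEdge n → SU2 => g e :=
  fun i j => entry_mem_multiplierAlgebra e i j

theorem IsPolynomialHolonomy.mul {H K : (SurfEdge n → SU2) → SU2} (hH : IsPolynomialHolonomy H)
    (hK : IsPolynomialHolonomy K) : IsPolynomialHolonomy fun g => H g * K g := by
  intro i j
  have : (fun g => (H g * K g).1 i j) = (fun g => (H g).1 i 0) * (fun g => (K g).1 0 j) +
      (fun g => (H g).1 i 1) * fun g => (K g).1 1 j := by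
    ext1 g
    change ((H g).1 * (K g).1) i j = _
    rw [Matrix.mul_apply, Fin.sum_univ_two]
    rfl
  rw [this]
  exact add_mem (mul_mem (hH _ _) (hK _ _)) (mul_mem (hH _ _) (hK _ _))

end SpinNetworkSpace

end

/-! ### Spin network states from loops around two particles -/

section

variable {n : ℕ} [NeZero n]

section GaugeInvariantStates

theorem IsPolynomialHolonomy.inv {H : (SurfEdge n → SU2) → SU2} (hH : IsPolynomialHolonomy H) :
    IsPolynomialHolonomy fun g => (H g)⁻¹ := by
  have h00 : ∀ x : SU2, (x⁻¹).1 0 0 = x.1 1 1 := fun x => by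
    rw [(SU2.inv_entries x).1, (SU2.entries_eq x).2]
  have h10 : ∀ x : SU2, (x⁻¹).1 1 0 = -x.1 1 0 := fun x => (SU2.inv_entries x).2
  have h01 : ∀ x : SU2, (x⁻¹).1 0 1 = -x.1 0 1 := fun x => by
    rw [(SU2.entries_eq x⁻¹).1, h10, map_neg, neg_neg, (SU2.entries_eq x).1, neg_neg]
  have h11 : ∀ x : SU2, (x⁻¹).1 1 1 = x.1 0 0 := fun x => by
    rw [(SU2.entries_eq x⁻¹).2, h00, (SU2.entries_eq x).2, Complex.conj_conj]
  intro i j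
  fin_cases i <;> fin_cases j
  · exact (funext fun g => h00 (H g)) ▸ hH 1 1
  · exact (funext fun g => h01 (H g)) ▸ neg_mem (hH 0 1)
  · exact (funext fun g => h10 (H g)) ▸ neg_mem (hH 1 0)
  · exact (funext fun g => h11 (H g)) ▸ hH 0 0

theorem IsPolynomialHolonomy.halfTrace {H : (SurfEdge n → SU2) → SU2}
    (hH : IsPolynomialHolonomy H) :
    (fun g => ((SU2.halfTrace (H g) : ℝ) : ℂ)) ∈ multiplierAlgebra n := by
  have : (fun g => ((SU2.halfTrace (H g) : ℝ) : ℂ)) =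
      (2⁻¹ : ℂ) • ((fun g => (H g).1 0 0) + fun g => (H g).1 1 1) := by
    ext1 g
    rw [SU2.halfTrace_eq, Complex.re_eq_add_conj, Pi.smul_apply, Pi.add_apply,
      (SU2.entries_eq (H g)).2, smul_eq_mul]
    ring
  rw [this]
  exact Subalgebra.smul_mem _ (add_mem (hH _ _) (hH _ _)) _

/-- The holonomy of a loop around the particles `q` and `q + 1`. -/
def pairLoop (q : Fin n) (g : SurfEdge n → SU2) : SU2 :=
  (g (.meridian (q + 1) true))⁻¹ * (g (.meridian q true))⁻¹ * (g (.equator (q - 1)))⁻¹ *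
    g (.meridian q false) * g (.meridian (q + 1) false) * g (.equator (q + 1))

theorem isPolynomialHolonomy_pairLoop (q : Fin n) : IsPolynomialHolonomy (pairLoop q) :=
  (((((isPolynomialHolonomy_apply _).inv.mul (isPolynomialHolonomy_apply _).inv).mul
    (isPolynomialHolonomy_apply _).inv).mul (isPolynomialHolonomy_apply _)).mul
    (isPolynomialHolonomy_apply _)).mul (isPolynomialHolonomy_apply _)

theorem pairLoop_gaugeTransform (q : Fin n) (k : Tri n → SU2) (g : SurfEdge n → SU2) :
    pairLoop q (gaugeTransform k g) =
      (k (q + 1, true))⁻¹ * pairLoop q g * ((k (q + 1, true))⁻¹)⁻¹ := by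
  simp only [pairLoop, gaugeTransform, SurfEdge.src, SurfEdge.tgt, add_sub_cancel_right]
  group

theorem pairLoop_gaugeFixedConnection (q : Fin n) (C : Fin n → SU2) :
    pairLoop q (gaugeFixedConnection C) = C q * C (q + 1) := by
  simp [pairLoop, gaugeFixedConnection]

theorem eval_pairLoop_mem_spinNetworks (q : Fin n) (P : Polynomial ℂ) :
    (fun g => P.eval ((SU2.halfTrace (pairLoop q g) : ℝ) : ℂ)) ∈ SpinNetworks n := by
  constructor
  · change _ ∈ edgeProductSpan n
    apply mem_edgeProductSpan_of_mem_multiplierAlgebra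
    have h1 := (isPolynomialHolonomy_pairLoop q).halfTrace
    have h2 : (fun g => P.eval ((SU2.halfTrace (pairLoop q g) : ℝ) : ℂ)) =
        Polynomial.aeval (fun g : SurfEdge n → SU2 => ((SU2.halfTrace (pairLoop q g) : ℝ) : ℂ)) P := by
      ext1 g
      rw [Polynomial.aeval_fn_apply, Polynomial.coe_aeval_eq_eval]
    rw [h2]
    exact (Algebra.adjoin_le (Set.singleton_subset_iff.mpr h1))
      (Polynomial.aeval_mem_adjoin_singleton ℂ _)
  · intro k g
    beta_reduce
    rw [pairLoop_gaugeTransform, SU2.halfTrace_conj]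

theorem SpinNetworks.continuous {Φ : (SurfEdge n → SU2) → ℂ} (h : Φ ∈ SpinNetworks n) :
    Continuous Φ :=
  continuous_of_mem_edgeProductSpan h.1

theorem rank_spinNetworks_le : Module.rank ℂ (SpinNetworks n) ≤ Cardinal.aleph0 := by
  have h1 : SpinNetworks n ≤ edgeProductSpan n := fun Φ h => h.1
  refine (Submodule.rank_mono h1).trans ((rank_span_le _).trans ?_)
  rw [Cardinal.le_aleph0_iff_set_countable]
  have : {F : (SurfEdge n → SU2) → ℂ | ∃ (d : SurfEdge n → ℕ) (m k : ∀ e, Fin (d e + 1)),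
      F = fun g => ∏ e, wigner (d e) (g e) (m e) (k e)} ⊆
      Set.range fun x : (d : SurfEdge n → ℕ) × (∀ e, Fin (d e + 1)) × (∀ e, Fin (d e + 1)) =>
        fun g : SurfEdge n → SU2 => ∏ e, wigner (x.1 e) (g e) (x.2.1 e) (x.2.2 e) := by
    rintro _ ⟨d, m, k, rfl⟩
    exact ⟨⟨d, m, k⟩, rfl⟩
  exact (Set.countable_range _).mono this

end GaugeInvariantStates

end

/-! ### The physical scalar product -/

section

section StandardDelta

namespace SU2

theorem eq_one_of_halfTrace_eq_one {g : SU2} (h : halfTrace g = 1) : g = 1 := by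
  obtain ⟨v, hv⟩ := exists_diagonalization g
  rw [hv, h, Real.arccos_one, torusElt_zero, mul_one, mul_inv_cancel]

theorem halfTrace_one : halfTrace 1 = 1 := by
  rw [← torusElt_zero, halfTrace_torusElt, Real.cos_zero]

/-- A continuous class function with support in a small neighbourhood of the identity. -/
def bump (k : ℕ) (g : SU2) : ℝ := max 0 (1 / ((k : ℝ) + 1) - (1 - halfTrace g))

theorem continuous_bump (k : ℕ) : Continuous (bump k) :=
  continuous_const.max (continuous_const.sub (continuous_const.sub continuous_halfTrace))

theorem integral_bump_pos (k : ℕ) : 0 < ∫ g, bump k g ∂haarSU2 := by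
  have h1 : bump k 1 ≠ 0 := by
    have : (0 : ℝ) < 1 / ((k : ℝ) + 1) := by positivity
    rw [bump, halfTrace_one, sub_self, sub_zero, max_eq_right this.le]
    exact this.ne'
  exact (continuous_bump k).integral_pos_of_hasCompactSupport_nonneg_nonzero
    (HasCompactSupport.of_compactSpace _) (fun g => le_max_left _ _) h1

/-- The identity is the only element of maximal trace, so the neighbourhoods defined by the trace
shrink to it. -/
theorem isDeltaSequence_bump :
    IsDeltaSequence fun k g => (∫ x, bump k x ∂haarSU2)⁻¹ * bump k g where
  continuous k := continuous_const.mul (continuous_bump k)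
  nonneg k g := mul_nonneg (inv_nonneg.mpr (integral_bump_pos k).le) (le_max_left _ _)
  conj_invariant k x g := by simp only [bump, halfTrace_conj]
  integral_eq_one k := by
    rw [integral_const_mul, inv_mul_cancel₀ (integral_bump_pos k).ne']
  support_shrinks U hU := by
    obtain ⟨V, hVU, hV, h1⟩ := mem_nhds_iff.mp hU
    rcases (Vᶜ).eq_empty_or_nonempty with hempty | hne
    · refine Eventually.of_forall fun k g _ => hVU ?_
      by_contra h
      exact (hempty ▸ h : g ∈ (∅ : Set SU2))
    · obtain ⟨g₀, hg₀, hmax⟩ := hV.isClosed_compl.isCompact.exists_isMaxOn hne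
        continuous_halfTrace.continuousOn
      have hlt : halfTrace g₀ < 1 := lt_of_le_of_ne (abs_le.mp (abs_halfTrace_le g₀)).2
        fun h => hg₀ (eq_one_of_halfTrace_eq_one h ▸ h1)
      have hlim := tendsto_one_div_add_atTop_nhds_zero_nat (𝕜 := ℝ)
      filter_upwards [hlim.eventually (gt_mem_nhds (sub_pos.mpr hlt))] with k hk g hg
      by_contra hgU
      have hle : halfTrace g ≤ halfTrace g₀ := hmax fun h => hgU (hVU h)
      apply hg
      have : bump k g = 0 := max_eq_left (by linarith)
      simp [this]

end SU2

end StandardDelta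

section FlatIntegral

/-- The integral over the flat configurations, as the limit of integrals against one particular
sequence of delta functions. -/
def flatIntegral {n : ℕ} (θ : Fin n → ℝ) (F : (Fin n → SU2) → ℂ) : ℂ :=
  limUnder atTop fun k => reducedIntegral θ F fun g => (∫ x, SU2.bump k x ∂haarSU2)⁻¹ * SU2.bump k g

variable {n : ℕ} {θ : Fin n → ℝ}

theorem flatIntegral_eq {F : (Fin n → SU2) → ℂ} {A : ℂ}
    (h : ∀ φ : ℕ → SU2 → ℝ, IsDeltaSequence φ →
      Tendsto (fun k => reducedIntegral θ F (φ k)) atTop (𝓝 A)) : flatIntegral θ F = A :=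
  (h _ SU2.isDeltaSequence_bump).limUnder_eq

/-- The conditions under which integrals over the flat configurations are finite. -/
def IsRegularAngles (θ : Fin n → ℝ) : Prop :=
  (∀ p, θ p ∈ Set.Ioo 0 Real.pi) ∧
    (4 ≤ n ∨ ∀ g, IsFlatConfiguration θ g → IsIrreducibleConfiguration g)

variable (hθ : IsRegularAngles θ)
include hθ

theorem IsDeltaSequence.tendsto_flatIntegral {φ : ℕ → SU2 → ℝ} (hφ : IsDeltaSequence φ)
    {F : (Fin n → SU2) → ℂ} (hF : Continuous F) :
    Tendsto (fun k => reducedIntegral θ F (φ k)) atTop (𝓝 (flatIntegral θ F)) := by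
  obtain ⟨A, hA⟩ := exists_tendsto_reducedIntegral hθ.1 hθ.2 F hF
  rw [flatIntegral_eq hA]
  exact hA φ hφ

omit hθ in
theorem integrable_reduced {F : (Fin n → SU2) → ℂ} (hF : Continuous F) {ψ : SU2 → ℝ}
    (hψ : Continuous ψ) : Integrable (fun u : Fin n → SU2 =>
      F (fun p => u p * torusElt (θ p) * (u p)⁻¹) * (ψ (SU2.holonomyProduct θ u) : ℂ))
      (Measure.pi fun _ => haarSU2) := by
  have h : Continuous fun (u : Fin n → SU2) p => u p * torusElt (θ p) * (u p)⁻¹ :=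
    continuous_pi fun p => (SU2.continuous_conj_torusElt (θ p)).comp (continuous_apply p)
  exact ((hF.comp h).mul (Complex.continuous_ofReal.comp
    (hψ.comp (SU2.continuous_holonomyProduct θ)))).integrable_of_compactSpace

theorem flatIntegral_add {F G : (Fin n → SU2) → ℂ} (hF : Continuous F) (hG : Continuous G) :
    flatIntegral θ (fun C => F C + G C) = flatIntegral θ F + flatIntegral θ G := by
  have hd := SU2.isDeltaSequence_bump
  refine tendsto_nhds_unique (hd.tendsto_flatIntegral hθ (hF.add hG)) ?_
  refine ((hd.tendsto_flatIntegral hθ hF).add (hd.tendsto_flatIntegral hθ hG)).congr fun k => ?_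
  unfold reducedIntegral
  rw [← integral_add (integrable_reduced hF (hd.continuous k))
    (integrable_reduced hG (hd.continuous k))]
  simp only [add_mul]

theorem flatIntegral_const_mul (c : ℂ) {F : (Fin n → SU2) → ℂ} (hF : Continuous F) :
    flatIntegral θ (fun C => c * F C) = c * flatIntegral θ F := by
  have hd := SU2.isDeltaSequence_bump
  refine tendsto_nhds_unique (hd.tendsto_flatIntegral hθ (continuous_const.mul hF)) ?_
  refine ((hd.tendsto_flatIntegral hθ hF).const_mul c).congr fun k => ?_
  unfold reducedIntegral
  rw [← integral_const_mul]
  simp only [mul_assoc]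

theorem flatIntegral_conj {F : (Fin n → SU2) → ℂ} (hF : Continuous F) :
    flatIntegral θ (fun C => starRingEnd ℂ (F C)) = starRingEnd ℂ (flatIntegral θ F) := by
  have hd := SU2.isDeltaSequence_bump
  refine tendsto_nhds_unique (hd.tendsto_flatIntegral hθ (Complex.continuous_conj.comp hF)) ?_
  refine ((Complex.continuous_conj.tendsto _).comp (hd.tendsto_flatIntegral hθ hF)).congr
    fun k => ?_
  simp only [Function.comp_apply]
  unfold reducedIntegral
  rw [← integral_conj]
  simp only [map_mul, Complex.conj_ofReal]

theorem re_flatIntegral_nonneg {F : (Fin n → SU2) → ℂ} (hF : Continuous F)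
    (h0 : ∀ C, 0 ≤ (F C).re) : 0 ≤ (flatIntegral θ F).re := by
  have hd := SU2.isDeltaSequence_bump
  refine ge_of_tendsto' ((Complex.continuous_re.tendsto _).comp (hd.tendsto_flatIntegral hθ hF))
    fun k => ?_
  have hi := integrable_reduced (θ := θ) hF (hd.continuous k)
  change 0 ≤ RCLike.re (reducedIntegral θ F _)
  unfold reducedIntegral
  rw [← integral_re hi]
  refine integral_nonneg fun u => ?_
  simp only [RCLike.re_to_complex, Complex.re_mul_ofReal]
  exact mul_nonneg (h0 _) (hd.nonneg k _)

end FlatIntegral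

section ScalarProduct

variable {n : ℕ} [NeZero n] {θ : Fin n → ℝ}

theorem SpinNetworkState.continuous_toFun (Φ : SpinNetworkState n) : Continuous Φ.toFun :=
  SpinNetworks.continuous (show SpinNetworks n from Φ).2

theorem SpinNetworkState.toFun_gaugeTransform (Φ : SpinNetworkState n) (k : Tri n → SU2)
    (g : SurfEdge n → SU2) : Φ.toFun (gaugeTransform k g) = Φ.toFun g :=
  (show SpinNetworks n from Φ).2.2 k g

theorem continuous_gaugeFixedConnection : Continuous (gaugeFixedConnection (n := n)) := by
  refine continuous_pi fun e => ?_
  rcases e with ⟨p, _ | _⟩ | p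
  · exact continuous_apply p
  · exact continuous_const
  · exact continuous_const

/-- A spin network state as a function of the holonomies of the particles. -/
def SpinNetworkState.reduced (Φ : SpinNetworkState n) (C : Fin n → SU2) : ℂ :=
  Φ.toFun (gaugeFixedConnection C)

theorem SpinNetworkState.continuous_reduced (Φ : SpinNetworkState n) : Continuous Φ.reduced :=
  Φ.continuous_toFun.comp continuous_gaugeFixedConnection

theorem SpinNetworkState.continuous_conj_reduced_mul (Φ Ψ : SpinNetworkState n) :
    Continuous fun C => starRingEnd ℂ (Φ.reduced C) * Ψ.reduced C :=
  (Complex.continuous_conj.comp Φ.continuous_reduced).mul Ψ.continuous_reduced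

/-- The physical scalar product: the integral over the flat configurations. -/
@[reducible] def physicalCore (hθ : IsRegularAngles θ) : PreInnerProductSpace.Core ℂ (SpinNetworkState n) where
  inner Φ Ψ := flatIntegral θ fun C => starRingEnd ℂ (Φ.reduced C) * Ψ.reduced C
  conj_inner_symm Φ Ψ := by
    rw [← flatIntegral_conj hθ (Ψ.continuous_conj_reduced_mul Φ)]
    congr 1
    ext1 C
    simp only [map_mul, Complex.conj_conj, mul_comm]
  re_inner_nonneg Φ := by
    refine re_flatIntegral_nonneg hθ (Φ.continuous_conj_reduced_mul Φ) fun C => ?_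
    rw [← Complex.normSq_eq_conj_mul_self, Complex.ofReal_re]
    exact Complex.normSq_nonneg _
  add_left Φ Ψ X := by
    rw [← flatIntegral_add hθ (Φ.continuous_conj_reduced_mul X) (Ψ.continuous_conj_reduced_mul X)]
    congr 1
    ext1 C
    rw [← add_mul, ← map_add]
    rfl
  smul_left Φ Ψ c := by
    rw [← flatIntegral_const_mul hθ _ (Φ.continuous_conj_reduced_mul Ψ)]
    congr 1
    ext1 C
    rw [← mul_assoc, ← map_mul]
    rfl

theorem physicalCore_inner (hθ : IsRegularAngles θ) (Φ Ψ : SpinNetworkState n) :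
    (physicalCore hθ).inner Φ Ψ =
      flatIntegral θ fun C => starRingEnd ℂ (Φ.reduced C) * Ψ.reduced C := rfl

theorem isReducedAmplitude_physicalCore (hθ : IsRegularAngles θ) (Φf Φi : SpinNetworkState n) :
    IsReducedAmplitude θ Φf.toFun Φi.toFun ((physicalCore hθ).inner Φf Φi) := fun _ hφ =>
  hφ.tendsto_flatIntegral hθ (Φf.continuous_conj_reduced_mul Φi)

theorem isTransitionAmplitude_physicalCore (hθ : IsRegularAngles θ) {T : Finset (DualEdge n)}
    (hT : IsMaximalDualTree T) (Φf Φi : SpinNetworkState n) :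
    IsTransitionAmplitude θ T Φf.toFun Φi.toFun ((physicalCore hθ).inner Φf Φi) := fun _ hφ =>
  tendsto_regularizedAmplitude hφ hT θ Φf.toFun_gaugeTransform Φi.toFun_gaugeTransform
    Φf.continuous_toFun Φi.continuous_toFun
    (fun _ hψ => hψ.tendsto_flatIntegral hθ (Φf.continuous_conj_reduced_mul Φi))
    (fun _ hψ => hψ.tendsto_flatIntegral hθ continuous_const)

end ScalarProduct

end

/-! ### Separable Hilbert spaces and `L²` of a power of the sphere -/

section

section HilbertSpaces

variable {E F : Type*} [NormedAddCommGroup E] [InnerProductSpace ℂ E] [CompleteSpace E]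
  [NormedAddCommGroup F] [InnerProductSpace ℂ F] [CompleteSpace F]

theorem Orthonormal.countable_of_separableSpace [TopologicalSpace.SeparableSpace E] {w : Set E}
    (hw : Orthonormal ℂ ((↑) : w → E)) : w.Countable := by
  -- distinct vectors have distance `√2`, so the balls of radius `1 / 2` are disjoint
  have hdisj : w.PairwiseDisjoint fun x => Metric.ball x (1 / 2) := by
    intro x hx y hy hxy
    apply Metric.ball_disjoint_ball
    have h0 : inner ℂ x y = 0 := hw.2 (i := ⟨x, hx⟩) (j := ⟨y, hy⟩) (by simpa using hxy)
    have hx1 : ‖x‖ = 1 := hw.1 ⟨x, hx⟩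
    have hy1 : ‖y‖ = 1 := hw.1 ⟨y, hy⟩
    have h2 : ‖x - y‖ ^ 2 = 2 := by
      rw [norm_sub_sq (𝕜 := ℂ), h0, hx1, hy1]; norm_num
    rw [dist_eq_norm]
    nlinarith [norm_nonneg (x - y)]
  exact hdisj.countable_of_isOpen (fun _ _ => Metric.isOpen_ball)
    fun x _ => ⟨x, Metric.mem_ball_self (by norm_num)⟩

theorem exists_hilbertBasis_nat [TopologicalSpace.SeparableSpace E] (hE : ¬ FiniteDimensional ℂ E) :
    Nonempty (HilbertBasis ℕ ℂ E) := by
  obtain ⟨w, b, hb⟩ := exists_hilbertBasis ℂ E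
  have hw : Orthonormal ℂ ((↑) : w → E) := hb ▸ b.orthonormal
  have hc : Countable w := hw.countable_of_separableSpace.to_subtype
  have hinf : Infinite w := by
    by_contra h
    rw [not_infinite_iff_finite] at h
    have := Fintype.ofFinite w
    exact hE (b.toOrthonormalBasis.toBasis.finiteDimensional_of_finite)
  obtain ⟨e⟩ : Nonempty (ℕ ≃ w) := by
    obtain ⟨_⟩ := nonempty_denumerable w
    exact ⟨(Denumerable.eqv w).symm⟩
  refine ⟨HilbertBasis.mk (b.orthonormal.comp e e.injective) ?_⟩
  rw [e.surjective.range_comp]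
  exact b.dense_span.ge

/-- Infinite dimensional separable Hilbert spaces are isomorphic. -/
theorem nonempty_linearIsometryEquiv_of_separable [TopologicalSpace.SeparableSpace E]
    [TopologicalSpace.SeparableSpace F] (hE : ¬ FiniteDimensional ℂ E)
    (hF : ¬ FiniteDimensional ℂ F) : Nonempty (E ≃ₗᵢ[ℂ] F) := by
  obtain ⟨b⟩ := exists_hilbertBasis_nat hE
  obtain ⟨c⟩ := exists_hilbertBasis_nat hF
  exact ⟨b.repr.trans c.repr.symm⟩

end HilbertSpaces

section SpherePower

theorem measurePreserving_mk_cartanU1 :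
    MeasurePreserving (QuotientGroup.mk : SU2 → SU2 ⧸ cartanU1) haarSU2 measureSU2ModU1 :=
  ⟨QuotientGroup.measurable_coe, rfl⟩

instance : IsProbabilityMeasure measureSU2ModU1 :=
  Measure.isProbabilityMeasure_map QuotientGroup.measurable_coe.aemeasurable

theorem measurePreserving_mk_pi (n : ℕ) :
    MeasurePreserving (fun (u : Fin n → SU2) p => (QuotientGroup.mk (u p) : SU2 ⧸ cartanU1))
      (Measure.pi fun _ => haarSU2) (Measure.pi fun _ => measureSU2ModU1) :=
  measurePreserving_pi (fun _ : Fin n => haarSU2) (fun _ => measureSU2ModU1)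
    (f := fun _ => QuotientGroup.mk) fun _ => measurePreserving_mk_cartanU1

instance (n : ℕ) : TopologicalSpace.SeparableSpace (L2SpherePower n) := by
  have : Fact ((1 : ENNReal) ≤ 2) := ⟨one_le_two⟩
  have : Fact ((2 : ENNReal) ≠ ⊤) := ⟨ENNReal.ofNat_ne_top⟩
  have h : SecondCountableTopology (Lp ℂ 2 (Measure.pi fun _ : Fin (n - 1) => haarSU2)) :=
    inferInstance
  have := (Lp.compMeasurePreservingₗᵢ (p := 2) (E := ℂ) ℂ _
    (measurePreserving_mk_pi (n - 1))).isometry.isEmbedding.isInducing.secondCountableTopology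
  infer_instance

/-- The weight of the first column as a function on the sphere `SU(2)/U(1)`. -/
def sphereHeight : SU2 ⧸ cartanU1 → ℝ :=
  Quotient.lift SU2.colWeight fun a b h => by
    obtain ⟨τ, hτ⟩ := QuotientGroup.leftRel_apply.mp h
    rw [eq_inv_mul_iff_mul_eq] at hτ
    rw [← hτ]
    unfold SU2.colWeight
    rw [SU2.mul_apply_zero]
    simp [Complex.normSq_eq_norm_sq, Complex.norm_exp_ofReal_mul_I]

theorem measurable_sphereHeight : Measurable sphereHeight :=
  measurable_from_quotient.mpr SU2.continuous_colWeight.measurable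

/-- The set of configurations of points on the sphere for which the height of one of them lies
between `1 / (j + 2)` and `1 / (j + 1)`. -/
def heightSlab {m : ℕ} (i : Fin m) (j : ℕ) : Set (Fin m → SU2 ⧸ cartanU1) :=
  (fun q => sphereHeight (q i)) ⁻¹' Set.Ioo (1 / ((j : ℝ) + 2)) (1 / ((j : ℝ) + 1))

theorem measurableSet_heightSlab {m : ℕ} (i : Fin m) (j : ℕ) : MeasurableSet (heightSlab i j) :=
  (measurable_sphereHeight.comp (measurable_pi_apply i)) measurableSet_Ioo

theorem disjoint_heightSlab {m : ℕ} (i : Fin m) {j k : ℕ} (hjk : j ≠ k) :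
    heightSlab i j ∩ heightSlab i k = ∅ := by
  wlog h : j < k generalizing j k
  · rw [Set.inter_comm]
    exact this hjk.symm (lt_of_le_of_ne (not_lt.mp h) hjk.symm)
  refine Set.eq_empty_of_forall_notMem fun q hq => ?_
  have h1 : 1 / ((j : ℝ) + 2) < sphereHeight (q i) := hq.1.1
  have h2 : sphereHeight (q i) < 1 / ((k : ℝ) + 1) := hq.2.2
  have h3 : (j : ℝ) + 2 ≤ (k : ℝ) + 1 := by
    have : ((j + 1 : ℕ) : ℝ) ≤ k := by exact_mod_cast h
    push_cast at this
    linarith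
  have := one_div_le_one_div_of_le (by positivity : (0 : ℝ) < (j : ℝ) + 2) h3
  linarith

theorem measure_heightSlab_ne_zero {m : ℕ} (i : Fin m) (j : ℕ) :
    (Measure.pi fun _ => measureSU2ModU1) (heightSlab i j) ≠ 0 := by
  have h1 : (0 : ℝ) < 1 / ((j : ℝ) + 2) := by positivity
  have h2 : 1 / ((j : ℝ) + 1) ≤ 1 := by
    rw [div_le_one (by positivity)]
    have := Nat.cast_nonneg (α := ℝ) j
    linarith
  have h3 : 1 / ((j : ℝ) + 2) < 1 / ((j : ℝ) + 1) :=
    one_div_lt_one_div_of_lt (by positivity) (by linarith)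
  rw [← (measurePreserving_mk_pi m).measure_preimage (measurableSet_heightSlab i j).nullMeasurableSet]
  change (Measure.pi fun _ => haarSU2) (Function.eval i ⁻¹' (SU2.colWeight ⁻¹' Set.Ioo _ _)) ≠ 0
  rw [(measurePreserving_eval (fun _ : Fin m => haarSU2) i).measure_preimage
    (SU2.continuous_colWeight.measurable measurableSet_Ioo).nullMeasurableSet,
    ← Measure.map_apply SU2.continuous_colWeight.measurable measurableSet_Ioo,
    SU2.map_colWeight_haar, Measure.restrict_apply measurableSet_Ioo,
    Set.inter_eq_left.mpr (Set.Ioo_subset_Icc_self.trans (Set.Icc_subset_Icc h1.le h2)),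
    Real.volume_Ioo]
  simpa using h3

/-- The indicator functions of the height slabs are orthogonal and nonzero. -/
theorem not_finiteDimensional_L2SpherePower {n : ℕ} (hn : 2 ≤ n) :
    ¬ FiniteDimensional ℂ (L2SpherePower n) := by
  intro hfin
  let i : Fin (n - 1) := ⟨0, by omega⟩
  let v : ℕ → L2SpherePower n := fun j =>
    indicatorConstLp 2 (measurableSet_heightSlab i j) (measure_ne_top _ _) (1 : ℂ)
  have hinner : ∀ j k, inner ℂ (v j) (v k) =
      (((Measure.pi fun _ => measureSU2ModU1).real (heightSlab i j ∩ heightSlab i k) : ℝ) : ℂ) :=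
    fun j k => L2.inner_indicatorConstLp_one_indicatorConstLp_one _ _ _ _
  refine Module.Finite.not_linearIndependent_of_infinite v
    (linearIndependent_of_ne_zero_of_inner_eq_zero (𝕜 := ℂ) (fun j h => ?_) fun j k hjk => ?_)
  · have h1 := hinner j j
    rw [h, inner_zero_left, Set.inter_self, eq_comm, Complex.ofReal_eq_zero,
      measureReal_eq_zero_iff] at h1
    exact measure_heightSlab_ne_zero i j h1
  · beta_reduce
    rw [hinner, disjoint_heightSlab i hjk]
    simp

end SpherePower

end

/-! ### Commuting elements and cyclic renumbering -/

section

namespace SU2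

section Commuting

/-- Lagrange's identity for the imaginary parts of two unit quaternions; the cross product
vanishes exactly if they commute. -/
theorem sq_halfTrace_mul_sub_lt {A B : SU2} (h : A * B ≠ B * A) :
    (halfTrace (A * B) - halfTrace A * halfTrace B) ^ 2 <
      (1 - halfTrace A ^ 2) * (1 - halfTrace B ^ 2) := by
  have nA := normSq_add_normSq A
  have nB := normSq_add_normSq B
  have e1 : halfTrace (A * B) = (A.1 0 0).re * (B.1 0 0).re - (A.1 0 0).im * (B.1 0 0).im -
      ((A.1 1 0).re * (B.1 1 0).re + (A.1 1 0).im * (B.1 1 0).im) := by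
    rw [halfTrace_eq, mul_apply_zero]
    simp [(entries_eq A).1]
    ring
  rw [e1, halfTrace_eq, halfTrace_eq]
  rw [Complex.normSq_apply, Complex.normSq_apply] at nA nB
  have hmul0 : ∀ X Y : SU2, (X * Y).1 0 0 = X.1 0 0 * Y.1 0 0 - starRingEnd ℂ (X.1 1 0) * Y.1 1 0 := by
    intro X Y
    rw [mul_apply_zero, (entries_eq X).1]; ring
  have hmul1 : ∀ X Y : SU2, (X * Y).1 1 0 = X.1 1 0 * Y.1 0 0 + starRingEnd ℂ (X.1 0 0) * Y.1 1 0 := by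
    intro X Y
    rw [mul_apply_one, (entries_eq X).2]
  set a := (A.1 0 0).re
  set b := (A.1 0 0).im with hb
  set c := (A.1 1 0).re with hc
  set d := (A.1 1 0).im with hd
  set a' := (B.1 0 0).re
  set b' := (B.1 0 0).im with hb'
  set c' := (B.1 1 0).re with hc'
  set d' := (B.1 1 0).im with hd'
  have hlag : (1 - a ^ 2) * (1 - a' ^ 2) - (a * a' - b * b' - (c * c' + d * d') - a * a') ^ 2 =
      (b * c' - c * b') ^ 2 + (b * d' - d * b') ^ 2 + (c * d' - d * c') ^ 2 := by
    have h1 : 1 - a ^ 2 = b ^ 2 + c ^ 2 + d ^ 2 := by linear_combination -nA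
    have h2 : 1 - a' ^ 2 = b' ^ 2 + c' ^ 2 + d' ^ 2 := by linear_combination -nB
    rw [h1, h2]; ring
  by_contra hle
  have hsum : (b * c' - c * b') ^ 2 + (b * d' - d * b') ^ 2 + (c * d' - d * c') ^ 2 ≤ 0 := by
    rw [← hlag]; linarith [not_lt.mp hle]
  have z1 : b * c' - c * b' = 0 := by
    have := sq_nonneg (b * c' - c * b'); have := sq_nonneg (b * d' - d * b')
    have := sq_nonneg (c * d' - d * c'); exact pow_eq_zero_iff two_ne_zero |>.mp (by linarith)
  have z2 : b * d' - d * b' = 0 := by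
    have := sq_nonneg (b * c' - c * b'); have := sq_nonneg (b * d' - d * b')
    have := sq_nonneg (c * d' - d * c'); exact pow_eq_zero_iff two_ne_zero |>.mp (by linarith)
  have z3 : c * d' - d * c' = 0 := by
    have := sq_nonneg (b * c' - c * b'); have := sq_nonneg (b * d' - d * b')
    have := sq_nonneg (c * d' - d * c'); exact pow_eq_zero_iff two_ne_zero |>.mp (by linarith)
  apply h
  apply ext_column
  · rw [hmul0, hmul0]
    apply Complex.ext
    · simp [← hb, ← hb', ← hc, ← hc', ← hd, ← hd']; ring
    · simp [← hb, ← hb', ← hc, ← hc', ← hd, ← hd']; linear_combination -2 * z3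
  · rw [hmul1, hmul1]
    apply Complex.ext
    · simp [← hb, ← hb', ← hc, ← hc', ← hd, ← hd']; linear_combination 2 * z2
    · simp [← hb, ← hb', ← hc, ← hc', ← hd, ← hd']; linear_combination -2 * z1

/-- The centralizer of a noncentral element is abelian. -/
theorem mul_comm_of_commute_isConj {θ : ℝ} (hθ : θ ∈ Set.Ioo 0 Real.pi) {A B C : SU2}
    (hB : IsConj (torusElt θ) B) (hA : A * B = B * A) (hC : B * C = C * B) : A * C = C * A := by
  obtain ⟨v, rfl⟩ := isConj_iff.mp hB
  have key : ∀ X : SU2, X * (v * torusElt θ * v⁻¹) = v * torusElt θ * v⁻¹ * X →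
      (v⁻¹ * X * v).1 1 0 = 0 := by
    intro X hX
    set Y := v⁻¹ * X * v with hY
    have h1 : Y * torusElt θ = torusElt θ * Y := by
      have h2 : Y * torusElt θ = v⁻¹ * (X * (v * torusElt θ * v⁻¹)) * v := by rw [hY]; group
      rw [h2, hX, hY]; group
    have h2 := congrArg (fun Z : SU2 => Z.1 1 0) h1
    simp only [mul_apply_one, torusElt_zero_zero, torusElt_one_zero, torusElt_one_one, mul_zero,
      add_zero, zero_mul, zero_add] at h2
    have h3 : Y.1 1 0 * (Complex.exp (θ * Complex.I) - Complex.exp (-(θ * Complex.I))) = 0 := by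
      linear_combination h2
    rcases mul_eq_zero.mp h3 with h | h
    · exact h
    · exfalso
      have h4 := congrArg Complex.im h
      rw [Complex.sub_im, ← neg_mul, ← Complex.ofReal_neg, Complex.exp_ofReal_mul_I_im,
        Complex.exp_ofReal_mul_I_im, Real.sin_neg, Complex.zero_im] at h4
      have := Real.sin_pos_of_mem_Ioo hθ
      linarith
  have h1 := key A hA
  have h2 := key C hC.symm
  have h3 : v⁻¹ * A * v * (v⁻¹ * C * v) = v⁻¹ * C * v * (v⁻¹ * A * v) := by
    generalize v⁻¹ * A * v = Y at h1 ⊢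
    generalize v⁻¹ * C * v = Z at h2 ⊢
    apply ext_column
    · rw [mul_apply_zero, mul_apply_zero, h1, h2]; ring
    · rw [mul_apply_one, mul_apply_one, h1, h2]; ring
  calc A * C = v * (v⁻¹ * A * v * (v⁻¹ * C * v)) * v⁻¹ := by group
    _ = C * A := by rw [h3]; group

end Commuting

end SU2

open SU2

/-- In an irreducible flat configuration, the holonomies of two neighbouring particles do not
commute. -/
theorem exists_adjacent_not_commute {n : ℕ} {θ : Fin n → ℝ} (hθ : ∀ p, θ p ∈ Set.Ioo 0 Real.pi)
    {g : Fin n → SU2} (hg : ∀ p, IsConj (torusElt (θ p)) (g p)) (hirr : IsIrreducibleConfiguration g) :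
    ∃ (i : ℕ) (h : i + 1 < n), g ⟨i, by omega⟩ * g ⟨i + 1, h⟩ ≠ g ⟨i + 1, h⟩ * g ⟨i, by omega⟩ := by
  by_contra hcon
  push Not at hcon
  have key : ∀ (d i : ℕ) (h : i + d < n),
      g ⟨i, by omega⟩ * g ⟨i + d, h⟩ = g ⟨i + d, h⟩ * g ⟨i, by omega⟩ := by
    intro d
    -- commutation propagates through the noncentral element in between
    induction d with
    | zero => intro i h; rfl
    | succ d ih =>
      intro i h
      exact mul_comm_of_commute_isConj (hθ _) (hg ⟨i + d, by omega⟩) (ih i (by omega))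
        (hcon (i + d) h)
  obtain ⟨p, q, hpq⟩ := hirr
  rcases le_total p.val q.val with h | h
  · have := key (q.val - p.val) p.val (by omega)
    simp only [Nat.add_sub_cancel' h] at this
    exact hpq this
  · have := key (p.val - q.val) q.val (by omega)
    simp only [Nat.add_sub_cancel' h] at this
    exact hpq this.symm

section Rotation

theorem prod_ofFn_add_one {G : Type*} [Group G] {m : ℕ} (D : Fin (m + 1) → G) :
    (List.ofFn fun i => D (i + 1)).prod = (D 0)⁻¹ * (List.ofFn D).prod * D 0 := by
  rw [List.ofFn_succ', List.ofFn_succ (f := D), List.concat_eq_append, List.prod_append,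
    List.prod_singleton, List.prod_cons, Fin.last_add_one, inv_mul_cancel_left]
  simp only [Fin.coeSucc_eq_succ]

/-- A cyclic permutation of the factors conjugates the product. -/
theorem exists_prod_ofFn_add {G : Type*} [Group G] {m : ℕ} (q : Fin (m + 1)) :
    ∀ C : Fin (m + 1) → G, ∃ a : G, (List.ofFn fun i => C (i + q)).prod =
      a * (List.ofFn C).prod * a⁻¹ := by
  induction q using Fin.induction with
  | zero => intro C; exact ⟨1, by simp⟩
  | succ q ih =>
    intro C
    have h : ∀ i, i + q.succ = (i + 1) + q.castSucc := by
      intro i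
      rw [← Fin.coeSucc_eq_succ, add_right_comm, add_assoc]
    obtain ⟨a, ha⟩ := ih C
    refine ⟨(C (0 + q.castSucc))⁻¹ * a, ?_⟩
    simp only [h]
    rw [prod_ofFn_add_one (fun i => C (i + q.castSucc)), ha]
    group

theorem integral_pi_reindex {ι : Type*} [Fintype ι] (e : ι ≃ ι) (f : (ι → SU2) → ℂ) : ∫ u, f (fun i => u (e i)) ∂(Measure.pi fun _ => haarSU2) =
      ∫ u, f u ∂(Measure.pi fun _ => haarSU2) := by
  have h := measurePreserving_piCongrLeft (fun _ : ι => haarSU2) e.symm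
  have h2 : ∀ u : ι → SU2, MeasurableEquiv.piCongrLeft (fun _ : ι => SU2) e.symm u =
      fun i => u (e i) := by
    intro u
    ext1 i
    have := MeasurableEquiv.piCongrLeft_apply_apply (β := fun _ : ι => SU2) e.symm u (e i)
    rwa [e.symm_apply_apply] at this
  have h3 := h.integral_comp' (g := f)
  simp only [h2] at h3
  exact h3

/-- A cyclic renumbering of the particles does not change the integral against class functions of
the product. -/
theorem reducedIntegral_add {m : ℕ} (θ : Fin (m + 1) → ℝ) (q : Fin (m + 1))
    (G : (Fin (m + 1) → SU2) → ℂ) {ψ : SU2 → ℝ}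
    (hc : ∀ x g, ψ (x * g * x⁻¹) = ψ g) :
    reducedIntegral (fun i => θ (i + q)) G ψ =
      reducedIntegral θ (fun C => G fun i => C (i + q)) ψ := by
  unfold reducedIntegral
  rw [← integral_pi_reindex (Equiv.addRight q)]
  congr 1
  ext u
  obtain ⟨a, ha⟩ := exists_prod_ofFn_add q fun p => u p * torusElt (θ p) * (u p)⁻¹
  simp only [Equiv.coe_addRight, holonomyProduct]
  rw [ha, hc]

theorem flatIntegral_add_index {m : ℕ} {θ : Fin (m + 1) → ℝ} (hθ : ∀ p, θ p ∈ Set.Ioo 0 Real.pi)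
    (hm : 4 ≤ m + 1) (q : Fin (m + 1)) {G : (Fin (m + 1) → SU2) → ℂ} (hG : Continuous G) :
    flatIntegral (fun i => θ (i + q)) G = flatIntegral θ fun C => G fun i => C (i + q) := by
  refine flatIntegral_eq fun φ hφ => ?_
  have hG' : Continuous fun C : Fin (m + 1) → SU2 => G fun i => C (i + q) :=
    hG.comp (continuous_pi fun i => continuous_apply _)
  refine (hφ.tendsto_flatIntegral ⟨hθ, Or.inl hm⟩ hG').congr fun k => ?_
  rw [reducedIntegral_add θ q G (hφ.conj_invariant k)]

end Rotation

end

/-! ### The physical Hilbert space -/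

section

open SU2

section Positivity

/-- The reduced integral charges every neighbourhood of a flat configuration in which particles `0`
and `1` have noncommuting holonomies, while the trace of the product of these two holonomies has an
atomless distribution. -/
theorem reducedLimit_pos {m : ℕ} {θ : Fin (m + 4) → ℝ} (hθ : ∀ p, θ p ∈ Set.Ioo 0 Real.pi)
    {K : ℝ → ℝ} (hK : Continuous K) (h0 : ∀ y, 0 ≤ K y) (hz : {y | K y = 0}.Countable)
    {g : Fin (m + 4) → SU2} (hg : IsFlatConfiguration θ g) (hne : g 0 * g 1 ≠ g 1 * g 0) :
    0 < (reducedLimit (m := m + 1) θ fun C => ((K (halfTrace (C 0 * C 1)) : ℝ) : ℂ)).re := by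
  set R : (Fin (m + 2) → SU2) → SU2 := holonomyProduct fun p => θ p.succ.succ with hR
  have hcR : Continuous R := continuous_holonomyProduct _
  have hsa : 0 < Real.sin (θ 1) := Real.sin_pos_of_mem_Ioo (hθ 1)
  have hsb : 0 < Real.sin (θ 0) := Real.sin_pos_of_mem_Ioo (hθ 0)
  -- the domain on which the remaining holonomies can be completed to a flat configuration, by the
  -- strict triangle inequality, and the density of the limit on it
  set U : Set (Fin (m + 2) → SU2) := {x | |halfTrace (R x) * Real.cos (θ 0) - Real.cos (θ 1)| <
    sinAngle (R x) * Real.sin (θ 0)} with hU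
  have hUo : IsOpen U := isOpen_lt
    (((continuous_halfTrace.comp hcR).mul continuous_const).sub continuous_const).abs
    ((continuous_sinAngle.comp hcR).mul continuous_const)
  set W : (Fin (m + 2) → SU2) → ℝ := U.indicator fun x =>
    Real.pi / (4 * Real.sin (θ 1) * Real.sin (θ 0)) *
      ((sinAngle (R x))⁻¹ * K (halfTrace (R x))) with hW
  have hlim : reducedLimit (m := m + 1) θ (fun C => ((K (halfTrace (C 0 * C 1)) : ℝ) : ℂ)) =
      ((∫ x, W x ∂Measure.pi fun _ => haarSU2 : ℝ) : ℂ) := by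
    rw [reducedLimit, ← integral_complex_ofReal]
    congr 1
    ext1 x
    have hprod : ∀ h : SU2, halfTrace (h * (R x * h)⁻¹) = halfTrace (R x) := by
      intro h
      rw [mul_inv_rev, mul_inv_cancel_left, halfTrace_inv]
    simp only [Fin.cons_zero, Fin.cons_one, fiberLimit, circleAverage_const, ← hR, hprod]
    by_cases hx : x ∈ U
    · have hx' : |halfTrace (R x) * Real.cos (θ 0) - Real.cos (θ 1)| <
          sinAngle (R x) * Real.sin (θ 0) := hx
      rw [if_pos hx', hW, Set.indicator_of_mem hx, ← Complex.ofReal_mul]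
      congr 1
      field_simp
    · have hx' : ¬ |halfTrace (R x) * Real.cos (θ 0) - Real.cos (θ 1)| <
          sinAngle (R x) * Real.sin (θ 0) := hx
      rw [if_neg hx', hW, Set.indicator_of_notMem hx, Complex.ofReal_zero]
  rw [hlim, Complex.ofReal_re]
  have hWi : Integrable W (Measure.pi fun _ => haarSU2) := by
    refine Integrable.indicator ?_ hUo.measurableSet
    have hi := (holonomyProduct_sinAngle (fun p : Fin (m + 2) => θ p.succ.succ) fun p => hθ _).2
    have hc : Continuous fun x => K (halfTrace (R x)) := hK.comp (continuous_halfTrace.comp hcR)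
    obtain ⟨M, hM⟩ := (isCompact_range hc).isBounded.exists_norm_le
    exact (hi.mul_bdd (c := M) hc.aestronglyMeasurable
      (Eventually.of_forall fun x => hM _ ⟨x, rfl⟩)).const_mul _
  have hW0 : 0 ≤ W := fun x => Set.indicator_nonneg (fun x _ => mul_nonneg (by positivity)
    (mul_nonneg (inv_nonneg.mpr (sinAngle_nonneg _)) (h0 _))) x
  rw [integral_pos_iff_support_of_nonneg hW0 hWi]
  have hK0 : ∀ᵐ x ∂(Measure.pi fun _ : Fin (m + 2) => haarSU2), K (halfTrace (R x)) ≠ 0 := by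
    have : ∀ᵐ x ∂(Measure.pi fun _ : Fin (m + 2) => haarSU2),
        ∀ y ∈ {y | K y = 0}, halfTrace (R x) ≠ y :=
      (ae_ball_iff hz).mpr fun y _ =>
        ae_halfTrace_holonomyProduct_ne (fun p => θ p.succ.succ) (fun p => hθ _) y
    filter_upwards [this] with x hx h
    exact hx _ h rfl
  -- noncommutativity of `g 0` and `g 1` makes the triangle inequality strict at `g`
  have hUne : U.Nonempty := by
    choose x hx using fun p : Fin (m + 2) => isConj_iff.mp (hg.1 p.succ.succ)
    refine ⟨x, ?_⟩
    have hprod := hg.2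
    rw [List.ofFn_succ, List.ofFn_succ, List.prod_cons, List.prod_cons] at hprod
    have hRx : R x = (List.ofFn fun p : Fin (m + 2) => g p.succ.succ).prod := by
      simp only [hR, holonomyProduct, hx]
    rw [← hRx, Fin.succ_zero_eq_one] at hprod
    have hnc : R x * g 0 ≠ g 0 * R x := by
      intro h
      apply hne
      have h1 : g 1 = (g 0)⁻¹ * (R x)⁻¹ :=
        eq_mul_inv_iff_mul_eq.mpr (eq_inv_of_mul_eq_one_right hprod)
      rw [h1, mul_inv_cancel_left, mul_assoc, eq_inv_mul_iff_mul_eq, eq_inv_mul_iff_mul_eq,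
        ← mul_assoc, h, mul_inv_cancel_right]
    have hlt := sq_halfTrace_mul_sub_lt hnc
    have h1 : halfTrace (R x * g 0) = Real.cos (θ 1) := by
      have h2 : R x = (g 0 * g 1)⁻¹ := eq_inv_of_mul_eq_one_right (by rw [mul_assoc, hprod])
      rw [h2, mul_inv_rev, inv_mul_cancel_right, halfTrace_inv]
      exact (isConj_torusElt_iff (hθ 1) _).mp (hg.1 1)
    have h2 : halfTrace (g 0) = Real.cos (θ 0) := (isConj_torusElt_iff (hθ 0) _).mp (hg.1 0)
    rw [h1, h2, ← sinAngle_sq, ← Real.sin_sq, ← mul_pow] at hlt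
    have := abs_lt_of_sq_lt_sq hlt (mul_nonneg (sinAngle_nonneg _) hsb.le)
    rwa [abs_sub_comm] at this
  refine lt_of_lt_of_le (hUo.measure_pos (Measure.pi fun _ => haarSU2) hUne)
    (measure_mono_ae ?_)
  filter_upwards [hK0] with x hx hxU
  have hσ : 0 < sinAngle (R x) := by
    have := (abs_nonneg _).trans_lt (show _ < _ from hxU)
    exact (pos_iff_pos_of_mul_pos this).mpr hsb
  replace hxU : x ∈ U := hxU
  change W x ≠ 0
  rw [hW, Set.indicator_of_mem hxU]
  positivity

end Positivity

section Physical

theorem Fin.add_one_eq_mk {m i : ℕ} (h : i + 1 < m + 1) :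
    (⟨i, by omega⟩ : Fin (m + 1)) + 1 = ⟨i + 1, h⟩ := by
  apply Fin.ext
  rw [Fin.val_add_one_of_lt (by rw [Fin.lt_def, Fin.val_last]; exact Nat.lt_of_succ_lt_succ h)]

/-- If an irreducible flat configuration exists, then polynomials in the trace of the holonomy
around some pair of neighbouring particles have positive norm. -/
theorem exists_flatIntegral_pos {n : ℕ} [NeZero n] {θ : Fin n → ℝ}
    (hθ : ∀ p, θ p ∈ Set.Ioo 0 Real.pi) (hn : 4 ≤ n)
    (hg : ∃ g, IsFlatConfiguration θ g ∧ IsIrreducibleConfiguration g) :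
    ∃ q : Fin n, ∀ K : ℝ → ℝ, Continuous K → (∀ y, 0 ≤ K y) → {y | K y = 0}.Countable →
      0 < (flatIntegral θ fun C => ((K (halfTrace (C q * C (q + 1))) : ℝ) : ℂ)).re := by
  obtain ⟨m, rfl⟩ : ∃ m, n = m + 4 := ⟨n - 4, by omega⟩
  obtain ⟨g, hg, hirr⟩ := hg
  -- renumber the particles so that the two with noncommuting holonomies become `0` and `1`
  obtain ⟨i, hi, hne⟩ := exists_adjacent_not_commute hθ hg.1 hirr
  rw [← Fin.add_one_eq_mk hi] at hne
  generalize (⟨i, by omega⟩ : Fin (m + 4)) = q at hne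
  refine ⟨q, fun K hK h0 hz => ?_⟩
  have hθ' : ∀ p, θ (p + q) ∈ Set.Ioo 0 Real.pi := fun p => hθ _
  have hflat : IsFlatConfiguration (fun p => θ (p + q)) fun p => g (p + q) := by
    refine ⟨fun p => hg.1 _, ?_⟩
    obtain ⟨a, ha⟩ := exists_prod_ofFn_add q g
    rw [ha, hg.2, mul_one, mul_inv_cancel]
  have hpos := reducedLimit_pos hθ' hK h0 hz hflat (by rwa [zero_add, add_comm 1 q])
  have hc : Continuous fun C : Fin (m + 4) → SU2 =>
      ((K (halfTrace (C 0 * C 1)) : ℝ) : ℂ) :=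
    Complex.continuous_ofReal.comp (hK.comp (continuous_halfTrace.comp
      ((continuous_apply 0).mul (continuous_apply 1))))
  have hrot := flatIntegral_add_index hθ hn q hc
  simp only [zero_add, add_comm 1 q] at hrot
  rw [← hrot, flatIntegral_eq fun φ hφ => hφ.tendsto_reducedIntegral (m := m + 1) hθ' ?_ _ hc]
  · exact hpos
  · filter_upwards [ae_halfTrace_holonomyProduct_ne (fun p : Fin (m + 2) => θ (p.succ.succ + q))
      (fun p => hθ _) (Real.cos (θ (1 + q) + θ (0 + q))),
      ae_halfTrace_holonomyProduct_ne (fun p : Fin (m + 2) => θ (p.succ.succ + q))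
      (fun p => hθ _) (Real.cos (θ (1 + q) - θ (0 + q)))] with x h1 h2 h
    exact (halfTrace_eq_of_abs_eq h).elim h1 h2

variable {n : ℕ} [NeZero n]

/-- Polynomials in the trace of the holonomy around two neighbouring particles, as spin network
states. -/
def pairState (q : Fin n) : Polynomial ℂ →ₗ[ℂ] SpinNetworkState n where
  toFun P := (⟨_, eval_pairLoop_mem_spinNetworks q P⟩ : SpinNetworks n)
  map_add' P Q := by
    refine Subtype.ext (funext fun g => ?_)
    exact Polynomial.eval_add
  map_smul' c P := by
    refine Subtype.ext (funext fun g => ?_)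
    exact (Polynomial.eval_smul c P _).trans rfl

theorem pairState_reduced (q : Fin n) (P : Polynomial ℂ) (C : Fin n → SU2) :
    (pairState q P).reduced C = P.eval ((halfTrace (C q * C (q + 1)) : ℝ) : ℂ) := by
  rw [← pairLoop_gaugeFixedConnection]
  rfl

theorem inner_pairState_self_pos {θ : Fin n → ℝ} (hθ : IsRegularAngles θ) {q : Fin n}
    (hq : ∀ K : ℝ → ℝ, Continuous K → (∀ y, 0 ≤ K y) → {y | K y = 0}.Countable →
      0 < (flatIntegral θ fun C => ((K (halfTrace (C q * C (q + 1))) : ℝ) : ℂ)).re)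
    {P : Polynomial ℂ} (hP : P ≠ 0) :
    0 < ((physicalCore hθ).inner (pairState q P) (pairState q P)).re := by
  rw [physicalCore_inner]
  simp only [pairState_reduced, ← Complex.normSq_eq_conj_mul_self]
  refine hq (fun y => Complex.normSq (P.eval (y : ℂ))) ?_ (fun y => Complex.normSq_nonneg _) ?_
  · exact Complex.continuous_normSq.comp (P.continuous.comp Complex.continuous_ofReal)
  · refine Set.Finite.countable ((P.rootSet_finite ℂ).preimage
      Complex.ofReal_injective.injOn |>.subset fun y hy => ?_)
    rw [Set.mem_preimage, Polynomial.mem_rootSet_of_ne hP, Polynomial.coe_aeval_eq_eval]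
    exact Complex.normSq_eq_zero.mp hy

/-- The polynomials in the trace around two neighbouring particles embed into the physical Hilbert
space. -/
theorem not_finiteDimensional_physicalHilbertSpace {θ : Fin n → ℝ} (hθ : IsRegularAngles θ)
    (hn : 4 ≤ n) (hg : ∃ g, IsFlatConfiguration θ g ∧ IsIrreducibleConfiguration g) :
    ¬ FiniteDimensional ℂ (PhysicalHilbertSpace (physicalCore hθ)) := by
  obtain ⟨q, hq⟩ := exists_flatIntegral_pos hθ.1 hn hg
  intro hfin
  let L : SpinNetworkState.With (physicalCore hθ) →ₗ[ℂ] PhysicalHilbertSpace (physicalCore hθ) :=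
    (UniformSpace.Completion.toComplL (𝕜 := ℂ)).toLinearMap
  let M : Polynomial ℂ →ₗ[ℂ] SpinNetworkState.With (physicalCore hθ) :=
    { toFun := fun P => pairState q P
      map_add' := (pairState q).map_add
      map_smul' := (pairState q).map_smul }
  have hinj : Function.Injective (L ∘ₗ M) := by
    rw [← LinearMap.ker_eq_bot, LinearMap.ker_eq_bot']
    intro P hP
    by_contra hne
    have hpos := inner_pairState_self_pos hθ hq hne
    have h1 : inner ℂ (L (M P)) (L (M P)) = inner ℂ (M P) (M P) :=
      UniformSpace.Completion.inner_coe _ _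
    rw [show L (M P) = 0 from hP, inner_zero_left] at h1
    have h2 : (physicalCore hθ).inner (pairState q P) (pairState q P) = 0 := h1.symm
    rw [h2, Complex.zero_re] at hpos
    exact lt_irrefl _ hpos
  exact Polynomial.not_finite (Module.Finite.of_injective _ hinj)

/-- Spin network states have countable dimension, so they are separable for every seminorm. -/
theorem separableSpace_with (c : PreInnerProductSpace.Core ℂ (SpinNetworkState n)) :
    TopologicalSpace.SeparableSpace (SpinNetworkState.With c) := by
  let b := Module.Basis.ofVectorSpace ℂ (SpinNetworks n)
  have hb : (Set.range b).Countable := by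
    rw [← Cardinal.le_aleph0_iff_set_countable, b.mk_range_eq_rank]
    exact rank_spinNetworks_le
  have hb' : TopologicalSpace.IsSeparable (α := SpinNetworkState.With c) (Set.range b) :=
    Set.Countable.isSeparable (α := SpinNetworkState.With c) hb
  have hspan : (Submodule.span ℂ (Set.range b) : Set (SpinNetworks n)) = Set.univ := by
    rw [b.span_eq, Submodule.top_coe]
  have h := hb'.span (R := ℂ)
  exact TopologicalSpace.isSeparable_univ_iff.mp (hspan ▸ h)

end Physical

end

end

theorem mainTheorem4 (n : ℕ) [NeZero n] (θ : Fin n → ℝ)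
    (hθ : ∀ p, θ p ∈ Set.Ioo 0 Real.pi)
    (hreg : 4 ≤ n ∨ ∀ g, IsFlatConfiguration θ g → IsIrreducibleConfiguration g) :
    ∃ c : PreInnerProductSpace.Core ℂ (SpinNetworkState n),
      (∀ T : Finset (DualEdge n), IsMaximalDualTree T → ∀ Φf Φi : SpinNetworkState n,
        IsTransitionAmplitude θ T Φf.toFun Φi.toFun (c.inner Φf Φi)) ∧
      (∀ Φf Φi : SpinNetworkState n,
        IsReducedAmplitude θ Φf.toFun Φi.toFun (c.inner Φf Φi)) ∧
      (4 ≤ n → (∃ g, IsFlatConfiguration θ g ∧ IsIrreducibleConfiguration g) →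
        Nonempty (PhysicalHilbertSpace c ≃ₗᵢ[ℂ] L2SpherePower n)) := by
  refine ⟨physicalCore ⟨hθ, hreg⟩, fun T hT => isTransitionAmplitude_physicalCore _ hT,
    isReducedAmplitude_physicalCore _, fun hn hg => ?_⟩
  have := separableSpace_with (physicalCore (θ := θ) ⟨hθ, hreg⟩)
  exact nonempty_linearIsometryEquiv_of_separable
    (not_finiteDimensional_physicalHilbertSpace _ hn hg)
    (not_finiteDimensional_L2SpherePower (by omega))
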